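/- Let $\mathfrak B$ be a unital C$^*$-algebra. A free C$^*$-dynamical system $(\mathfrak A,\mathrm{SO}(2),\alpha)$ with fixed point algebra $\mathfrak B$ consists of a unital C$^*$-algebra $\mathfrak A$, a strongly continuous action $\alpha$ of $\mathrm{SO}(2)$ on $\mathfrak A$ by $^*$-automorphisms such that the span of the functions $g\mapsto x\,\alpha_g(y)$, $x,y\in\mathfrak A$, is dense in $C(\mathrm{SO}(2),\mathfrak A)$, and an identification of $\mathfrak B$ with the fixed point algebra $\mathfrak A^{\mathrm{SO}(2)}$ (an injective unital $^*$-homomorphism $\mathfrak B\to\mathfrak A$ with this range). Two such systems are equivalent if there is an $\mathrm{SO}(2)$-equivariant $^*$-isomorphism between them that is the identity on $\mathfrak B$; let $\mathrm{Ext}(\mathfrak B,\mathrm{SO}(2))$ be the set of equivalence classes. For $k\in\mathbb Z$ let $A(k)=\{x\in\mathfrak A:\alpha_g(x)=\chi(g)^k x \text{ for all } g\}$, where $\chi$ sends the rotation by the angle $\theta$ to $e^{i\theta}$. A Morita equivalence $\mathfrak B$-bimodule is a $\mathfrak B$-bimodule $N$ that is a full right and a full left Hilbert $\mathfrak B$-module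 with inner products $\langle\cdot,\cdot\rangle_{\mathfrak B}$ and ${}_{\mathfrak B}\langle\cdot,\cdot\rangle$, where either action is adjointable for the inner product of the other side and ${}_{\mathfrak B}\langle x,y\rangle z=x\langle y,z\rangle_{\mathfrak B}$. Let $\mathrm{Pic}(\mathfrak B)$ be the set of classes of such bimodules modulo bimodule isomorphisms preserving both inner products. For such an $N$ let $\bar N=\{\tilde x:x\in N\}$ be its dual bimodule, and let $N(0)=\mathfrak B$, $N(k)=N^{\otimes k}$ and $N(-k)=\bar N^{\otimes k}$ for $k>0$ (tensor products of Hilbert modules over $\mathfrak B$). Then: 1. For every free C$^*$-dynamical system $(\mathfrak A,\mathrm{SO}(2),\alpha)$ with fixed point algebra $\mathfrak B$ and every $k\in\mathbb Z$, the isotypic component $A(k)$ is a Morita equivalence $\mathfrak B$-bimodule with ${}_{\mathfrak B}\langle x,y\rangle=xy^*$ and $\langle x,y\rangle_{\mathfrak B}=x^*y$. 2. The map $\mathrm{Ext}(\mathfrak B,\mathrm{SO}(2))\to\mathrm{Pic}(\mathfrak B)$, $[(\mathfrak A,\mathrm{SO}(2),\alpha)]\mapsto[A(1)]$, is well defined and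 bijective. 3. Let $N$ be a Morita equivalence $\mathfrak B$-bimodule. There is exactly one family of bimodule isomorphisms $\Psi_{k,l}:N(k)\otimes_{\mathfrak B}N(l)\to N(k+l)$, $k,l\in\mathbb Z$, preserving the right inner products, which is associative, that is, $\Psi_{k_1+k_2,k_3}(\Psi_{k_1,k_2}\otimes\mathrm{id})=\Psi_{k_1,k_2+k_3}(\mathrm{id}\otimes\Psi_{k_2,k_3})$, and for which $\Psi_{0,k}(b\otimes x)=bx$, $\Psi_{k,0}(x\otimes b)=xb$, $\Psi_{k,1}$ and $\Psi_{-k,-1}$ are the identity of $N^{\otimes k}\otimes_{\mathfrak B}N=N^{\otimes(k+1)}$ and of $\bar N^{\otimes k}\otimes_{\mathfrak B}\bar N=\bar N^{\otimes(k+1)}$ for $k>0$, $\Psi_{1,-1}(x\otimes\tilde y)={}_{\mathfrak B}\langle x,y\rangle$ and $\Psi_{-1,1}(\tilde x\otimes y)=\langle x,y\rangle_{\mathfrak B}$. The inverse of the bijection in 2 sends $[N]$ to the class of the system given by this factor system: the class of $(\mathfrak A,\mathrm{SO}(2),\alpha)$ is the preimage of $[N]$ if and only if there are bimodule isomorphisms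 $\varphi_k:N(k)\to A(k)$, $k\in\mathbb Z$, preserving the right inner products, such that $\varphi_0$ is the given identification of $\mathfrak B$ with $A(0)$ and $\varphi_{k+l}(\Psi_{k,l}(x\otimes y))=\varphi_k(x)\varphi_l(y)$ for all $k,l\in\mathbb Z$, $x\in N(k)$, $y\in N(l)$. -/

import Mathlib

open scoped TensorProduct MulOpposite ComplexConjugate
open MulOpposite UniformSpace

universe u

noncomputable section

/-- A complex `B`-bimodule with a positive semi-definite `B`-valued right inner product for which
the left action of `B` is by adjointable maps. -/
structure PreCorrespondence (B : Type u) [CStarAlgebra B] where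
  carrier : Type u
  [addCommGroup : AddCommGroup carrier]
  [module : Module ℂ carrier]
  [leftModule : Module B carrier]
  [rightModule : Module Bᵐᵒᵖ carrier]
  [smulCommClass : SMulCommClass B Bᵐᵒᵖ carrier]
  [leftTower : IsScalarTower ℂ B carrier]
  [rightTower : IsScalarTower ℂ Bᵐᵒᵖ carrier]
  rinner : carrier → carrier → B
  rinner_add_right : ∀ x y z, rinner x (y + z) = rinner x y + rinner x z
  rinner_op_smul_right : ∀ x y (b : B), rinner x (op b • y) = rinner x y * b
  star_rinner : ∀ x y, star (rinner x y) = rinner y x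
  rinner_smul_left : ∀ (b : B) x y, rinner (b • x) y = rinner x (star b • y)
  rinner_self_nonneg : ∀ x, ∃ b, rinner x x = star b * b

attribute [instance] PreCorrespondence.addCommGroup PreCorrespondence.module
  PreCorrespondence.leftModule PreCorrespondence.rightModule PreCorrespondence.smulCommClass
  PreCorrespondence.leftTower PreCorrespondence.rightTower

namespace PreCorrespondence

variable {B : Type u} [CStarAlgebra B] (P : PreCorrespondence B)

theorem rinner_add_left (x y z : P.carrier) :
    P.rinner (x + y) z = P.rinner x z + P.rinner y z := by
  rw [← P.star_rinner z, P.rinner_add_right, star_add, P.star_rinner, P.star_rinner]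

theorem complex_smul_eq (c : ℂ) (x : P.carrier) : c • x = op (c • (1 : B)) • x := by
  rw [op_smul, smul_assoc, op_one, one_smul]

theorem rinner_smul_right (c : ℂ) (x y : P.carrier) :
    P.rinner x (c • y) = c • P.rinner x y := by
  rw [P.complex_smul_eq, P.rinner_op_smul_right, mul_smul_comm, mul_one]

theorem rinner_smul_left_complex (c : ℂ) (x y : P.carrier) :
    P.rinner (c • x) y = conj c • P.rinner x y := by
  rw [← P.star_rinner y, P.rinner_smul_right, star_smul, P.star_rinner]; rfl

theorem rinner_op_smul_left (b : B) (x y : P.carrier) :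
    P.rinner (op b • x) y = star b * P.rinner x y := by
  rw [← P.star_rinner y, P.rinner_op_smul_right, star_mul, P.star_rinner]

/-- The inner product as a sesquilinear map. -/
def sesq : P.carrier →ₗ⋆[ℂ] P.carrier →ₗ[ℂ] B where
  toFun x :=
    { toFun := fun y => P.rinner x y
      map_add' := P.rinner_add_right x
      map_smul' := fun c y => P.rinner_smul_right c x y }
  map_add' x y := LinearMap.ext fun z => P.rinner_add_left x y z
  map_smul' c x := LinearMap.ext fun z => P.rinner_smul_left_complex c x z

theorem sesq_apply (x y : P.carrier) : P.sesq x y = P.rinner x y := rfl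

theorem rinner_sum_sum {ι : Type*} (s : Finset ι) (x y : ι → P.carrier) :
    P.rinner (∑ i ∈ s, x i) (∑ j ∈ s, y j) = ∑ i ∈ s, ∑ j ∈ s, P.rinner (x i) (y j) := by
  simp only [← P.sesq_apply, map_sum, LinearMap.sum_apply]
  exact Finset.sum_comm

theorem rinner_sub_self (x y : P.carrier) : P.rinner (x - y) (x - y) =
    P.rinner x x - P.rinner x y - P.rinner y x + P.rinner y y := by
  simp only [← P.sesq_apply, map_sub, LinearMap.sub_apply]; abel

theorem norm_rinner_sq_le (x y : P.carrier) :
    ‖P.rinner x y‖ ^ 2 ≤ ‖P.rinner x x‖ * ‖P.rinner y y‖ := by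
  let _ := CStarAlgebra.spectralOrder B
  let _ := CStarAlgebra.spectralOrderedRing B
  have hpos : ∀ z, 0 ≤ P.rinner z z := fun z => by
    obtain ⟨b, hb⟩ := P.rinner_self_nonneg z
    rw [hb]; exact star_mul_self_nonneg b
  set a := P.rinner x y with ha
  have hyx : P.rinner y x = star a := (P.star_rinner x y).symm
  -- for every `t > ‖⟨x, x⟩‖`, `a* a ≤ t ⟨y, y⟩`
  have key : ∀ t : ℝ, ‖P.rinner x x‖ < t → ‖a‖ ^ 2 ≤ t * ‖P.rinner y y‖ := by
    intro t ht
    have ht0 : 0 < t := lt_of_le_of_lt (norm_nonneg _) ht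
    have h1 : 0 ≤ star a * P.rinner x x * a - (t : ℂ) • (star a * a) - (t : ℂ) • (star a * a)
        + (t : ℂ) • (t : ℂ) • P.rinner y y := by
      refine (hpos (op a • x - (t : ℂ) • y)).trans_eq ?_
      rw [P.rinner_sub_self]
      simp only [P.rinner_op_smul_left, P.rinner_op_smul_right, P.rinner_smul_right,
        P.rinner_smul_left_complex, Complex.conj_ofReal, ← ha, hyx, mul_assoc,
        smul_mul_assoc, mul_smul_comm]
    have h2 : star a * P.rinner x x * a ≤ t • (star a * a) := by
      refine (CStarAlgebra.star_left_conjugate_le_norm_smul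
        (hb := (hpos x).isSelfAdjoint)).trans ?_
      exact smul_le_smul_of_nonneg_right ht.le (star_mul_self_nonneg a)
    have h3 : t • (star a * a) ≤ t • t • P.rinner y y := by
      have h4 : (0 : B) ≤ t • (star a * a) - t • (star a * a) - t • (star a * a)
        + t • t • P.rinner y y := by
        refine h1.trans ?_
        simp only [Complex.coe_smul]
        gcongr
      simpa [add_comm, ← sub_eq_add_neg] using h4
    have h5 : star a * a ≤ t • P.rinner y y := (smul_le_smul_iff_of_pos_left ht0).1 h3
    have := CStarAlgebra.norm_le_norm_of_nonneg_of_le (star_mul_self_nonneg a) h5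
    rwa [CStarRing.norm_star_mul_self, norm_smul, Real.norm_of_nonneg ht0.le, ← pow_two] at this
  refine le_of_forall_pos_le_add fun ε hε => ?_
  have hN : 0 < ‖P.rinner y y‖ + 1 := by positivity
  refine (key (‖P.rinner x x‖ + ε / (‖P.rinner y y‖ + 1))
    (lt_add_of_pos_right _ (by positivity))).trans ?_
  rw [add_mul]
  gcongr
  rw [div_mul_eq_mul_div, div_le_iff₀ hN]
  gcongr
  linarith

theorem norm_rinner_le (x y : P.carrier) :
    ‖P.rinner x y‖ ≤ √‖P.rinner x x‖ * √‖P.rinner y y‖ := by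
  rw [← Real.sqrt_mul (norm_nonneg _)]
  exact Real.le_sqrt_of_sq_le (P.norm_rinner_sq_le x y)

/-- The seminorm `‖x‖ = ‖⟨x, x⟩‖ ^ (1 / 2)`. -/
instance : SeminormedAddCommGroup P.carrier :=
  { P.addCommGroup, AddGroupSeminorm.toSeminormedAddCommGroup
    { toFun := fun x : P.carrier => √‖P.rinner x x‖
      map_zero' := by simp [← P.sesq_apply]
      neg' := fun x => by simp [← P.sesq_apply]
      add_le' := fun x y => by
        refine Real.sqrt_le_iff.2 ⟨by positivity, ?_⟩
        have h1 := P.norm_rinner_le x y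
        have h2 := P.norm_rinner_le y x
        have h3 := Real.sq_sqrt (norm_nonneg (P.rinner x x))
        have h4 := Real.sq_sqrt (norm_nonneg (P.rinner y y))
        have h5 : P.rinner (x + y) (x + y) =
          P.rinner x x + P.rinner x y + P.rinner y x + P.rinner y y := by
          rw [P.rinner_add_left, P.rinner_add_right, P.rinner_add_right]; abel
        have h6 : ‖P.rinner (x + y) (x + y)‖ ≤
          ‖P.rinner x x‖ + ‖P.rinner x y‖ + ‖P.rinner y x‖ + ‖P.rinner y y‖ := by
          rw [h5]
          exact (norm_add_le _ _).trans (by gcongr; exact norm_add₃_le)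
        nlinarith } with }

theorem norm_def (x : P.carrier) : ‖x‖ = √‖P.rinner x x‖ := rfl

theorem norm_sq (x : P.carrier) : ‖x‖ ^ 2 = ‖P.rinner x x‖ :=
  Real.sq_sqrt (norm_nonneg _)

instance : NormedSpace ℂ P.carrier :=
  { P.module with
    norm_smul_le := fun c x => by
      refine (pow_le_pow_iff_left₀ (norm_nonneg _) (by positivity) two_ne_zero).1 ?_
      rw [mul_pow, P.norm_sq, P.norm_sq, P.rinner_smul_right, P.rinner_smul_left_complex,
        norm_smul, norm_smul, RCLike.norm_conj, ← mul_assoc, ← pow_two] }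

theorem norm_smul_le_left (b : B) (x : P.carrier) : ‖b • x‖ ≤ ‖b‖ * ‖x‖ := by
  let _ := CStarAlgebra.spectralOrder B
  let _ := CStarAlgebra.spectralOrderedRing B
  have hpos : ∀ z, 0 ≤ P.rinner z z := fun z => by
    obtain ⟨b, hb⟩ := P.rinner_self_nonneg z
    rw [hb]; exact star_mul_self_nonneg b
  have h1 : star b * b ≤ ((‖b‖ ^ 2 : ℝ) : ℂ) • (1 : B) := by
    have := CStarAlgebra.star_mul_le_algebraMap_norm_sq (a := b)
    rwa [Algebra.algebraMap_eq_smul_one, ← Complex.coe_smul] at this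
  obtain ⟨c, hc⟩ := CStarAlgebra.nonneg_iff_eq_star_mul_self.1 (sub_nonneg.2 h1)
  have h2 : P.rinner (c • x) (c • x) =
      (‖b‖ ^ 2 : ℝ) • P.rinner x x - P.rinner (b • x) (b • x) := by
    rw [P.rinner_smul_left, P.rinner_smul_left, ← mul_smul, ← mul_smul, ← hc, sub_smul,
      smul_assoc, one_smul, ← P.sesq_apply, map_sub, map_smul, Complex.coe_smul]
    rfl
  have h3 : P.rinner (b • x) (b • x) ≤ (‖b‖ ^ 2 : ℝ) • P.rinner x x :=
    sub_nonneg.1 (h2 ▸ hpos _)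
  refine (pow_le_pow_iff_left₀ (norm_nonneg _) (by positivity) two_ne_zero).1 ?_
  rw [mul_pow, P.norm_sq, P.norm_sq]
  refine (CStarAlgebra.norm_le_norm_of_nonneg_of_le (hpos _) h3).trans_eq ?_
  rw [norm_smul, Real.norm_of_nonneg (by positivity)]

theorem norm_smul_le_right (b : Bᵐᵒᵖ) (x : P.carrier) : ‖b • x‖ ≤ ‖b‖ * ‖x‖ := by
  refine (pow_le_pow_iff_left₀ (norm_nonneg _) (by positivity) two_ne_zero).1 ?_
  obtain ⟨b, rfl⟩ := op_surjective b
  rw [mul_pow, P.norm_sq, P.norm_sq, P.rinner_op_smul_left, P.rinner_op_smul_right, norm_op]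
  refine (norm_mul_le _ _).trans ?_
  rw [norm_star, pow_two, mul_assoc]
  gcongr
  refine (norm_mul_le _ _).trans_eq (mul_comm _ _)

instance : UniformContinuousConstSMul B P.carrier :=
  ⟨fun b => AddMonoidHomClass.uniformContinuous_of_bound
    (DistribSMul.toAddMonoidHom P.carrier b) ‖b‖ (P.norm_smul_le_left b)⟩

instance : UniformContinuousConstSMul Bᵐᵒᵖ P.carrier :=
  ⟨fun b => AddMonoidHomClass.uniformContinuous_of_bound
    (DistribSMul.toAddMonoidHom P.carrier b) ‖b‖ (P.norm_smul_le_right b)⟩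

/-- The inner product on the completion, the continuous extension of `P.rinner`. -/
def completionInner (x y : Completion P.carrier) : B :=
  (Completion.isDenseInducing_coe.prodMap Completion.isDenseInducing_coe).extend
    (fun p : P.carrier × P.carrier => P.rinner p.1 p.2) (x, y)

theorem continuous_rinner : Continuous fun p : P.carrier × P.carrier => P.rinner p.1 p.2 := by
  let f : P.carrier →L⋆[ℂ] P.carrier →L[ℂ] B := LinearMap.mkContinuous₂ P.sesq 1 fun x y => by
    rw [one_mul]; exact P.norm_rinner_le x y
  exact (f.continuous.comp continuous_fst).clm_apply continuous_snd

theorem completionInner_coe (x y : P.carrier) :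
    P.completionInner (x : Completion P.carrier) (y : Completion P.carrier) = P.rinner x y :=
  (Completion.isDenseInducing_coe.prodMap Completion.isDenseInducing_coe).extend_eq
    P.continuous_rinner (x, y)

theorem continuous_completionInner :
    Continuous fun p : Completion P.carrier × Completion P.carrier =>
      P.completionInner p.1 p.2 := by
  let inner' : P.carrier →+ P.carrier →+ B :=
    { toFun := fun x => (P.sesq x).toAddMonoidHom
      map_zero' := by ext x; simp
      map_add' := fun x y => by ext z; simp }
  have : Continuous fun p : P.carrier × P.carrier => inner' p.1 p.2 := P.continuous_rinner
  exact (Completion.isDenseInducing_toCompl P.carrier).extend_Z_bilin (Completion.isDenseInducing_toCompl P.carrier) this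

end PreCorrespondence

/-- A correspondence over `B`: a `B`-bimodule which is a right Hilbert `B`-module (complete for the
norm `‖x‖ = ‖⟨x, x⟩‖ ^ (1 / 2)`) on which `B` acts from the left by adjointable maps. The right
action of `b` is `op b • x`. -/
structure Correspondence (B : Type u) [CStarAlgebra B] where
  carrier : Type u
  [normedAddCommGroup : NormedAddCommGroup carrier]
  [normedSpace : NormedSpace ℂ carrier]
  [completeSpace : CompleteSpace carrier]
  [leftModule : Module B carrier]
  [rightModule : Module Bᵐᵒᵖ carrier]
  [smulCommClass : SMulCommClass B Bᵐᵒᵖ carrier]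
  [leftTower : IsScalarTower ℂ B carrier]
  [rightTower : IsScalarTower ℂ Bᵐᵒᵖ carrier]
  rinner : carrier → carrier → B
  rinner_add_right : ∀ x y z, rinner x (y + z) = rinner x y + rinner x z
  rinner_op_smul_right : ∀ x y (b : B), rinner x (op b • y) = rinner x y * b
  star_rinner : ∀ x y, star (rinner x y) = rinner y x
  rinner_smul_left : ∀ (b : B) x y, rinner (b • x) y = rinner x (star b • y)
  rinner_self_nonneg : ∀ x, ∃ b, rinner x x = star b * b
  norm_sq_eq_rinner : ∀ x, ‖x‖ ^ 2 = ‖rinner x x‖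

attribute [instance] Correspondence.normedAddCommGroup Correspondence.normedSpace
  Correspondence.completeSpace Correspondence.leftModule Correspondence.rightModule
  Correspondence.smulCommClass Correspondence.leftTower Correspondence.rightTower

variable {B : Type u} [CStarAlgebra B]

theorem exists_star_mul_self_of_mem_closure {s : Set B} (hs : ∀ a ∈ s, ∃ b, a = star b * b) {a : B}
    (ha : a ∈ closure s) : ∃ b, a = star b * b := by
  let _ := CStarAlgebra.spectralOrder B
  let _ := CStarAlgebra.spectralOrderedRing B
  rw [← CStarAlgebra.nonneg_iff_eq_star_mul_self]
  refine closure_minimal (fun c hc => ?_) (CStarAlgebra.isClosed_nonneg (A := B)) ha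
  exact CStarAlgebra.nonneg_iff_eq_star_mul_self.2 (hs c hc)

/-- The Hausdorff completion of a pre-correspondence. -/
def PreCorrespondence.completion (P : PreCorrespondence B) : Correspondence B where
  carrier := Completion P.carrier
  rinner := P.completionInner
  rinner_add_right x y z := by
    have hc := P.continuous_completionInner
    refine Completion.induction_on₃ x y z (isClosed_eq ?_ ?_) fun x y z => ?_
    · exact hc.comp (continuous_fst.prodMk (by fun_prop))
    · exact (hc.comp (continuous_fst.prodMk (continuous_fst.comp continuous_snd))).add
        (hc.comp (continuous_fst.prodMk (continuous_snd.comp continuous_snd)))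
    · rw [← Completion.coe_add]
      simp only [P.completionInner_coe, P.rinner_add_right]
  rinner_op_smul_right x y b := by
    have hc := P.continuous_completionInner
    refine Completion.induction_on₂ x y (isClosed_eq ?_ ?_) fun x y => ?_
    · exact hc.comp (continuous_fst.prodMk ((uniformContinuous_const_smul _).continuous.comp continuous_snd))
    · exact hc.mul continuous_const
    · rw [← Completion.coe_smul]
      simp only [P.completionInner_coe, P.rinner_op_smul_right]
  star_rinner x y := by
    have hc := P.continuous_completionInner
    refine Completion.induction_on₂ x y (isClosed_eq ?_ ?_) fun x y => ?_
    · exact hc.star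
    · exact hc.comp (continuous_snd.prodMk continuous_fst)
    · simp only [P.completionInner_coe, P.star_rinner]
  rinner_smul_left b x y := by
    have hc := P.continuous_completionInner
    refine Completion.induction_on₂ x y (isClosed_eq ?_ ?_) fun x y => ?_
    · exact hc.comp (((uniformContinuous_const_smul _).continuous.comp continuous_fst).prodMk continuous_snd)
    · exact hc.comp (continuous_fst.prodMk ((uniformContinuous_const_smul _).continuous.comp continuous_snd))
    · rw [← Completion.coe_smul, ← Completion.coe_smul]
      simp only [P.completionInner_coe, P.rinner_smul_left]
  rinner_self_nonneg x := by
    have hc : Continuous fun x => P.completionInner x x :=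
      P.continuous_completionInner.comp (continuous_id.prodMk continuous_id)
    refine exists_star_mul_self_of_mem_closure
      (s := Set.range fun x : P.carrier => P.rinner x x) ?_ ?_
    · rintro _ ⟨x, rfl⟩; exact P.rinner_self_nonneg x
    · refine closure_mono ?_ (hc.range_subset_closure_image_dense Completion.denseRange_coe ⟨x, rfl⟩)
      rintro _ ⟨_, ⟨y, rfl⟩, rfl⟩
      exact ⟨y, (P.completionInner_coe y y).symm⟩
  norm_sq_eq_rinner x := by
    have hc : Continuous fun x => P.completionInner x x :=
      P.continuous_completionInner.comp (continuous_id.prodMk continuous_id)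
    refine Completion.induction_on x (isClosed_eq (by fun_prop) hc.norm) fun x => ?_
    rw [Completion.norm_coe, P.completionInner_coe, P.norm_sq]

theorem exists_eq_star_mul_self_of_conjugates {C : Type*} [CStarAlgebra C] {a : C}
    (ha : IsSelfAdjoint a) (h : ∀ d e : C, star d * a * d = -(star e * e) → e = 0) :
    ∃ c, a = star c * c := by
  let _ := CStarAlgebra.spectralOrder C
  let _ := CStarAlgebra.spectralOrderedRing C
  have hd : 0 ≤ a⁻ := CFC.negPart_nonneg a
  have hd3 : 0 ≤ a⁻ * a⁻ * a⁻ := by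
    have := star_left_conjugate_nonneg hd a⁻
    rwa [hd.isSelfAdjoint.star_eq] at this
  obtain ⟨e, he⟩ := CStarAlgebra.nonneg_iff_eq_star_mul_self.1 hd3
  have hada : star a⁻ * a * a⁻ = -(star e * e) := by
    rw [← he, hd.isSelfAdjoint.star_eq]
    nth_rw 2 [← CFC.posPart_sub_negPart a ha]
    rw [mul_sub, CFC.negPart_mul_posPart, zero_sub, neg_mul]
  have hd0 : a⁻ = 0 := by
    have h0 : a⁻ * a⁻ * a⁻ = 0 := by rw [he, h _ _ hada, mul_zero]
    have h1 : star (star a⁻ * a⁻) * (star a⁻ * a⁻) = 0 := by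
      rw [star_mul, star_star, hd.isSelfAdjoint.star_eq, ← mul_assoc, h0, zero_mul]
    exact (CStarRing.star_mul_self_eq_zero_iff _).1 ((CStarRing.star_mul_self_eq_zero_iff _).1 h1)
  exact CStarAlgebra.nonneg_iff_eq_star_mul_self.1 ((CFC.negPart_eq_zero_iff a ha).1 hd0)

namespace Correspondence

/-- Forget the norm of a correspondence. -/
def toPre (M : Correspondence B) : PreCorrespondence B where
  carrier := M.carrier
  rinner := M.rinner
  rinner_add_right := M.rinner_add_right
  rinner_op_smul_right := M.rinner_op_smul_right
  star_rinner := M.star_rinner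
  rinner_smul_left := M.rinner_smul_left
  rinner_self_nonneg := M.rinner_self_nonneg

variable (M N : Correspondence B)

theorem rinner_sum_sum {ι : Type*} (s : Finset ι) (x y : ι → M.carrier) :
    M.rinner (∑ i ∈ s, x i) (∑ j ∈ s, y j) = ∑ i ∈ s, ∑ j ∈ s, M.rinner (x i) (y j) :=
  M.toPre.rinner_sum_sum s x y

theorem rinner_sum_right {ι : Type*} (s : Finset ι) (x : M.carrier) (y : ι → M.carrier) :
    M.rinner x (∑ j ∈ s, y j) = ∑ j ∈ s, M.rinner x (y j) :=
  map_sum (M.toPre.sesq x) y s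

theorem rinner_add_left (x y z : M.carrier) :
    M.rinner (x + y) z = M.rinner x z + M.rinner y z :=
  M.toPre.rinner_add_left x y z

theorem rinner_smul_right (c : ℂ) (x y : M.carrier) :
    M.rinner x (c • y) = c • M.rinner x y :=
  M.toPre.rinner_smul_right c x y

theorem rinner_smul_left_complex (c : ℂ) (x y : M.carrier) :
    M.rinner (c • x) y = conj c • M.rinner x y :=
  M.toPre.rinner_smul_left_complex c x y

theorem rinner_op_smul_left (b : B) (x y : M.carrier) :
    M.rinner (op b • x) y = star b * M.rinner x y :=
  M.toPre.rinner_op_smul_left b x y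

/-- Gram matrices are positive in the matrix algebra over `B`. -/
theorem exists_gram {n : ℕ} (x : Fin n → M.carrier) :
    ∃ c : Fin n → Fin n → B, ∀ i j, M.rinner (x i) (x j) = ∑ k, star (c k i) * c k j := by
  let _ := CStarAlgebra.spectralOrder B
  let _ := CStarAlgebra.spectralOrderedRing B
  let a : CStarMatrix (Fin n) (Fin n) B := CStarMatrix.ofMatrix fun i j => M.rinner (x i) (x j)
  have ha : IsSelfAdjoint a := by
    ext i j
    rw [CStarMatrix.star_apply]
    exact M.star_rinner _ _
  obtain ⟨c, hc⟩ := exists_eq_star_mul_self_of_conjugates ha fun d e hde => by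
    ext i j
    have h1 : (star d * a * d) j j =
        M.rinner (∑ i, op (d i j) • x i) (∑ k, op (d k j) • x k) := by
      rw [M.rinner_sum_sum, CStarMatrix.mul_apply, Finset.sum_comm]
      refine Finset.sum_congr rfl fun k _ => ?_
      rw [CStarMatrix.mul_apply, Finset.sum_mul]
      refine Finset.sum_congr rfl fun i _ => ?_
      rw [M.rinner_op_smul_left, M.rinner_op_smul_right, CStarMatrix.star_apply, mul_assoc]
      rfl
    obtain ⟨b, hb⟩ := M.rinner_self_nonneg (∑ i, op (d i j) • x i)
    have h2 : 0 ≤ -((star e * e) j j) := by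
      rw [← CStarMatrix.neg_apply, ← hde, h1, hb]
      exact star_mul_self_nonneg b
    have h3 : (star e * e) j j = ∑ i, star (e i j) * e i j := by
      rw [CStarMatrix.mul_apply]; rfl
    have h4 : ∑ i, star (e i j) * e i j = 0 :=
      le_antisymm (h3 ▸ neg_nonneg.1 h2) (Finset.sum_nonneg fun i _ => star_mul_self_nonneg _)
    have h5 := (Finset.sum_eq_zero_iff_of_nonneg
      fun i _ => star_mul_self_nonneg (e i j)).1 h4 i (Finset.mem_univ i)
    exact CStarRing.star_mul_self_eq_zero_iff _ |>.1 h5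
  refine ⟨fun k i => c k i, fun i j => ?_⟩
  have := congrArg (fun m : CStarMatrix (Fin n) (Fin n) B => m i j) hc
  simp only [CStarMatrix.mul_apply, CStarMatrix.star_apply] at this
  exact this

/-- The algebraic tensor product over `ℂ` underlying the interior tensor product; `B` acts from the
left on the first and from the right on the second factor. -/
def TensorCarrier : Type u := M.carrier ⊗[ℂ] N.carrier

namespace TensorCarrier

instance : AddCommGroup (TensorCarrier M N) :=
  inferInstanceAs (AddCommGroup (M.carrier ⊗[ℂ] N.carrier))

instance : Module ℂ (TensorCarrier M N) :=
  inferInstanceAs (Module ℂ (M.carrier ⊗[ℂ] N.carrier))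

instance : Module B (TensorCarrier M N) :=
  inferInstanceAs (Module B (M.carrier ⊗[ℂ] N.carrier))

instance : IsScalarTower ℂ B (TensorCarrier M N) :=
  inferInstanceAs (IsScalarTower ℂ B (M.carrier ⊗[ℂ] N.carrier))

instance : Module Bᵐᵒᵖ (TensorCarrier M N) :=
  Module.compHom (M.carrier ⊗[ℂ] N.carrier)
    ((Module.End.lTensorAlgHom ℂ N.carrier M.carrier).comp
      (Algebra.lsmul ℂ ℂ N.carrier : Bᵐᵒᵖ →ₐ[ℂ] Module.End ℂ N.carrier)).toRingHom

variable {M N} in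
/-- The elementary tensor `x ⊗ y`. -/
def tmul (x : M.carrier) (y : N.carrier) : TensorCarrier M N := x ⊗ₜ[ℂ] y

variable {M N}

theorem smul_tmul (b : B) (x : M.carrier) (y : N.carrier) : b • tmul x y = tmul (b • x) y := rfl

theorem op_smul_tmul (b : Bᵐᵒᵖ) (x : M.carrier) (y : N.carrier) :
    b • tmul x y = tmul x (b • y) := rfl

theorem complex_smul_tmul (c : ℂ) (x : M.carrier) (y : N.carrier) :
    c • tmul x y = tmul (c • x) y := rfl

@[elab_as_elim]
theorem induction {p : TensorCarrier M N → Prop} (t : TensorCarrier M N)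
    (h : ∀ x y, p (tmul x y)) (hadd : ∀ s t, p s → p t → p (s + t)) : p t :=
  TensorProduct.induction_on t
    (by simpa [tmul] using h 0 0)
    h hadd

theorem exists_eq_sum (t : TensorCarrier M N) :
    ∃ (n : ℕ) (x : Fin n → M.carrier) (y : Fin n → N.carrier), t = ∑ i, tmul (x i) (y i) := by
  induction t using induction with
  | h x y => exact ⟨1, fun _ => x, fun _ => y, by simp⟩
  | hadd s t hs ht =>
    obtain ⟨n, x, y, rfl⟩ := hs
    obtain ⟨m, x', y', rfl⟩ := ht
    exact ⟨n + m, Fin.append x x', Fin.append y y', by simp [Fin.sum_univ_add]⟩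

variable (M N)

instance : IsScalarTower ℂ Bᵐᵒᵖ (TensorCarrier M N) where
  smul_assoc c b t := by
    induction t using induction with
    | h x y =>
      rw [op_smul_tmul, op_smul_tmul, smul_assoc]
      exact TensorProduct.tmul_smul c x (b • y)
    | hadd s t hs ht => rw [smul_add, smul_add, smul_add, hs, ht]

instance : SMulCommClass B Bᵐᵒᵖ (TensorCarrier M N) where
  smul_comm a b t := by
    induction t using induction with
    | h x y => rfl
    | hadd s t hs ht => rw [smul_add, smul_add, smul_add, smul_add, hs, ht]

/-- The sesquilinear map with `⟨x₁ ⊗ y₁, x₂ ⊗ y₂⟩ = ⟨y₁, ⟨x₁, x₂⟩ • y₂⟩`. -/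
def sesq : TensorCarrier M N →ₗ⋆[ℂ] TensorCarrier M N →ₗ[ℂ] B :=
  TensorProduct.lift (LinearMap.mk₂'ₛₗ (starRingEnd ℂ) (starRingEnd ℂ)
    (fun x y => TensorProduct.lift (LinearMap.mk₂ ℂ
      (fun x' y' => N.rinner y (M.rinner x x' • y'))
      (fun x₁ x₂ y' => by rw [M.rinner_add_right, add_smul, N.rinner_add_right])
      (fun c x' y' => by rw [M.rinner_smul_right, smul_assoc, N.rinner_smul_right])
      (fun x' y₁ y₂ => by rw [smul_add, N.rinner_add_right])
      (fun c x' y' => by rw [smul_comm, N.rinner_smul_right])))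
    (fun x₁ x₂ y => TensorProduct.ext' fun x' y' => by
      change N.rinner y (M.rinner (x₁ + x₂) x' • y') =
        N.rinner y (M.rinner x₁ x' • y') + N.rinner y (M.rinner x₂ x' • y')
      rw [M.rinner_add_left, add_smul, N.rinner_add_right])
    (fun c x y => TensorProduct.ext' fun x' y' => by
      change N.rinner y (M.rinner (c • x) x' • y') = conj c • N.rinner y (M.rinner x x' • y')
      rw [M.rinner_smul_left_complex, smul_assoc, N.rinner_smul_right])
    (fun x y₁ y₂ => TensorProduct.ext' fun x' y' => by
      change N.rinner (y₁ + y₂) (M.rinner x x' • y') =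
        N.rinner y₁ (M.rinner x x' • y') + N.rinner y₂ (M.rinner x x' • y')
      rw [N.rinner_add_left])
    (fun c x y => TensorProduct.ext' fun x' y' => by
      change N.rinner (c • y) (M.rinner x x' • y') = conj c • N.rinner y (M.rinner x x' • y')
      rw [N.rinner_smul_left_complex]))

theorem sesq_tmul (x x' : M.carrier) (y y' : N.carrier) :
    sesq M N (tmul x y) (tmul x' y') = N.rinner y (M.rinner x x' • y') := rfl

end TensorCarrier

/-- The algebraic tensor product of two correspondences with its semi-inner product. -/
def preTensor : PreCorrespondence B where
  carrier := TensorCarrier M N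
  rinner := fun s t => TensorCarrier.sesq M N s t
  rinner_add_right s := map_add _
  rinner_op_smul_right s t b := by
    induction s using TensorCarrier.induction with
    | h x y =>
      induction t using TensorCarrier.induction with
      | h x' y' =>
        rw [TensorCarrier.op_smul_tmul, TensorCarrier.sesq_tmul, TensorCarrier.sesq_tmul,
          smul_comm, N.rinner_op_smul_right]
      | hadd t t' h h' => rw [smul_add, map_add, map_add, h, h', add_mul]
    | hadd s s' h h' => rw [map_add, LinearMap.add_apply, LinearMap.add_apply, h, h', add_mul]
  star_rinner s t := by
    induction s using TensorCarrier.induction with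
    | h x y =>
      induction t using TensorCarrier.induction with
      | h x' y' =>
        rw [TensorCarrier.sesq_tmul, TensorCarrier.sesq_tmul, N.star_rinner, N.rinner_smul_left,
          M.star_rinner]
      | hadd t t' h h' => rw [map_add, map_add, LinearMap.add_apply, star_add, h, h']
    | hadd s s' h h' => rw [map_add, map_add, LinearMap.add_apply, star_add, h, h']
  rinner_smul_left b s t := by
    induction s using TensorCarrier.induction with
    | h x y =>
      induction t using TensorCarrier.induction with
      | h x' y' =>
        rw [TensorCarrier.smul_tmul, TensorCarrier.smul_tmul, TensorCarrier.sesq_tmul,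
          TensorCarrier.sesq_tmul, M.rinner_smul_left]
      | hadd t t' h h' => rw [smul_add, map_add, map_add, h, h']
    | hadd s s' h h' =>
      rw [smul_add, map_add, map_add, LinearMap.add_apply, LinearMap.add_apply, h, h']
  rinner_self_nonneg t := by
    let _ := CStarAlgebra.spectralOrder B
    let _ := CStarAlgebra.spectralOrderedRing B
    rw [← CStarAlgebra.nonneg_iff_eq_star_mul_self]
    obtain ⟨n, x, y, rfl⟩ := TensorCarrier.exists_eq_sum t
    obtain ⟨c, hc⟩ := M.exists_gram x
    have h : TensorCarrier.sesq M N (∑ i, TensorCarrier.tmul (x i) (y i))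
        (∑ i, TensorCarrier.tmul (x i) (y i)) =
        ∑ k, N.rinner (∑ i, c k i • y i) (∑ j, c k j • y j) := by
      simp only [map_sum, LinearMap.sum_apply, TensorCarrier.sesq_tmul, N.rinner_sum_sum, hc,
        Finset.sum_smul, N.rinner_smul_left, ← mul_smul]
      rw [Finset.sum_comm]
      simp only [N.rinner_sum_right]
      exact (Finset.sum_congr rfl fun i _ => Finset.sum_comm).trans Finset.sum_comm
    rw [h]
    refine Finset.sum_nonneg fun k _ => ?_
    obtain ⟨b, hb⟩ := N.rinner_self_nonneg (∑ i, c k i • y i)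
    rw [hb]; exact star_mul_self_nonneg b

/-- The (interior) tensor product `M ⊗_B N` of correspondences: the Hausdorff completion of the
algebraic tensor product for the inner product
`⟨x₁ ⊗ y₁, x₂ ⊗ y₂⟩ = ⟨y₁, ⟨x₁, x₂⟩ • y₂⟩`. (The vectors `(x • b) ⊗ y - x ⊗ (b • y)` have length
zero, so that this is balanced over `B`.) -/
def tensor : Correspondence B := (preTensor M N).completion

variable {M N}

/-- The elementary tensor `x ⊗ y` in `M ⊗_B N`. -/
def tmul (x : M.carrier) (y : N.carrier) : (tensor M N).carrier :=
  Completion.coe' (α := (preTensor M N).carrier) (TensorCarrier.tmul x y)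

theorem rinner_tmul (x x' : M.carrier) (y y' : N.carrier) :
    (tensor M N).rinner (tmul x y) (tmul x' y') = N.rinner y (M.rinner x x' • y') :=
  (preTensor M N).completionInner_coe _ _

theorem tmul_balanced (x : M.carrier) (b : B) (y : N.carrier) :
    tmul (op b • x) y = tmul x (b • y) := by
  have h : ‖tmul (op b • x) y - tmul x (b • y)‖ ^ 2 = 0 := by
    rw [norm_sq_eq_rinner, norm_eq_zero]
    refine ((tensor M N).toPre.rinner_sub_self (tmul (op b • x) y) (tmul x (b • y))).trans ?_
    change (tensor M N).rinner _ _ - (tensor M N).rinner _ _ - (tensor M N).rinner _ _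
      + (tensor M N).rinner _ _ = 0
    simp only [rinner_tmul, M.rinner_op_smul_left, M.rinner_op_smul_right, N.rinner_smul_left,
      ← mul_smul, mul_assoc]
    abel
  exact sub_eq_zero.1 (norm_eq_zero.1 (pow_eq_zero_iff two_ne_zero |>.1 h))

end Correspondence

namespace Correspondence

/-- `B` as a correspondence over itself, with `⟨a, b⟩ = a* b`. -/
def self (B : Type u) [CStarAlgebra B] : Correspondence B where
  carrier := B
  rinner a b := star a * b
  rinner_add_right a b c := mul_add _ _ _
  rinner_op_smul_right a b c := (mul_assoc _ _ _).symm
  star_rinner a b := by rw [star_mul, star_star]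
  rinner_smul_left a b c := by rw [smul_eq_mul, smul_eq_mul, star_mul, mul_assoc]
  rinner_self_nonneg a := ⟨a, rfl⟩
  norm_sq_eq_rinner a := by rw [CStarRing.norm_star_mul_self, pow_two]

/-- Isomorphisms of correspondences: bijective bimodule maps preserving the inner product. -/
@[ext]
structure Iso (M N : Correspondence B) where
  toEquiv : M.carrier ≃ₗ[ℂ] N.carrier
  map_smul_left : ∀ (b : B) x, toEquiv (b • x) = b • toEquiv x
  map_smul_right : ∀ (b : Bᵐᵒᵖ) x, toEquiv (b • x) = b • toEquiv x
  map_rinner : ∀ x y, N.rinner (toEquiv x) (toEquiv y) = M.rinner x y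

instance (M N : Correspondence B) : CoeFun (Iso M N) fun _ => M.carrier → N.carrier :=
  ⟨fun φ => φ.toEquiv⟩

/-- The tensor powers of a correspondence: `B`, `M`, `M ⊗ M`, `(M ⊗ M) ⊗ M`, ... -/
def pow (M : Correspondence B) : ℕ → Correspondence B
  | 0 => self B
  | 1 => M
  | n + 2 => tensor (pow M (n + 1)) M

end Correspondence

/-- A Hilbert `B`-bimodule: a `B`-bimodule which is both a right and a left Hilbert `B`-module (for
the same norm), where either action is adjointable for the inner product of the other side and
`_B⟨x, y⟩ z = x ⟨y, z⟩_B`. (That the left and the right norm agree is a consequence of the other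
properties of an equivalence bimodule.) -/
structure HilbertBimodule (B : Type u) [CStarAlgebra B] extends Correspondence B where
  linner : carrier → carrier → B
  linner_add_left : ∀ x y z, linner (x + y) z = linner x z + linner y z
  linner_smul_left : ∀ (b : B) x y, linner (b • x) y = b * linner x y
  star_linner : ∀ x y, star (linner x y) = linner y x
  linner_op_smul_left : ∀ (b : B) x y, linner (op b • x) y = linner x (op (star b) • y)
  linner_self_nonneg : ∀ x, ∃ b, linner x x = star b * b
  norm_sq_eq_linner : ∀ x, ‖x‖ ^ 2 = ‖linner x x‖
  linner_smul : ∀ x y z, linner x y • z = op (rinner y z) • x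

namespace HilbertBimodule

/-- A Morita equivalence `B`-bimodule is a Hilbert bimodule for which both inner products are
full. -/
structure IsMorita (N : HilbertBimodule B) : Prop where
  dense_rinner :
    Dense (Submodule.span ℂ (Set.range fun p : N.carrier × N.carrier => N.rinner p.1 p.2) : Set B)
  dense_linner :
    Dense (Submodule.span ℂ (Set.range fun p : N.carrier × N.carrier => N.linner p.1 p.2) : Set B)

/-- Isomorphisms of Hilbert bimodules preserve the bimodule structure and both inner products. -/
structure Iso (M N : HilbertBimodule B) extends
    Correspondence.Iso M.toCorrespondence N.toCorrespondence where
  map_linner : ∀ x y, N.linner (toEquiv x) (toEquiv y) = M.linner x y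

/-- The conjugate vector space underlying the dual bimodule. -/
def DualCarrier (N : HilbertBimodule B) : Type u := N.carrier

variable (N : HilbertBimodule B)

/-- The element `x̃` of the dual bimodule given by `x`. -/
def toDual (x : N.carrier) : N.DualCarrier := x

/-- The element `x` underlying the element `x̃` of the dual bimodule. -/
def ofDual (x : N.DualCarrier) : N.carrier := x

instance : NormedAddCommGroup N.DualCarrier := inferInstanceAs (NormedAddCommGroup N.carrier)

instance : CompleteSpace N.DualCarrier := inferInstanceAs (CompleteSpace N.carrier)

instance : NormedSpace ℂ N.DualCarrier where
  smul c x := N.toDual (conj c • N.ofDual x)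
  one_smul x := by
    change conj (1 : ℂ) • N.ofDual x = N.ofDual x
    rw [map_one, one_smul]
  mul_smul c d x := by
    change conj (c * d) • N.ofDual x = conj c • conj d • N.ofDual x
    rw [map_mul, mul_smul]
  smul_zero c := smul_zero (A := N.carrier) (conj c)
  smul_add c x y := smul_add (conj c) (N.ofDual x) (N.ofDual y)
  add_smul c d x := by
    change conj (c + d) • N.ofDual x = conj c • N.ofDual x + conj d • N.ofDual x
    rw [map_add, add_smul]
  zero_smul x := by
    change conj (0 : ℂ) • N.ofDual x = 0
    rw [map_zero, zero_smul]
  norm_smul_le c x := by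
    change ‖conj c • N.ofDual x‖ ≤ ‖c‖ * ‖N.ofDual x‖
    rw [norm_smul, RCLike.norm_conj]

instance : Module B N.DualCarrier where
  smul b x := N.toDual (op (star b) • N.ofDual x)
  one_smul x := by
    change op (star (1 : B)) • N.ofDual x = N.ofDual x
    rw [star_one, op_one, one_smul]
  mul_smul a b x := by
    change op (star (a * b)) • N.ofDual x = op (star a) • op (star b) • N.ofDual x
    rw [star_mul, op_mul, mul_smul]
  smul_zero b := smul_zero (A := N.carrier) (op (star b))
  smul_add b x y := smul_add (op (star b)) (N.ofDual x) (N.ofDual y)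
  add_smul a b x := by
    change op (star (a + b)) • N.ofDual x = op (star a) • N.ofDual x + op (star b) • N.ofDual x
    rw [star_add, op_add, add_smul]
  zero_smul x := by
    change op (star (0 : B)) • N.ofDual x = 0
    rw [star_zero, op_zero, zero_smul]

instance : Module Bᵐᵒᵖ N.DualCarrier where
  smul b x := N.toDual (star (unop b) • N.ofDual x)
  one_smul x := by
    change star (unop (1 : Bᵐᵒᵖ)) • N.ofDual x = N.ofDual x
    rw [unop_one, star_one, one_smul]
  mul_smul a b x := by
    change star (unop (a * b)) • N.ofDual x = star (unop a) • star (unop b) • N.ofDual x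
    rw [unop_mul, star_mul, mul_smul]
  smul_zero b := smul_zero (A := N.carrier) (star (unop b))
  smul_add b x y := smul_add (star (unop b)) (N.ofDual x) (N.ofDual y)
  add_smul a b x := by
    change star (unop (a + b)) • N.ofDual x =
      star (unop a) • N.ofDual x + star (unop b) • N.ofDual x
    rw [unop_add, star_add, add_smul]
  zero_smul x := by
    change star (unop (0 : Bᵐᵒᵖ)) • N.ofDual x = 0
    rw [unop_zero, star_zero, zero_smul]

instance : SMulCommClass B Bᵐᵒᵖ N.DualCarrier where
  smul_comm a b x := (smul_comm (star (unop b)) (op (star a)) (N.ofDual x)).symm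

instance : IsScalarTower ℂ B N.DualCarrier where
  smul_assoc c b x := by
    change op (star (c • b)) • N.ofDual x = conj c • op (star b) • N.ofDual x
    rw [star_smul, op_smul, smul_assoc]; rfl

instance : IsScalarTower ℂ Bᵐᵒᵖ N.DualCarrier where
  smul_assoc c b x := by
    change star (unop (c • b)) • N.ofDual x = conj c • star (unop b) • N.ofDual x
    rw [unop_smul, star_smul, smul_assoc]; rfl

/-- The dual bimodule: the conjugate space with `b • x̃ = (x • b*)~`, `x̃ • b = (b* • x)~`,
`⟨x̃, ỹ⟩_B = _B⟨x, y⟩` and `_B⟨x̃, ỹ⟩ = ⟨x, y⟩_B`. -/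
def dual : HilbertBimodule B where
  carrier := N.DualCarrier
  rinner x y := N.linner (N.ofDual x) (N.ofDual y)
  rinner_add_right x y z := by
    rw [← N.star_linner, ← N.star_linner (N.ofDual y), ← N.star_linner (N.ofDual z), ← star_add]
    exact congrArg star (N.linner_add_left _ _ _)
  rinner_op_smul_right x y b := by
    change N.linner (N.ofDual x) (star b • N.ofDual y) = _
    rw [← N.star_linner, N.linner_smul_left, star_mul, star_star, N.star_linner]
  star_rinner x y := N.star_linner _ _
  rinner_smul_left b x y := by
    change N.linner (op (star b) • N.ofDual x) (N.ofDual y) =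
      N.linner (N.ofDual x) (op (star (star b)) • N.ofDual y)
    rw [N.linner_op_smul_left]
  rinner_self_nonneg x := N.linner_self_nonneg _
  norm_sq_eq_rinner x := N.norm_sq_eq_linner _
  linner x y := N.rinner (N.ofDual x) (N.ofDual y)
  linner_add_left x y z := N.toCorrespondence.rinner_add_left _ _ _
  linner_smul_left b x y := by
    change N.rinner (op (star b) • N.ofDual x) (N.ofDual y) = _
    rw [N.toCorrespondence.rinner_op_smul_left, star_star]
  star_linner x y := N.star_rinner _ _
  linner_op_smul_left b x y := by
    change N.rinner (star b • N.ofDual x) (N.ofDual y) =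
      N.rinner (N.ofDual x) (star (star b) • N.ofDual y)
    rw [N.rinner_smul_left]
  linner_self_nonneg x := N.rinner_self_nonneg _
  norm_sq_eq_linner x := N.norm_sq_eq_rinner _
  linner_smul x y z := by
    change op (star (N.rinner (N.ofDual x) (N.ofDual y))) • N.ofDual z =
      star (N.linner (N.ofDual y) (N.ofDual z)) • N.ofDual x
    rw [N.star_rinner, N.star_linner, N.linner_smul]

/-- The correspondences `N(k)`: `N(0) = B`, `N(k) = N^{⊗ k}` and `N(-k) = N̄^{⊗ k}` for `k > 0`. -/
def zpow : ℤ → Correspondence B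
  | Int.ofNat n => N.toCorrespondence.pow n
  | Int.negSucc n => N.dual.toCorrespondence.pow (n + 1)

/-- The factor system associated with `N`: isomorphisms `N(k) ⊗_B N(l) ≅ N(k + l)` that are
associative, are given by the actions of `B` if `k = 0` or `l = 0`, by the tensor product if `k` and
`l` have the same sign, and by the two inner products if `{k, l} = {1, -1}`. By associativity, this
determines the isomorphisms for all `k` and `l`. -/
@[ext]
structure FactorSystem where
  Ψ : ∀ {k l m : ℤ}, k + l = m → Correspondence.Iso ((N.zpow k).tensor (N.zpow l)) (N.zpow m)
  assoc : ∀ {k₁ k₂ k₃ k₁₂ k₂₃ m : ℤ} (h₁₂ : k₁ + k₂ = k₁₂) (h₂₃ : k₂ + k₃ = k₂₃)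
    (h : k₁₂ + k₃ = m) (h' : k₁ + k₂₃ = m)
    (x : (N.zpow k₁).carrier) (y : (N.zpow k₂).carrier) (z : (N.zpow k₃).carrier),
    Ψ h (Correspondence.tmul (Ψ h₁₂ (Correspondence.tmul x y)) z) =
      Ψ h' (Correspondence.tmul x (Ψ h₂₃ (Correspondence.tmul y z)))
  zero_left : ∀ (k : ℤ) (b : B) (x : (N.zpow k).carrier),
    Ψ (zero_add k) (Correspondence.tmul (M := N.zpow 0) b x) = b • x
  zero_right : ∀ (k : ℤ) (x : (N.zpow k).carrier) (b : B),
    Ψ (add_zero k) (Correspondence.tmul (N := N.zpow 0) x b) = op b • x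
  pos : ∀ (n : ℕ) (u : ((N.toCorrespondence.pow (n + 1)).tensor N.toCorrespondence).carrier),
    Ψ (k := Int.ofNat (n + 1)) (l := Int.ofNat 1) (m := Int.ofNat (n + 2)) rfl u = u
  neg : ∀ (n : ℕ)
    (u : ((N.dual.toCorrespondence.pow (n + 1)).tensor N.dual.toCorrespondence).carrier),
    Ψ (k := Int.negSucc n) (l := Int.negSucc 0) (m := Int.negSucc (n + 1)) rfl u = u
  one_neg_one : ∀ x y : N.carrier,
    Ψ (k := Int.ofNat 1) (l := Int.negSucc 0) (m := Int.ofNat 0) rfl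
      (Correspondence.tmul (M := N.toCorrespondence) (N := N.dual.toCorrespondence)
        x (N.toDual y)) = N.linner x y
  neg_one_one : ∀ x y : N.carrier,
    Ψ (k := Int.negSucc 0) (l := Int.ofNat 1) (m := Int.ofNat 0) rfl
      (Correspondence.tmul (M := N.dual.toCorrespondence) (N := N.toCorrespondence)
        (N.toDual x) y) = N.rinner x y

end HilbertBimodule

/-- Morita equivalence `B`-bimodules. -/
structure MoritaBimodule (B : Type u) [CStarAlgebra B] extends HilbertBimodule B where
  isMorita : toHilbertBimodule.IsMorita

namespace MoritaBimodule

/-- Isomorphism of Morita equivalence bimodules. -/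
instance setoid (B : Type u) [CStarAlgebra B] : Setoid (MoritaBimodule B) where
  r M N := Nonempty (HilbertBimodule.Iso M.toHilbertBimodule N.toHilbertBimodule)
  iseqv :=
    { refl := fun M => ⟨⟨⟨LinearEquiv.refl ℂ _, fun _ _ => rfl, fun _ _ => rfl, fun _ _ => rfl⟩,
        fun _ _ => rfl⟩⟩
      symm := by
        rintro M N ⟨φ⟩
        refine ⟨⟨⟨φ.toEquiv.symm, fun b x => ?_, fun b x => ?_, fun x y => ?_⟩, fun x y => ?_⟩⟩
        · rw [LinearEquiv.symm_apply_eq, φ.map_smul_left, LinearEquiv.apply_symm_apply]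
        · rw [LinearEquiv.symm_apply_eq, φ.map_smul_right, LinearEquiv.apply_symm_apply]
        · rw [← φ.map_rinner, LinearEquiv.apply_symm_apply, LinearEquiv.apply_symm_apply]
        · rw [← φ.map_linner, LinearEquiv.apply_symm_apply, LinearEquiv.apply_symm_apply]
      trans := by
        rintro M N P ⟨φ⟩ ⟨ψ⟩
        refine ⟨⟨⟨φ.toEquiv.trans ψ.toEquiv, fun b x => ?_, fun b x => ?_, fun x y => ?_⟩,
          fun x y => ?_⟩⟩
        · simp only [LinearEquiv.trans_apply, φ.map_smul_left, ψ.map_smul_left]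
        · simp only [LinearEquiv.trans_apply, φ.map_smul_right, ψ.map_smul_right]
        · simp only [LinearEquiv.trans_apply, φ.map_rinner, ψ.map_rinner]
        · simp only [LinearEquiv.trans_apply, φ.map_linner, ψ.map_linner] }

end MoritaBimodule

/-- The set `Pic(B)` of isomorphism classes of Morita equivalence `B`-bimodules. -/
def Pic (B : Type u) [CStarAlgebra B] : Type (u + 1) := Quotient (MoritaBimodule.setoid B)

/-- The class of a Morita equivalence bimodule. -/
def MoritaBimodule.toPic (N : MoritaBimodule B) : Pic B := Quotient.mk _ N

/-- A C*-dynamical system: a strongly continuous action of a topological group `G` by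
`*`-automorphisms on a unital C*-algebra. -/
structure CStarDynamicalSystem (G : Type*) [Group G] [TopologicalSpace G] where
  A : Type u
  [cstarAlgebra : CStarAlgebra A]
  α : G →* (A ≃⋆ₐ[ℂ] A)
  continuous_apply : ∀ x, Continuous fun g => α g x

attribute [instance] CStarDynamicalSystem.cstarAlgebra

namespace CStarDynamicalSystem

variable {G : Type*} [Group G] [TopologicalSpace G] (S : CStarDynamicalSystem.{u} G)

/-- The Ellwood map `A ⊗ A → C(G, A)`, `x ⊗ y ↦ (g ↦ x α_g(y))`. -/
def ellwood : S.A ⊗[ℂ] S.A →ₗ[ℂ] C(G, S.A) :=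
  TensorProduct.lift (LinearMap.mk₂ ℂ
    (fun x y => ⟨fun g => x * S.α g y, continuous_const.mul (S.continuous_apply y)⟩)
    (fun x x' y => ContinuousMap.ext fun g => add_mul x x' _)
    (fun c x y => ContinuousMap.ext fun g => smul_mul_assoc c x _)
    (fun x y y' => ContinuousMap.ext fun g => by
      change x * S.α g (y + y') = x * S.α g y + x * S.α g y'
      rw [map_add, mul_add])
    (fun c x y => ContinuousMap.ext fun g => by
      change x * S.α g (c • y) = c • (x * S.α g y)
      rw [map_smul, mul_smul_comm]))

/-- Freeness: the Ellwood map has dense range. (For compact `G`, the compact-open topology of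
`C(G, A)` is the one of the supremum norm.) -/
def IsFree : Prop := DenseRange S.ellwood

end CStarDynamicalSystem

/-- The group `SO(2)`. -/
abbrev SO2 : Type := Matrix.specialOrthogonalGroup (Fin 2) ℝ

/-- The fundamental character of `SO(2)`, sending the rotation by `θ` to `e^{iθ}`. -/
def SO2.character (g : SO2) : ℂ := ⟨g.1 0 0, g.1 1 0⟩

theorem SO2.conj_character_mul (g : SO2) : conj g.character * g.character = 1 := by
  obtain ⟨h1, h2, h3⟩ := Matrix.mem_specialOrthogonalGroup_fin_two_iff.1 g.2
  rw [h2] at h3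
  apply Complex.ext
  · simp [SO2.character]; nlinarith
  · simp [SO2.character]; ring

theorem SO2.character_mul_conj (g : SO2) : g.character * conj g.character = 1 := by
  rw [mul_comm, g.conj_character_mul]

theorem SO2.character_ne_zero (g : SO2) : g.character ≠ 0 := fun h => by
  simpa [h] using g.conj_character_mul

/-- A free C*-dynamical system with structure group `SO(2)` and fixed point algebra `B`; the latter
is identified with the fixed points by means of `ι`. -/
structure FreeSystem (B : Type u) [CStarAlgebra B] extends CStarDynamicalSystem.{u} SO2 where
  isFree : toCStarDynamicalSystem.IsFree
  ι : B →⋆ₐ[ℂ] A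
  ι_injective : Function.Injective ι
  range_ι : Set.range ι = {x | ∀ g, α g x = x}

namespace FreeSystem

variable (S : FreeSystem B)

theorem α_ι (g : SO2) (b : B) : S.α g (S.ι b) = S.ι b := by
  have h : S.ι b ∈ {x | ∀ g, S.α g x = x} := S.range_ι ▸ ⟨b, rfl⟩
  exact h g

/-- The element of `B` corresponding to a fixed point of the action (and `0` for other
elements). -/
def toB (x : S.A) : B :=
  open Classical in if h : ∃ b, S.ι b = x then h.choose else 0

theorem ι_toB {x : S.A} (hx : ∀ g, S.α g x = x) : S.ι (S.toB x) = x := by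
  have h : ∃ b, S.ι b = x := by
    have h : x ∈ {x | ∀ g, S.α g x = x} := hx
    rwa [← S.range_ι] at h
  rw [toB, dif_pos h]
  exact h.choose_spec

/-- The isotypic component `A(k) = {x | α_g(x) = χ(g)^k x for all g}`. -/
def isotypicSubmodule (k : ℤ) : Submodule ℂ S.A where
  carrier := {x | ∀ g, S.α g x = g.character ^ k • x}
  add_mem' := fun hx hy g => by rw [map_add, hx g, hy g, smul_add]
  zero_mem' := fun g => by rw [map_zero, smul_zero]
  smul_mem' := fun c x hx g => by rw [map_smul, hx g, smul_comm]

theorem isClosed_isotypicSubmodule (k : ℤ) : IsClosed (S.isotypicSubmodule k : Set S.A) := by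
  have h : (S.isotypicSubmodule k : Set S.A) = ⋂ g, {x | S.α g x = g.character ^ k • x} := by
    ext x; simp [isotypicSubmodule]
  rw [h]
  refine isClosed_iInter fun g => isClosed_eq ?_ (by fun_prop)
  exact (StarAlgEquiv.isometry (S.α g)).continuous

theorem star_mul_fixed {k : ℤ} (x y : S.isotypicSubmodule k) (g : SO2) :
    S.α g (star (x : S.A) * y) = star (x : S.A) * y := by
  rw [map_mul, map_star, x.2 g, y.2 g, star_smul, smul_mul_smul_comm, star_zpow₀, ← mul_zpow]
  rw [show star g.character * g.character = 1 from g.conj_character_mul, one_zpow, one_smul]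

theorem mul_star_fixed {k : ℤ} (x y : S.isotypicSubmodule k) (g : SO2) :
    S.α g ((x : S.A) * star (y : S.A)) = (x : S.A) * star (y : S.A) := by
  rw [map_mul, map_star, x.2 g, y.2 g, star_smul, smul_mul_smul_comm, star_zpow₀, ← mul_zpow]
  rw [show g.character * star g.character = 1 from g.character_mul_conj, one_zpow, one_smul]

/-- The isotypic component `A(k)` as a type, a `B`-bimodule by multiplication in `A`. -/
def IsotypicCarrier (k : ℤ) : Type u := S.isotypicSubmodule k

/-- The inclusion of an isotypic component into `A`. -/
def val {k : ℤ} (x : S.IsotypicCarrier k) : S.A := x.1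

section

variable {S} {k : ℤ}

theorem val_injective : Function.Injective (S.val (k := k)) := Subtype.val_injective

instance : NormedAddCommGroup (S.IsotypicCarrier k) :=
  inferInstanceAs (NormedAddCommGroup (S.isotypicSubmodule k))

instance : NormedSpace ℂ (S.IsotypicCarrier k) :=
  inferInstanceAs (NormedSpace ℂ (S.isotypicSubmodule k))

instance : CompleteSpace (S.IsotypicCarrier k) :=
  (S.isClosed_isotypicSubmodule k).completeSpace_coe

instance : SMul B (S.IsotypicCarrier k) where
  smul b x := ⟨S.ι b * S.val x, fun g => by
    rw [map_mul, S.α_ι, show S.α g (S.val x) = _ from x.2 g, mul_smul_comm]; rfl⟩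

instance : SMul Bᵐᵒᵖ (S.IsotypicCarrier k) where
  smul b x := ⟨S.val x * S.ι (unop b), fun g => by
    rw [map_mul, S.α_ι, show S.α g (S.val x) = _ from x.2 g, smul_mul_assoc]; rfl⟩

theorem val_add (x y : S.IsotypicCarrier k) : S.val (x + y) = S.val x + S.val y := rfl

theorem val_zero : S.val (0 : S.IsotypicCarrier k) = 0 := rfl

theorem val_smul_complex (c : ℂ) (x : S.IsotypicCarrier k) : S.val (c • x) = c • S.val x := rfl

theorem val_smul (b : B) (x : S.IsotypicCarrier k) : S.val (b • x) = S.ι b * S.val x := rfl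

theorem val_op_smul (b : Bᵐᵒᵖ) (x : S.IsotypicCarrier k) :
    S.val (b • x) = S.val x * S.ι (unop b) := rfl

theorem norm_val (x : S.IsotypicCarrier k) : ‖S.val x‖ = ‖x‖ := rfl

instance : Module B (S.IsotypicCarrier k) where
  one_smul x := val_injective (by rw [val_smul, map_one, one_mul])
  mul_smul a b x := val_injective (by simp only [val_smul, map_mul, mul_assoc])
  smul_zero b := val_injective (by rw [val_smul, val_zero, mul_zero])
  smul_add b x y := val_injective (by simp only [val_smul, val_add, mul_add])
  add_smul a b x := val_injective (by simp only [val_smul, val_add, map_add, add_mul])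
  zero_smul x := val_injective (by rw [val_smul, map_zero, zero_mul, val_zero])

instance : Module Bᵐᵒᵖ (S.IsotypicCarrier k) where
  one_smul x := val_injective (by rw [val_op_smul, unop_one, map_one, mul_one])
  mul_smul a b x := val_injective (by simp only [val_op_smul, unop_mul, map_mul, mul_assoc])
  smul_zero b := val_injective (by rw [val_op_smul, val_zero, zero_mul])
  smul_add b x y := val_injective (by simp only [val_op_smul, val_add, add_mul])
  add_smul a b x := val_injective (by simp only [val_op_smul, val_add, unop_add, map_add, mul_add])
  zero_smul x := val_injective (by rw [val_op_smul, unop_zero, map_zero, mul_zero, val_zero])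

instance : SMulCommClass B Bᵐᵒᵖ (S.IsotypicCarrier k) where
  smul_comm a b x := val_injective (by simp only [val_smul, val_op_smul, mul_assoc])

instance : IsScalarTower ℂ B (S.IsotypicCarrier k) where
  smul_assoc c b x := val_injective (by
    simp only [val_smul, val_smul_complex, map_smul, smul_mul_assoc])

instance : IsScalarTower ℂ Bᵐᵒᵖ (S.IsotypicCarrier k) where
  smul_assoc c b x := val_injective (by
    simp only [val_op_smul, val_smul_complex, unop_smul, map_smul, mul_smul_comm])

theorem ι_toB_star_mul (x y : S.IsotypicCarrier k) :
    S.ι (S.toB (star (S.val x) * S.val y)) = star (S.val x) * S.val y :=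
  S.ι_toB (S.star_mul_fixed x y)

theorem ι_toB_mul_star (x y : S.IsotypicCarrier k) :
    S.ι (S.toB (S.val x * star (S.val y))) = S.val x * star (S.val y) :=
  S.ι_toB (S.mul_star_fixed x y)

end

theorem exists_of_ι_eq {b : B} {x : S.A} (h : S.ι b = star x * x) : ∃ c, b = star c * c := by
  let _ := CStarAlgebra.spectralOrder S.A
  let _ := CStarAlgebra.spectralOrderedRing S.A
  refine exists_eq_star_mul_self_of_conjugates ?_ fun d e hde => ?_
  · exact S.ι_injective (by rw [map_star, h, star_mul, star_star])
  · have h1 : star (x * S.ι d) * (x * S.ι d) = -(star (S.ι e) * S.ι e) := by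
      rw [← map_star, ← map_mul, ← map_neg, ← hde, map_mul, map_mul, h, star_mul, map_star]
      simp only [mul_assoc]
    have h2 : star (S.ι e) * S.ι e = 0 := by
      refine le_antisymm ?_ (star_mul_self_nonneg _)
      rw [← neg_nonneg, ← h1]
      exact star_mul_self_nonneg _
    exact S.ι_injective (((CStarRing.star_mul_self_eq_zero_iff _).1 h2).trans (map_zero S.ι).symm)

theorem norm_ι (b : B) : ‖S.ι b‖ = ‖b‖ := NonUnitalStarAlgHom.norm_map S.ι S.ι_injective b

/-- The isotypic component `A(k)` as a Hilbert `B`-bimodule, with `⟨x, y⟩_B = x* y` and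
`_B⟨x, y⟩ = x y*`. -/
def isotypic (k : ℤ) : HilbertBimodule B where
  carrier := S.IsotypicCarrier k
  rinner x y := S.toB (star (S.val x) * S.val y)
  rinner_add_right x y z := S.ι_injective (by
    rw [map_add, ι_toB_star_mul, ι_toB_star_mul, ι_toB_star_mul, val_add, mul_add])
  rinner_op_smul_right x y b := S.ι_injective (by
    rw [map_mul, ι_toB_star_mul, ι_toB_star_mul, val_op_smul, unop_op, mul_assoc])
  star_rinner x y := S.ι_injective (by
    simp only [map_star, ι_toB_star_mul, star_mul, star_star])
  rinner_smul_left b x y := S.ι_injective (by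
    simp only [val_smul, star_mul, map_star, mul_assoc])
  rinner_self_nonneg x := S.exists_of_ι_eq (ι_toB_star_mul x x)
  norm_sq_eq_rinner x := by
    rw [← S.norm_ι, ι_toB_star_mul, CStarRing.norm_star_mul_self, pow_two, norm_val]
  linner x y := S.toB (S.val x * star (S.val y))
  linner_add_left x y z := S.ι_injective (by
    rw [map_add, ι_toB_mul_star, ι_toB_mul_star, ι_toB_mul_star, val_add, add_mul])
  linner_smul_left b x y := S.ι_injective (by
    rw [map_mul, ι_toB_mul_star, ι_toB_mul_star, val_smul, mul_assoc])
  star_linner x y := S.ι_injective (by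
    simp only [map_star, ι_toB_mul_star, star_mul, star_star])
  linner_op_smul_left b x y := S.ι_injective (by
    simp only [val_op_smul, unop_op, star_mul, map_star, star_star, mul_assoc])
  linner_self_nonneg x := S.exists_of_ι_eq (x := star (S.val x)) (by
    rw [star_star]; exact ι_toB_mul_star x x)
  norm_sq_eq_linner x := by
    rw [← S.norm_ι, ι_toB_mul_star, CStarRing.norm_self_mul_star, pow_two, norm_val]
  linner_smul x y z := val_injective (by
    simp only [val_smul, val_op_smul, unop_op, ι_toB_mul_star, ι_toB_star_mul, mul_assoc])

/-- `A` is the C*-dynamical system given by the factor system `F` of `N`: there are isomorphisms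
`φ_k : N(k) ≅ A(k)` that are the given identification for `k = 0` and turn the maps
`Ψ_{k,l} : N(k) ⊗_B N(l) → N(k + l)` into the multiplication of `A`. -/
def HasFactorSystem {N : HilbertBimodule B} (F : N.FactorSystem) : Prop :=
  ∃ φ : ∀ k : ℤ, Correspondence.Iso (N.zpow k) (S.isotypic k).toCorrespondence,
    (∀ b : B, S.val (φ 0 b) = S.ι b) ∧
    ∀ {k l m : ℤ} (h : k + l = m) (x : (N.zpow k).carrier) (y : (N.zpow l).carrier),
      S.val (φ m (F.Ψ h (Correspondence.tmul x y))) = S.val (φ k x) * S.val (φ l y)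

/-- Equivalence of free systems: `SO(2)`-equivariant `*`-isomorphisms over `B`. -/
instance setoid (B : Type u) [CStarAlgebra B] : Setoid (FreeSystem B) where
  r S T := ∃ φ : S.A ≃⋆ₐ[ℂ] T.A,
    (∀ b, φ (S.ι b) = T.ι b) ∧ ∀ (g : SO2) (x : S.A), φ (S.α g x) = T.α g (φ x)
  iseqv :=
    { refl := fun S => ⟨StarAlgEquiv.refl ℂ _, fun _ => rfl, fun _ _ => rfl⟩
      symm := by
        rintro S T ⟨φ, h1, h2⟩
        refine ⟨φ.symm, fun b => ?_, fun g x => ?_⟩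
        · rw [← h1, StarAlgEquiv.symm_apply_apply]
        · apply EquivLike.injective φ
          rw [h2, StarAlgEquiv.apply_symm_apply, StarAlgEquiv.apply_symm_apply]
      trans := by
        rintro S T U ⟨φ, h1, h2⟩ ⟨ψ, h3, h4⟩
        exact ⟨φ.trans ψ, fun b => by simp [h1, h3], fun g x => by simp [h2, h4]⟩ }

end FreeSystem

/-- The set `Ext(B, SO(2))` of equivalence classes of free C*-dynamical systems with structure group
`SO(2)` and fixed point algebra `B`. -/
def FreeExt (B : Type u) [CStarAlgebra B] : Type (u + 1) := Quotient (FreeSystem.setoid B)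

/-- The class of a free C*-dynamical system. -/
def FreeSystem.toFreeExt (S : FreeSystem B) : FreeExt B := Quotient.mk _ S

end

noncomputable section

/-!
The action of `SO(2)` grades the algebra of a free system by its isotypic components, and freeness
says that `A(k)* A(k)` and `A(k) A(k)*` are dense in the fixed point algebra; this makes every
`A(k)` a Morita equivalence bimodule.

For the factor system of `N ≅ A(1)`, multiplication in the algebra identifies `A(k) ⊗ A(l)` with
`A(k + l)`, hence `N(k)` with `A(k)` for all `k`, and the maps `Ψ` are transported from the
multiplication; associativity then holds for free. Uniqueness is induction on the degrees.

Surjectivity onto the Picard set: creation operators on the two-sided Fock module `⨁ k, N(k)`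
represent `N` in a C*-algebra `C`, covariantly for both inner products. Multiplying them by the
character moves the representation into `C(SO(2), C)`, where translation makes it homogeneous of
degree one, and the C*-algebra it generates is a free system with `A(1) ≅ N`.

Injectivity: an isomorphism of the degree one parts of two free systems is a covariant
representation in their product, and the free system it generates is the graph of an equivalence.
The coordinate projections are injective because a homomorphism that is injective on the fixed
points is injective on all isotypic components.
-/

variable {B : Type u} [CStarAlgebra B]

/-! ### Products of submodules in a topological algebra -/

section SubmoduleMul

variable {R A : Type*} [CommSemiring R] [TopologicalSpace A] [Semiring A] [Algebra R A]
  [IsTopologicalSemiring A] [ContinuousConstSMul R A] {V W : Submodule R A}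

theorem topologicalClosure_mul_topologicalClosure_le (V W : Submodule R A) :
    V.topologicalClosure * W.topologicalClosure ≤ (V * W).topologicalClosure :=
  Submodule.mul_le.2 fun _ hv _ hw =>
    map_mem_closure₂ continuous_mul hv hw fun _ hv _ hw => Submodule.mul_mem_mul hv hw

theorem le_topologicalClosure_mul_left (h : 1 ∈ V.topologicalClosure) :
    W ≤ (V * W).topologicalClosure := fun w hw => by
  have := Submodule.mul_mem_mul h (W.le_topologicalClosure hw)
  rw [one_mul] at this
  exact topologicalClosure_mul_topologicalClosure_le V W this

theorem le_topologicalClosure_mul_right (h : 1 ∈ W.topologicalClosure) :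
    V ≤ (V * W).topologicalClosure := fun v hv => by
  have := Submodule.mul_mem_mul (V.le_topologicalClosure hv) h
  rw [mul_one] at this
  exact topologicalClosure_mul_topologicalClosure_le V W this

end SubmoduleMul

/-! ### The rotation group -/

namespace SO2

theorem character_injective : Function.Injective SO2.character := by
  intro g h hgh
  obtain ⟨hg₁, hg₂, -⟩ := Matrix.mem_specialOrthogonalGroup_fin_two_iff.1 g.2
  obtain ⟨hh₁, hh₂, -⟩ := Matrix.mem_specialOrthogonalGroup_fin_two_iff.1 h.2
  have hre : g.1 0 0 = h.1 0 0 := congrArg Complex.re hgh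
  have him : g.1 1 0 = h.1 1 0 := congrArg Complex.im hgh
  ext i j
  fin_cases i <;> fin_cases j <;> simp_all

theorem character_mul (g h : SO2) : (g * h).character = g.character * h.character := by
  obtain ⟨hdiag, hoff, -⟩ := Matrix.mem_specialOrthogonalGroup_fin_two_iff.1 g.2
  apply Complex.ext <;>
    simp only [SO2.character, Submonoid.coe_mul, Matrix.mul_apply, Fin.sum_univ_two,
      Complex.mul_re, Complex.mul_im, hoff, ← hdiag] <;> ring

theorem continuous_character : Continuous SO2.character := by
  have continuous_entry (i j) : Continuous fun g : SO2 => g.1 i j :=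
    continuous_subtype_val.matrix_elem i j
  exact Complex.equivRealProdCLM.symm.continuous.comp
    ((continuous_entry 0 0).prodMk (continuous_entry 1 0))

theorem norm_character (g : SO2) : ‖g.character‖ = 1 := by
  have h := congrArg norm g.conj_character_mul
  rw [norm_mul, RCLike.norm_conj, norm_one] at h
  exact (pow_eq_one_iff_of_nonneg (norm_nonneg _) two_ne_zero).1 ((pow_two _).trans h)

theorem norm_character_zpow (g : SO2) (k : ℤ) : ‖g.character ^ k‖ = 1 := by
  rw [norm_zpow, g.norm_character, one_zpow]

/-- The rotation whose character is a given complex number of modulus one. -/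
def ofCircle (z : Circle) : SO2 :=
  ⟨!![(z : ℂ).re, -(z : ℂ).im; (z : ℂ).im, (z : ℂ).re], by
    rw [Matrix.of_mem_specialOrthogonalGroup_fin_two_iff]
    have := Circle.normSq_coe z
    rw [Complex.normSq_apply] at this
    exact ⟨rfl, rfl, by linarith⟩⟩

theorem character_ofCircle (z : Circle) : (ofCircle z).character = z := rfl

theorem continuous_ofCircle : Continuous ofCircle := by
  refine Continuous.subtype_mk (continuous_matrix fun i j => ?_) _
  fin_cases i <;> fin_cases j <;> dsimp <;> fun_prop

theorem ofCircle_surjective : Function.Surjective ofCircle := fun g =>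
  ⟨⟨g.character, mem_sphere_zero_iff_norm.2 g.norm_character⟩,
    character_injective (character_ofCircle _)⟩

instance : CompactSpace SO2 := ofCircle_surjective.compactSpace continuous_ofCircle

/-- The rotation by the angle `2πt`. -/
def rot (t : UnitAddCircle) : SO2 := ofCircle (AddCircle.toCircle t)

theorem character_rot_zpow (t : UnitAddCircle) (k : ℤ) :
    (rot t).character ^ k = fourier k t := by
  rw [rot, character_ofCircle, fourier_apply, AddCircle.toCircle_zsmul, Circle.coe_zpow]

theorem rot_add (s t : UnitAddCircle) : rot (s + t) = rot s * rot t :=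
  character_injective (by
    simp only [character_mul, rot, character_ofCircle, AddCircle.toCircle_add, Circle.coe_mul])

theorem continuous_rot : Continuous rot :=
  continuous_ofCircle.comp AddCircle.continuous_toCircle

theorem rot_surjective : Function.Surjective rot := fun g => by
  obtain ⟨z, rfl⟩ := ofCircle_surjective g
  obtain ⟨t, rfl⟩ := (AddCircle.homeomorphCircle one_ne_zero).surjective z
  exact ⟨t, by rw [rot, AddCircle.homeomorphCircle_apply]⟩

end SO2

/-! ### Fourier analysis of continuous functions on the rotation group -/

namespace SO2

open MeasureTheory AddCircle

variable {E F : Type*} [NormedAddCommGroup E] [NormedSpace ℂ E]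
  [NormedAddCommGroup F] [NormedSpace ℂ F]

/-- The function `g ↦ χ(g)^k a` on `SO(2)`, linear in its value `a` at the identity. -/
def charFunL (k : ℤ) : E →L[ℂ] C(SO2, E) :=
  LinearMap.mkContinuous
    { toFun := fun a => ⟨fun g => g.character ^ k • a,
        (continuous_character.zpow₀ k fun g => Or.inl g.character_ne_zero).smul continuous_const⟩
      map_add' := fun a b => ContinuousMap.ext fun g => smul_add _ a b
      map_smul' := fun c a => ContinuousMap.ext fun g => smul_comm _ c a } 1 fun a =>
    (ContinuousMap.norm_le _ (by positivity)).2 fun g => by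
      simp only [LinearMap.coe_mk, AddHom.coe_mk, ContinuousMap.coe_mk, norm_smul,
        norm_character_zpow, le_refl]

theorem charFunL_apply (k : ℤ) (a : E) (g : SO2) : charFunL k a g = g.character ^ k • a := rfl

theorem integrable_fourier_smul_rot (k : ℤ) (f : C(SO2, E)) :
    Integrable (fun t => fourier k t • f (rot t)) haarAddCircle :=
  ((fourier k).continuous.smul (f.continuous.comp continuous_rot)).integrable_of_hasCompactSupport
    (HasCompactSupport.of_compactSpace _)

/-- The Fourier coefficient `∫ χ(g)^{-k} f(g) dg` of functions on `SO(2)`. -/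
def fourierCoeffL (k : ℤ) : C(SO2, E) →L[ℂ] E :=
  LinearMap.mkContinuous
    { toFun := fun f => ∫ t, fourier (-k) t • f (rot t) ∂haarAddCircle
      map_add' := fun f h => by
        simp only [ContinuousMap.add_apply, smul_add]
        exact integral_add (integrable_fourier_smul_rot _ f) (integrable_fourier_smul_rot _ h)
      map_smul' := fun c f => by
        simp only [ContinuousMap.smul_apply, RingHom.id_apply, smul_comm _ c]
        exact integral_smul c _ } 1 fun f => by
    refine (norm_integral_le_of_norm_le_const (C := ‖f‖) (ae_of_all _ fun t => ?_)).trans_eq ?_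
    · rw [norm_smul, fourier_apply, Circle.norm_coe, one_mul]
      exact f.norm_coe_le_norm _
    · rw [probReal_univ, mul_comm]

theorem fourierCoeffL_apply (k : ℤ) (f : C(SO2, E)) :
    fourierCoeffL k f = ∫ t, fourier (-k) t • f (rot t) ∂haarAddCircle := rfl

theorem map_fourierCoeffL {𝓕 : Type*} [FunLike 𝓕 E F] [ContinuousLinearMapClass 𝓕 ℂ E F]
    [CompleteSpace E] [CompleteSpace F] (p : 𝓕) (k : ℤ) (f : C(SO2, E)) :
    p (fourierCoeffL k f) = fourierCoeffL k ((p : C(E, F)).comp f) := by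
  let pL : E →L[ℂ] F := ⟨p, map_continuous p⟩
  refine (pL.integral_comp_comm (integrable_fourier_smul_rot _ f)).symm.trans ?_
  simp only [map_smul]
  rfl

theorem fourierCoeffL_charFunL [CompleteSpace E] (j k : ℤ) (a : E) :
    fourierCoeffL k (charFunL j a) = if j = k then a else 0 := by
  have integral_fourier_mul : ∫ t : UnitAddCircle, fourier (-k) t * fourier j t ∂haarAddCircle =
      if j = k then 1 else 0 := by
    simpa only [fourierCoeff, smul_eq_mul, Pi.single_apply, eq_comm] using
      congrFun (fourierCoeff_fourier (T := (1 : ℝ)) j) k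
  simp only [fourierCoeffL_apply, charFunL_apply, character_rot_zpow, smul_smul]
  rw [integral_smul_const, integral_fourier_mul, ite_smul, one_smul, zero_smul]

theorem fourierCoeffL_translate (g : SO2) (k : ℤ) (f : C(SO2, E)) :
    fourierCoeffL k (f.comp (ContinuousMap.mulLeft g)) =
      g.character ^ k • fourierCoeffL k f := by
  obtain ⟨s, rfl⟩ := rot_surjective g
  rw [fourierCoeffL_apply, fourierCoeffL_apply, ← integral_smul,
    ← integral_add_left_eq_self (fun r => _ • fourier (-k) r • f (rot r)) s]
  refine integral_congr_ae (ae_of_all _ fun t => ?_)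
  simp only [ContinuousMap.comp_apply, ContinuousMap.coe_mulLeft, smul_smul, ← rot_add]
  simp only [← character_rot_zpow, rot_add, character_mul, mul_zpow, ← mul_assoc,
    ← zpow_add₀ (character_ne_zero _), add_neg_cancel, zpow_zero, one_mul]

theorem fourierCoeffL_of_eq_zpow_smul {j : ℤ} {f f' : C(SO2, E)}
    (h : ∀ g, f' g = g.character ^ j • f g) (k : ℤ) :
    fourierCoeffL k f' = fourierCoeffL (k - j) f := by
  simp only [fourierCoeffL_apply, h, character_rot_zpow, smul_smul, ← fourier_add]
  ring_nf

theorem eq_zero_of_fourierCoeffL_eq_zero {f : C(SO2, ℂ)} (hf : ∀ k, fourierCoeffL k f = 0) :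
    f = 0 := by
  have hf' : fourierCoeff (f.comp ⟨rot, continuous_rot⟩) = 0 := funext hf
  ext g
  obtain ⟨t, rfl⟩ := rot_surjective g
  have hsum := has_pointwise_sum_fourier_series_of_summable
    (f := f.comp ⟨rot, continuous_rot⟩) (by rw [hf']; exact summable_zero) t
  simp only [hf', Pi.zero_apply, zero_smul] at hsum
  exact hsum.unique hasSum_zero

theorem apply_mem_of_fourierCoeffL_mem [CompleteSpace E] {V : Submodule ℂ E}
    (hV : IsClosed (V : Set E)) {f : C(SO2, E)} (hf : ∀ k, fourierCoeffL k f ∈ V) (g : SO2) :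
    f g ∈ V := by
  rw [← Submodule.Quotient.mk_eq_zero V]
  refine SeparatingDual.eq_zero_of_forall_dual_eq_zero (R := ℂ) fun φ => ?_
  let φV : E →L[ℂ] ℂ := φ.comp V.mkQL
  have φV_eq_zero {x : E} (hx : x ∈ V) : φV x = 0 := by
    change φ (Submodule.Quotient.mk x) = 0
    rw [(Submodule.Quotient.mk_eq_zero V).2 hx, map_zero]
  have hcomp : (φV : C(E, ℂ)).comp f = 0 := eq_zero_of_fourierCoeffL_eq_zero fun k => by
    rw [← map_fourierCoeffL, φV_eq_zero (hf k)]
  exact DFunLike.congr_fun hcomp g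

/-- The orbit `g ↦ (h ↦ f(hg))` of a function on `SO(2)` under right translation. -/
def translates (f : C(SO2, E)) : C(SO2, C(SO2, E)) :=
  ContinuousMap.curry
    ⟨fun p : SO2 × SO2 => f (p.2 * p.1), f.continuous.comp (continuous_snd.mul continuous_fst)⟩

theorem fourierCoeffL_translates [CompleteSpace E] (k : ℤ) (f : C(SO2, E)) :
    fourierCoeffL k (translates f) = charFunL k (fourierCoeffL k f) := by
  ext h
  rw [charFunL_apply, ← fourierCoeffL_translate]
  exact map_fourierCoeffL (ContinuousMap.evalCLM ℂ h) k (translates f)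

theorem mem_of_charFunL_mem [CompleteSpace E] {V : Submodule ℂ C(SO2, E)}
    (hV : IsClosed (V : Set C(SO2, E))) (h : ∀ k a, charFunL k a ∈ V) (f : C(SO2, E)) :
    f ∈ V := by
  have hf : translates f 1 ∈ V := apply_mem_of_fourierCoeffL_mem hV
    (fun k => by rw [fourierCoeffL_translates]; exact h k _) 1
  rwa [show translates f 1 = f from ContinuousMap.ext fun h => congrArg f (mul_one h)] at hf

end SO2

/-! ### Isotypic components of an action of the rotation group -/

namespace CStarDynamicalSystem

open SO2
open scoped CStarAlgebra

variable (X : CStarDynamicalSystem.{u} SO2)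

/-- The isotypic component `A(k) = {x | α_g(x) = χ(g)^k x for all g}`. -/
def isotypicComponent (k : ℤ) : Submodule ℂ X.A where
  carrier := {x | ∀ g, X.α g x = g.character ^ k • x}
  add_mem' := fun hx hy g => by rw [map_add, hx g, hy g, smul_add]
  zero_mem' := fun g => by rw [map_zero, smul_zero]
  smul_mem' := fun c x hx g => by rw [map_smul, hx g, smul_comm]

variable {X}

theorem mem_isotypicComponent_zero {x : X.A} :
    x ∈ X.isotypicComponent 0 ↔ ∀ g, X.α g x = x :=
  forall_congr' fun g => by rw [zpow_zero, one_smul]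

theorem one_mem_isotypicComponent : (1 : X.A) ∈ X.isotypicComponent 0 :=
  mem_isotypicComponent_zero.2 fun g => map_one (X.α g)

theorem mul_mem_isotypicComponent {k l m : ℤ} (h : k + l = m) {x y : X.A}
    (hx : x ∈ X.isotypicComponent k) (hy : y ∈ X.isotypicComponent l) :
    x * y ∈ X.isotypicComponent m := fun g => by
  rw [map_mul, hx g, hy g, smul_mul_smul_comm, ← zpow_add₀ g.character_ne_zero, h]

theorem isotypicComponent_mul_le (k l : ℤ) :
    X.isotypicComponent k * X.isotypicComponent l ≤ X.isotypicComponent (k + l) :=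
  Submodule.mul_le.2 fun _ hx _ hy => mul_mem_isotypicComponent rfl hx hy

theorem star_mem_isotypicComponent {k : ℤ} {x : X.A} (hx : x ∈ X.isotypicComponent k) :
    star x ∈ X.isotypicComponent (-k) := fun g => by
  have star_character : star g.character = g.character⁻¹ :=
    eq_inv_of_mul_eq_one_left g.conj_character_mul
  rw [map_star, hx g, star_smul, star_zpow₀, star_character, inv_zpow, zpow_neg]

variable (X) in
/-- The orbit map `x ↦ (g ↦ α_g(x))`. -/
def orbitMap : X.A →L[ℂ] C(SO2, X.A) :=
  LinearMap.mkContinuous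
    { toFun := fun x => ⟨fun g => X.α g x, X.continuous_apply x⟩
      map_add' := fun x y => ContinuousMap.ext fun g => map_add (X.α g) x y
      map_smul' := fun c x => ContinuousMap.ext fun g => map_smul (X.α g) c x } 1 fun x =>
    (ContinuousMap.norm_le _ (by positivity)).2 fun g =>
      (NonUnitalStarAlgHom.norm_apply_le (X.α g) x).trans_eq (one_mul _).symm

theorem orbitMap_apply (x : X.A) (g : SO2) : X.orbitMap x g = X.α g x := rfl

theorem orbitMap_of_mem {k : ℤ} {x : X.A} (hx : x ∈ X.isotypicComponent k) :
    X.orbitMap x = charFunL k x := ContinuousMap.ext hx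

variable (X) in
/-- The projection onto the isotypic component of degree `k`. -/
def isotypicProj (k : ℤ) : X.A →L[ℂ] X.A := (fourierCoeffL k).comp X.orbitMap

theorem isotypicProj_apply (k : ℤ) (x : X.A) :
    X.isotypicProj k x = fourierCoeffL k (X.orbitMap x) := rfl

theorem isotypicProj_mem (k : ℤ) (x : X.A) : X.isotypicProj k x ∈ X.isotypicComponent k := by
  intro g
  have translate : (X.α g : C(X.A, X.A)).comp (X.orbitMap x) =
      (X.orbitMap x).comp (ContinuousMap.mulLeft g) := ContinuousMap.ext fun h =>
    (DFunLike.congr_fun (map_mul X.α g h) x).symm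
  rw [isotypicProj_apply, map_fourierCoeffL, translate, fourierCoeffL_translate]

theorem isotypicProj_of_mem {j : ℤ} {x : X.A} (hx : x ∈ X.isotypicComponent j) (k : ℤ) :
    X.isotypicProj k x = if j = k then x else 0 := by
  rw [isotypicProj_apply, orbitMap_of_mem hx, fourierCoeffL_charFunL]

theorem isotypicProj_self {k : ℤ} {x : X.A} (hx : x ∈ X.isotypicComponent k) :
    X.isotypicProj k x = x := by
  rw [isotypicProj_of_mem hx, if_pos rfl]

theorem isotypicProj_mul_of_mem {j : ℤ} {a : X.A} (ha : a ∈ X.isotypicComponent j) (k : ℤ)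
    (x : X.A) : X.isotypicProj k (x * a) = X.isotypicProj (k - j) x * a := by
  let mulRight : X.A →L[ℂ] X.A := (ContinuousLinearMap.mul ℂ X.A).flip a
  have orbit_mul (g : SO2) : X.orbitMap (x * a) g =
      g.character ^ j • (mulRight : C(X.A, X.A)).comp (X.orbitMap x) g := by
    rw [orbitMap_apply, map_mul, ha g, mul_smul_comm]
    rfl
  exact (fourierCoeffL_of_eq_zpow_smul orbit_mul k).trans (map_fourierCoeffL mulRight _ _).symm

theorem map_isotypicProj {Y : CStarDynamicalSystem.{u} SO2} {𝓕 : Type*} [FunLike 𝓕 X.A Y.A]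
    [ContinuousLinearMapClass 𝓕 ℂ X.A Y.A] (p : 𝓕)
    (hp : ∀ g x, p (X.α g x) = Y.α g (p x)) (k : ℤ) (x : X.A) :
    p (X.isotypicProj k x) = Y.isotypicProj k (p x) := by
  rw [isotypicProj_apply, isotypicProj_apply, map_fourierCoeffL]
  exact congrArg _ (ContinuousMap.ext fun g => hp g x)

theorem mem_of_isotypicProj_mem {V : Submodule ℂ X.A} (hV : IsClosed (V : Set X.A)) {x : X.A}
    (hx : ∀ k, X.isotypicProj k x ∈ V) : x ∈ V := by
  have : X.orbitMap x 1 ∈ V := apply_mem_of_fourierCoeffL_mem hV hx 1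
  rwa [orbitMap_apply, map_one] at this

theorem mem_of_isotypicComponent_le {V : Submodule ℂ X.A} (hV : IsClosed (V : Set X.A))
    (h : ∀ k, X.isotypicComponent k ≤ V) (x : X.A) : x ∈ V :=
  mem_of_isotypicProj_mem hV fun k => h k (isotypicProj_mem k x)

theorem eq_zero_of_isotypicProj_eq_zero {x : X.A} (hx : ∀ k, X.isotypicProj k x = 0) : x = 0 :=
  mem_of_isotypicProj_mem (V := ⊥) isClosed_singleton hx

-- For `x` in the kernel, the fixed points `(x_k)^* x_k` of its isotypic parts lie in the kernel.
theorem injective_of_injective_on_fixed {Y : CStarDynamicalSystem.{u} SO2} (p : X.A →⋆ₐ[ℂ] Y.A)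
    (hp : ∀ g x, p (X.α g x) = Y.α g (p x))
    (hfix : ∀ x ∈ X.isotypicComponent 0, p x = 0 → x = 0) : Function.Injective p := by
  refine (injective_iff_map_eq_zero p).2 fun x hx => eq_zero_of_isotypicProj_eq_zero fun k => ?_
  have hproj : p (X.isotypicProj k x) = 0 := by
    rw [map_isotypicProj p hp, hx, map_zero]
  have hmem := isotypicProj_mem k x
  rw [← CStarRing.star_mul_self_eq_zero_iff]
  refine hfix _ (mul_mem_isotypicComponent (neg_add_cancel k)
    (star_mem_isotypicComponent hmem) hmem) ?_
  rw [map_mul, hproj, mul_zero]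

end CStarDynamicalSystem

/-! ### Freeness in terms of isotypic components -/

namespace CStarDynamicalSystem

open SO2
open scoped CStarAlgebra

variable {X : CStarDynamicalSystem.{u} SO2}

theorem ellwood_tmul_apply (x y : X.A) (g : SO2) : X.ellwood (x ⊗ₜ y) g = x * X.α g y := rfl

theorem fourierCoeffL_ellwood_tmul (k : ℤ) (x y : X.A) :
    fourierCoeffL k (X.ellwood (x ⊗ₜ y)) = x * X.isotypicProj k y :=
  (map_fourierCoeffL (ContinuousLinearMap.mul ℂ X.A x) k (X.orbitMap y)).symm

theorem ellwood_tmul_of_mem (x : X.A) {k : ℤ} {y : X.A} (hy : y ∈ X.isotypicComponent k) :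
    X.ellwood (x ⊗ₜ y) = charFunL k (x * y) := ContinuousMap.ext fun g => by
  rw [ellwood_tmul_apply, charFunL_apply, hy g, mul_smul_comm]

variable (X) in
/-- Fullness of the isotypic component `A(k)` with respect to the inner product `x* y`. -/
def IsFullAt (k : ℤ) : Prop :=
  1 ∈ (X.isotypicComponent (-k) * X.isotypicComponent k).topologicalClosure

theorem IsFullAt.add {j k : ℤ} (hj : X.IsFullAt j) (hk : X.IsFullAt k) : X.IsFullAt (j + k) := by
  let A := X.isotypicComponent
  have regroup : A (-k) * (A (-j) * A j * A k) ≤ A (-(j + k)) * A (j + k) := by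
    rw [mul_assoc (A (-j)), ← mul_assoc, neg_add_rev]
    exact mul_le_mul' (isotypicComponent_mul_le _ _) (isotypicComponent_mul_le _ _)
  refine Submodule.topologicalClosure_minimal _ ?_ (Submodule.isClosed_topologicalClosure _) hk
  calc A (-k) * A k
      ≤ (A (-k)).topologicalClosure * (A (-j) * A j * A k).topologicalClosure :=
        mul_le_mul' (Submodule.le_topologicalClosure _) (le_topologicalClosure_mul_left hj)
    _ ≤ (A (-k) * (A (-j) * A j * A k)).topologicalClosure :=
        topologicalClosure_mul_topologicalClosure_le _ _
    _ ≤ (A (-(j + k)) * A (j + k)).topologicalClosure := Submodule.topologicalClosure_mono regroup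

theorem IsFree.isFullAt (hX : X.IsFree) (k : ℤ) : X.IsFullAt k := by
  let average : C(SO2, X.A) →L[ℂ] X.A := (X.isotypicProj 0).comp (fourierCoeffL k)
  have average_ellwood (t) :
      average (X.ellwood t) ∈ X.isotypicComponent (-k) * X.isotypicComponent k := by
    induction t using TensorProduct.induction_on with
    | zero => rw [map_zero, map_zero]; exact Submodule.zero_mem _
    | tmul x y =>
      rw [ContinuousLinearMap.comp_apply, fourierCoeffL_ellwood_tmul,
        isotypicProj_mul_of_mem (isotypicProj_mem k y), zero_sub]
      exact Submodule.mul_mem_mul (isotypicProj_mem _ _) (isotypicProj_mem _ _)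
    | add s t hs ht => rw [map_add, map_add]; exact Submodule.add_mem _ hs ht
  have average_charFunL : average (charFunL k 1) = 1 := by
    rw [ContinuousLinearMap.comp_apply, fourierCoeffL_charFunL, if_pos rfl,
      isotypicProj_self one_mem_isotypicComponent]
  rw [IsFullAt, ← average_charFunL]
  refine map_mem_closure average.continuous (hX (charFunL k 1)) ?_
  rintro _ ⟨t, rfl⟩
  exact average_ellwood t

theorem IsFullAt.charFunL_mem_closure_range_ellwood {k : ℤ} (hk : X.IsFullAt k) (a : X.A) :
    charFunL k a ∈ (LinearMap.range X.ellwood).topologicalClosure := by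
  let L : X.A →L[ℂ] C(SO2, X.A) := (charFunL k).comp (ContinuousLinearMap.mul ℂ X.A a)
  have hL : X.isotypicComponent (-k) * X.isotypicComponent k ≤
      (LinearMap.range X.ellwood).comap L.toLinearMap :=
    Submodule.mul_le.2 fun x _ y hy => ⟨(a * x) ⊗ₜ y, by
      rw [ellwood_tmul_of_mem _ hy, mul_assoc]; rfl⟩
  have : L 1 ∈ (LinearMap.range X.ellwood).topologicalClosure :=
    map_mem_closure L.continuous hk fun _ hx => hL hx
  rwa [ContinuousLinearMap.comp_apply, ContinuousLinearMap.mul_apply', mul_one] at this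

theorem isFree_of_isFullAt (hone : X.IsFullAt 1) (hneg : X.IsFullAt (-1)) : X.IsFree := by
  have isFullAt (k : ℤ) : X.IsFullAt k := by
    induction k with
    | zero =>
      refine Submodule.le_topologicalClosure _ ?_
      have := Submodule.mul_mem_mul (one_mem_isotypicComponent (X := X)) one_mem_isotypicComponent
      rwa [mul_one] at this
    | succ n ih => exact ih.add hone
    | pred n ih => exact ih.add hneg
  exact fun f => mem_of_charFunL_mem (Submodule.isClosed_topologicalClosure _)
    (fun k a => (isFullAt k).charFunL_mem_closure_range_ellwood a) f

end CStarDynamicalSystem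

/-! ### The isotypic components are Morita equivalence bimodules -/

namespace HilbertBimodule

variable (N : HilbertBimodule B)

/-- The ideal of `B` spanned by the right inner products; `IsMorita` asks for its density. -/
def rinnerSpan : Submodule ℂ B :=
  Submodule.span ℂ (Set.range fun p : N.carrier × N.carrier => N.rinner p.1 p.2)

/-- The ideal of `B` spanned by the left inner products; `IsMorita` asks for its density. -/
def linnerSpan : Submodule ℂ B :=
  Submodule.span ℂ (Set.range fun p : N.carrier × N.carrier => N.linner p.1 p.2)

theorem mul_mem_rinnerSpan (b : B) {c : B} (hc : c ∈ N.rinnerSpan) : c * b ∈ N.rinnerSpan := by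
  suffices h : N.rinnerSpan ≤ N.rinnerSpan.comap (LinearMap.mulRight ℂ b) from h hc
  refine Submodule.span_le.2 ?_
  rintro _ ⟨p, rfl⟩
  exact Submodule.subset_span ⟨(p.1, op b • p.2), N.rinner_op_smul_right _ _ _⟩

theorem mul_mem_linnerSpan (b : B) {c : B} (hc : c ∈ N.linnerSpan) : b * c ∈ N.linnerSpan := by
  suffices h : N.linnerSpan ≤ N.linnerSpan.comap (LinearMap.mulLeft ℂ b) from h hc
  refine Submodule.span_le.2 ?_
  rintro _ ⟨p, rfl⟩
  exact Submodule.subset_span ⟨(b • p.1, p.2), N.linner_smul_left _ _ _⟩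

theorem isMorita_of_one_mem_closure (hr : (1 : B) ∈ closure (N.rinnerSpan : Set B))
    (hl : (1 : B) ∈ closure (N.linnerSpan : Set B)) : N.IsMorita where
  dense_rinner b := by
    have := map_mem_closure (f := (· * b)) (by fun_prop) hr fun _ => N.mul_mem_rinnerSpan b
    rwa [one_mul] at this
  dense_linner b := by
    have := map_mem_closure (f := (b * ·)) (by fun_prop) hl fun _ => N.mul_mem_linnerSpan b
    rwa [mul_one] at this

end HilbertBimodule

namespace FreeSystem

open CStarDynamicalSystem
open scoped CStarAlgebra

variable (S : FreeSystem B)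

theorem isometry_ι : Isometry S.ι := NonUnitalStarAlgHom.isometry S.ι S.ι_injective

theorem one_mem_closure_span_of_isFullAt {k : ℤ} (hk : S.IsFullAt k) {s : Set B}
    (h : ∀ x ∈ S.isotypicComponent (-k), ∀ y ∈ S.isotypicComponent k, ∃ b ∈ s, S.ι b = x * y) :
    (1 : B) ∈ closure (Submodule.span ℂ s : Set B) := by
  have hle : S.isotypicComponent (-k) * S.isotypicComponent k ≤
      (Submodule.span ℂ s).map (S.ι : B →ₗ[ℂ] S.A) := Submodule.mul_le.2 fun x hx y hy => by
    obtain ⟨b, hb, hbxy⟩ := h x hx y hy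
    exact ⟨b, Submodule.subset_span hb, hbxy⟩
  rw [S.isometry_ι.isUniformInducing.isInducing.closure_eq_preimage_closure_image,
    Set.mem_preimage, map_one]
  exact closure_mono hle hk

theorem isMorita (k : ℤ) : (S.isotypic k).IsMorita := by
  have star_mem {x : S.A} (hx : x ∈ S.isotypicComponent (-k)) :
      star x ∈ S.isotypicComponent k := neg_neg k ▸ star_mem_isotypicComponent hx
  refine HilbertBimodule.isMorita_of_one_mem_closure _ ?_ ?_
  · refine S.one_mem_closure_span_of_isFullAt (S.isFree.isFullAt k) fun x hx y hy => ?_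
    let x' : S.IsotypicCarrier k := ⟨star x, star_mem hx⟩
    let y' : S.IsotypicCarrier k := ⟨y, hy⟩
    exact ⟨_, ⟨(x', y'), rfl⟩,
      (ι_toB_star_mul x' y').trans (congrArg (· * y) (star_star x))⟩
  · refine S.one_mem_closure_span_of_isFullAt (S.isFree.isFullAt (-k)) fun x hx y hy => ?_
    let x' : S.IsotypicCarrier k := ⟨x, by rwa [neg_neg] at hx⟩
    let y' : S.IsotypicCarrier k := ⟨star y, star_mem hy⟩
    exact ⟨_, ⟨(x', y'), rfl⟩,
      (ι_toB_mul_star x' y').trans (congrArg (x * ·) (star_star y))⟩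

end FreeSystem

/-! ### Correspondences and their tensor products -/

namespace Correspondence

variable {M N P : Correspondence B}

theorem norm_eq_sqrt (x : M.carrier) : ‖x‖ = √‖M.rinner x x‖ := by
  rw [← M.norm_sq_eq_rinner, Real.sqrt_sq (norm_nonneg x)]

theorem rinner_sub_self (x y : M.carrier) : M.rinner (x - y) (x - y) =
    M.rinner x x - M.rinner x y - M.rinner y x + M.rinner y y :=
  M.toPre.rinner_sub_self x y

theorem eq_of_rinner_sub_self {x y : M.carrier} (h : M.rinner (x - y) (x - y) = 0) : x = y := by
  rw [← sub_eq_zero, ← norm_eq_zero, norm_eq_sqrt, h, norm_zero, Real.sqrt_zero]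

theorem norm_smul_le_left (b : B) (x : M.carrier) : ‖b • x‖ ≤ ‖b‖ * ‖x‖ := by
  rw [norm_eq_sqrt, norm_eq_sqrt x]
  exact M.toPre.norm_smul_le_left b x

theorem continuous_smul_left (b : B) : Continuous fun x : M.carrier => b • x :=
  AddMonoidHomClass.continuous_of_bound (DistribSMul.toAddMonoidHom M.carrier b) ‖b‖
    (norm_smul_le_left b)

theorem norm_rinner_le (x y : M.carrier) : ‖M.rinner x y‖ ≤ ‖x‖ * ‖y‖ := by
  rw [norm_eq_sqrt, norm_eq_sqrt]
  exact M.toPre.norm_rinner_le x y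

/-- The map `y ↦ ⟨x, y⟩`. -/
def rinnerL (x : M.carrier) : M.carrier →L[ℂ] B :=
  LinearMap.mkContinuous (M.toPre.sesq x) ‖x‖ fun y => norm_rinner_le x y

theorem continuous_rinner_right (x : M.carrier) : Continuous fun y => M.rinner x y :=
  (rinnerL x).continuous

theorem continuous_rinner_left (y : M.carrier) : Continuous fun x => M.rinner x y := by
  simp_rw [← M.star_rinner y]
  exact (continuous_rinner_right y).star

theorem add_tmul (x x' : M.carrier) (y : N.carrier) : tmul (x + x') y = tmul x y + tmul x' y :=
  (congrArg (Completion.coe' (α := (preTensor M N).carrier)) (TensorProduct.add_tmul x x' y)).trans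
    (Completion.coe_add _ _)

theorem tmul_add (x : M.carrier) (y y' : N.carrier) : tmul x (y + y') = tmul x y + tmul x y' :=
  (congrArg (Completion.coe' (α := (preTensor M N).carrier)) (TensorProduct.tmul_add x y y')).trans
    (Completion.coe_add _ _)

theorem smul_tmul (b : B) (x : M.carrier) (y : N.carrier) : b • tmul x y = tmul (b • x) y :=
  (Completion.coe_smul (X := (preTensor M N).carrier) b _).symm

theorem complex_smul_tmul (c : ℂ) (x : M.carrier) (y : N.carrier) :
    c • tmul x y = tmul (c • x) y :=
  (Completion.coe_smul (X := (preTensor M N).carrier) c _).symm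

theorem tmul_smul (c : ℂ) (x : M.carrier) (y : N.carrier) : tmul x (c • y) = c • tmul x y := by
  rw [complex_smul_tmul]
  exact congrArg (Completion.coe' (α := (preTensor M N).carrier))
    (TensorProduct.smul_tmul c x y).symm

@[elab_as_elim]
theorem tensor_induction {p : (tensor M N).carrier → Prop} (u : (tensor M N).carrier)
    (isClosed : IsClosed {u | p u}) (tmul : ∀ x y, p (tmul x y))
    (add : ∀ u v, p u → p v → p (u + v)) : p u := by
  refine Completion.induction_on (α := (preTensor M N).carrier) u isClosed fun t => ?_
  refine TensorCarrier.induction (M := M) (N := N)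
    (p := fun t => p (Completion.coe' (α := (preTensor M N).carrier) t)) t tmul fun s t hs ht => ?_
  exact Completion.coe_add (α := (preTensor M N).carrier) s t ▸ add _ _ hs ht

theorem norm_tmul_le (x : M.carrier) (y : N.carrier) : ‖tmul x y‖ ≤ ‖x‖ * ‖y‖ := by
  refine (pow_le_pow_iff_left₀ (norm_nonneg _) (by positivity) two_ne_zero).1 ?_
  calc ‖tmul x y‖ ^ 2 = ‖N.rinner y (M.rinner x x • y)‖ := by rw [norm_sq_eq_rinner, rinner_tmul]
    _ ≤ ‖y‖ * (‖M.rinner x x‖ * ‖y‖) := (norm_rinner_le _ _).trans <| by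
        gcongr; exact norm_smul_le_left _ _
    _ = (‖x‖ * ‖y‖) ^ 2 := by rw [← M.norm_sq_eq_rinner]; ring

/-- The map `y ↦ x ⊗ y`. -/
def tmulL (N : Correspondence B) (x : M.carrier) : N.carrier →L[ℂ] (tensor M N).carrier :=
  LinearMap.mkContinuous
    { toFun := fun y => tmul x y
      map_add' := tmul_add x
      map_smul' := fun c y => tmul_smul c x y } ‖x‖ fun y => norm_tmul_le x y

theorem continuous_tmul_right (x : M.carrier) : Continuous fun y : N.carrier => tmul x y :=
  (tmulL N x).continuous

theorem continuous_tmul_left (y : N.carrier) : Continuous fun x : M.carrier => tmul x y :=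
  AddMonoidHomClass.continuous_of_bound
    (AddMonoidHom.mk' (fun x : M.carrier => tmul x y) fun x x' => add_tmul x x' y) ‖y‖
    fun x => (norm_tmul_le x y).trans_eq (mul_comm _ _)

/-- The extension of a bounded linear map from the algebraic tensor product to `M ⊗_B N`. -/
def extendTensor {E : Type*} [NormedAddCommGroup E] [NormedSpace ℂ E] [CompleteSpace E]
    (g : (preTensor M N).carrier →L[ℂ] E) : (tensor M N).carrier →L[ℂ] E :=
  g.extend (Completion.toComplL (𝕜 := ℂ) (E := (preTensor M N).carrier))

theorem extendTensor_tmul {E : Type*} [NormedAddCommGroup E] [NormedSpace ℂ E] [CompleteSpace E]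
    (g : (preTensor M N).carrier →L[ℂ] E) (x : M.carrier) (y : N.carrier) :
    extendTensor g (tmul x y) = g (TensorCarrier.tmul x y) :=
  ContinuousLinearMap.extend_eq g Completion.denseRange_coe
    (Completion.isUniformInducing_coe _) _

namespace Iso

theorem norm_map (φ : Iso M N) (x : M.carrier) : ‖φ x‖ = ‖x‖ := by
  rw [norm_eq_sqrt, norm_eq_sqrt, φ.map_rinner]

theorem continuous (φ : Iso M N) : Continuous φ :=
  (AddMonoidHomClass.isometry_of_norm φ.toEquiv φ.norm_map).continuous

/-- The inverse isomorphism. -/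
def symm (φ : Iso M N) : Iso N M where
  toEquiv := φ.toEquiv.symm
  map_smul_left b x := by
    rw [LinearEquiv.symm_apply_eq, φ.map_smul_left, LinearEquiv.apply_symm_apply]
  map_smul_right b x := by
    rw [LinearEquiv.symm_apply_eq, φ.map_smul_right, LinearEquiv.apply_symm_apply]
  map_rinner x y := by
    rw [← φ.map_rinner, LinearEquiv.apply_symm_apply, LinearEquiv.apply_symm_apply]

theorem apply_symm_apply (φ : Iso M N) (x : N.carrier) : φ (φ.symm x) = x :=
  φ.toEquiv.apply_symm_apply x

theorem injective (φ : Iso M N) : Function.Injective φ := φ.toEquiv.injective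

theorem surjective (φ : Iso M N) : Function.Surjective φ := φ.toEquiv.surjective

/-- The composition of isomorphisms. -/
def trans (φ : Iso M N) (ψ : Iso N P) : Iso M P where
  toEquiv := φ.toEquiv.trans ψ.toEquiv
  map_smul_left b x := by simp only [LinearEquiv.trans_apply, φ.map_smul_left, ψ.map_smul_left]
  map_smul_right b x := by simp only [LinearEquiv.trans_apply, φ.map_smul_right, ψ.map_smul_right]
  map_rinner x y := by simp only [LinearEquiv.trans_apply, φ.map_rinner, ψ.map_rinner]

theorem ext_tmul {φ ψ : Iso (tensor M N) P} (h : ∀ x y, φ (tmul x y) = ψ (tmul x y)) :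
    φ = ψ := by
  refine Iso.ext (LinearEquiv.ext fun u => ?_)
  induction u using tensor_induction with
  | isClosed => exact isClosed_eq φ.continuous ψ.continuous
  | tmul x y => exact h x y
  | add u v hu hv => rw [map_add, map_add, hu, hv]

end Iso

section RinnerPreserving

variable (L : M.carrier →ₗ[ℂ] N.carrier) (hL : ∀ x y, N.rinner (L x) (L y) = M.rinner x y)

include hL

theorem isometry_of_map_rinner : Isometry L :=
  AddMonoidHomClass.isometry_of_norm L fun x => by rw [norm_eq_sqrt, norm_eq_sqrt, hL]

theorem map_op_smul_of_map_rinner (b : Bᵐᵒᵖ) (x : M.carrier) : L (b • x) = b • L x := by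
  induction b using MulOpposite.rec' with | _ b => ?_
  refine eq_of_rinner_sub_self ?_
  simp only [rinner_sub_self, hL, rinner_op_smul_left, rinner_op_smul_right, mul_assoc]
  abel

theorem bijective_of_map_rinner (hd : DenseRange L) : Function.Bijective L := by
  have hiso := isometry_of_map_rinner L hL
  refine ⟨hiso.injective, Set.range_eq_univ.1 ?_⟩
  rw [← hiso.isClosedEmbedding.isClosed_range.closure_eq, hd.closure_range]

end RinnerPreserving

/-- A left `B`-linear map with dense range that preserves the inner products, as an
isomorphism. -/
def isoOfDense (L : M.carrier →ₗ[ℂ] N.carrier) (hL : ∀ x y, N.rinner (L x) (L y) = M.rinner x y)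
    (hleft : ∀ (b : B) x, L (b • x) = b • L x) (hd : DenseRange L) : Iso M N where
  toEquiv := LinearEquiv.ofBijective L (bijective_of_map_rinner L hL hd)
  map_smul_left := hleft
  map_smul_right := map_op_smul_of_map_rinner L hL
  map_rinner := hL

/-- The linear map on the algebraic tensor product induced by a bilinear map. -/
def TensorCarrier.lift {E : Type*} [AddCommGroup E] [Module ℂ E]
    (f : M.carrier →ₗ[ℂ] N.carrier →ₗ[ℂ] E) : TensorCarrier M N →ₗ[ℂ] E :=
  TensorProduct.lift f

theorem TensorCarrier.lift_tmul {E : Type*} [AddCommGroup E] [Module ℂ E]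
    (f : M.carrier →ₗ[ℂ] N.carrier →ₗ[ℂ] E) (x : M.carrier) (y : N.carrier) :
    TensorCarrier.lift f (TensorCarrier.tmul x y) = f x y :=
  TensorProduct.lift.tmul x y

section TensorLift

variable (f : M.carrier →ₗ[ℂ] N.carrier →ₗ[ℂ] P.carrier)
  (hf : ∀ x x' y y', P.rinner (f x y) (f x' y') = N.rinner y (M.rinner x x' • y'))

include hf in
theorem TensorCarrier.rinner_lift (s t : TensorCarrier M N) :
    P.rinner (lift f s) (lift f t) = sesq M N s t := by
  induction s using TensorCarrier.induction with
  | h x y =>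
    induction t using TensorCarrier.induction with
    | h x' y' => rw [lift_tmul, lift_tmul, hf, sesq_tmul]
    | hadd t t' h h' => rw [map_add, map_add, P.rinner_add_right, h, h']
  | hadd s s' h h' => rw [map_add, map_add, P.rinner_add_left, h, h', LinearMap.add_apply]

/-- The map on `M ⊗_B N` induced by a bilinear map that preserves the inner products. -/
def tensorLift : (tensor M N).carrier →L[ℂ] P.carrier :=
  extendTensor (LinearMap.mkContinuous
    (show (preTensor M N).carrier →ₗ[ℂ] P.carrier from TensorCarrier.lift f) 1 fun t => by
      rw [norm_eq_sqrt, one_mul, (preTensor M N).norm_def]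
      exact (congrArg (fun b => √‖b‖) (TensorCarrier.rinner_lift f hf t t)).le)

theorem tensorLift_tmul (x : M.carrier) (y : N.carrier) : tensorLift f hf (tmul x y) = f x y :=
  extendTensor_tmul _ x y

theorem rinner_tensorLift (u v : (tensor M N).carrier) :
    P.rinner (tensorLift f hf u) (tensorLift f hf v) = (tensor M N).rinner u v := by
  induction u using tensor_induction with
  | isClosed =>
    exact isClosed_eq ((continuous_rinner_left _).comp (tensorLift f hf).continuous)
      (continuous_rinner_left v)
  | tmul x y =>
    induction v using tensor_induction with
    | isClosed =>
      exact isClosed_eq ((continuous_rinner_right _).comp (tensorLift f hf).continuous)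
        (continuous_rinner_right _)
    | tmul x' y' => rw [tensorLift_tmul, tensorLift_tmul, hf, rinner_tmul]
    | add u v hu hv => rw [map_add, rinner_add_right, rinner_add_right, hu, hv]
  | add u v hu hv => rw [map_add, rinner_add_left, rinner_add_left, hu, hv]

theorem tensorLift_smul (hleft : ∀ (b : B) x y, f (b • x) y = b • f x y) (b : B)
    (u : (tensor M N).carrier) : tensorLift f hf (b • u) = b • tensorLift f hf u := by
  induction u using tensor_induction with
  | isClosed =>
    exact isClosed_eq ((tensorLift f hf).continuous.comp (continuous_smul_left b))
      ((continuous_smul_left b).comp (tensorLift f hf).continuous)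
  | tmul x y => rw [smul_tmul, tensorLift_tmul, tensorLift_tmul, hleft]
  | add u v hu hv => rw [smul_add, map_add, map_add, smul_add, hu, hv]

theorem denseRange_tensorLift (hd : Dense (Submodule.span ℂ
      (Set.range fun p : M.carrier × N.carrier => f p.1 p.2) : Set P.carrier)) :
    DenseRange (tensorLift f hf) := by
  refine hd.mono (?_ : _ ≤ LinearMap.range (tensorLift f hf).toLinearMap)
  rw [Submodule.span_le]
  rintro _ ⟨p, rfl⟩
  exact ⟨tmul p.1 p.2, tensorLift_tmul f hf _ _⟩

end TensorLift

end Correspondence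

/-! ### Multiplication of isotypic components -/

namespace FreeSystem

open CStarDynamicalSystem

variable (S : FreeSystem B) {k l m : ℤ}

theorem isotypicComponent_le_closure_mul (h : k + l = m) :
    S.isotypicComponent m ≤ (S.isotypicComponent k * S.isotypicComponent l).topologicalClosure := by
  obtain rfl : k = m + -l := eq_add_neg_of_add_eq h
  calc S.isotypicComponent m
    _ ≤ (S.isotypicComponent m *
          (S.isotypicComponent (-l) * S.isotypicComponent l)).topologicalClosure :=
      le_topologicalClosure_mul_right (S.isFree.isFullAt l)
    _ ≤ (S.isotypicComponent (m + -l) * S.isotypicComponent l).topologicalClosure := by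
      rw [← mul_assoc]
      exact Submodule.topologicalClosure_mono
        (mul_le_mul_left (isotypicComponent_mul_le m (-l)) _)

/-- The inclusion of `A(k)` in `A`. -/
def valL (k : ℤ) : (S.isotypic k).carrier →L[ℂ] S.A := (S.isotypicSubmodule k).subtypeL

variable {S}

/-- An element of `A` of degree `k`, as an element of the bimodule `A(k)`. -/
def isotypicMk (x : S.A) (hx : x ∈ S.isotypicComponent k) : (S.isotypic k).carrier :=
  (⟨x, hx⟩ : S.isotypicSubmodule k)

theorem valL_isotypicMk (x : S.A) (hx : x ∈ S.isotypicComponent k) :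
    S.valL k (isotypicMk x hx) = x := rfl

theorem valL_mem (x : (S.isotypic k).carrier) : S.valL k x ∈ S.isotypicComponent k := x.2

theorem valL_injective : Function.Injective (S.valL k) := Subtype.val_injective

theorem valL_smul (b : B) (x : (S.isotypic k).carrier) :
    S.valL k (b • x) = S.ι b * S.valL k x := rfl

theorem valL_op_smul (b : Bᵐᵒᵖ) (x : (S.isotypic k).carrier) :
    S.valL k (b • x) = S.valL k x * S.ι (unop b) := rfl

theorem ι_rinner (x y : (S.isotypic k).carrier) :
    S.ι ((S.isotypic k).rinner x y) = star (S.valL k x) * S.valL k y :=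
  ι_toB_star_mul (S := S) (k := k) x y

theorem ι_linner (x y : (S.isotypic k).carrier) :
    S.ι ((S.isotypic k).linner x y) = S.valL k x * star (S.valL k y) :=
  ι_toB_mul_star (S := S) (k := k) x y

/-- The multiplication `A(k) × A(l) → A(k + l)`. -/
def mulL (h : k + l = m) :
    (S.isotypic k).carrier →ₗ[ℂ] (S.isotypic l).carrier →ₗ[ℂ] (S.isotypic m).carrier :=
  LinearMap.mk₂ ℂ (fun x y => isotypicMk (S.valL k x * S.valL l y)
      (mul_mem_isotypicComponent h (valL_mem x) (valL_mem y)))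
    (fun x x' y => valL_injective (by simp only [valL_isotypicMk, map_add, add_mul]))
    (fun c x y => valL_injective (by simp only [valL_isotypicMk, map_smul, smul_mul_assoc]))
    (fun x y y' => valL_injective (by simp only [valL_isotypicMk, map_add, mul_add]))
    (fun c x y => valL_injective (by simp only [valL_isotypicMk, map_smul, mul_smul_comm]))

theorem valL_mulL (h : k + l = m) (x : (S.isotypic k).carrier) (y : (S.isotypic l).carrier) :
    S.valL m (mulL h x y) = S.valL k x * S.valL l y := rfl

theorem mulL_smul (h : k + l = m) (b : B) (x : (S.isotypic k).carrier)
    (y : (S.isotypic l).carrier) : mulL h (b • x) y = b • mulL h x y :=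
  valL_injective (by simp only [valL_mulL, valL_smul, mul_assoc])

theorem rinner_mulL (h : k + l = m) (x x' : (S.isotypic k).carrier)
    (y y' : (S.isotypic l).carrier) :
    (S.isotypic m).rinner (mulL h x y) (mulL h x' y') =
      (S.isotypic l).rinner y ((S.isotypic k).rinner x x' • y') :=
  S.ι_injective (by simp only [ι_rinner, valL_mulL, valL_smul, star_mul, mul_assoc])

theorem dense_span_mulL (h : k + l = m) :
    Dense (Submodule.span ℂ (Set.range fun p : (S.isotypic k).carrier × (S.isotypic l).carrier =>
      mulL h p.1 p.2) : Set (S.isotypic m).carrier) := by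
  intro z
  set V := Submodule.span ℂ (Set.range fun p : (S.isotypic k).carrier × (S.isotypic l).carrier =>
      mulL h p.1 p.2)
  have mul_le : S.isotypicComponent k * S.isotypicComponent l ≤ V.map (S.valL m).toLinearMap :=
    Submodule.mul_le.2 fun x hx y hy =>
      ⟨_, Submodule.subset_span ⟨(isotypicMk x hx, isotypicMk y hy), rfl⟩, rfl⟩
  have inducing : Topology.IsInducing (S.valL m) := Topology.IsInducing.subtypeVal
  rw [inducing.closure_eq_preimage_closure_image]
  exact closure_mono mul_le (S.isotypicComponent_le_closure_mul h (valL_mem z))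

variable {M N : Correspondence B}

/-- The isomorphism `M ⊗_B N ≅ A(k + l)` given by the multiplication of `A` and by isomorphisms
`M ≅ A(k)` and `N ≅ A(l)`. -/
def mulIso (h : k + l = m) (φ : Correspondence.Iso M (S.isotypic k).toCorrespondence)
    (ψ : Correspondence.Iso N (S.isotypic l).toCorrespondence) :
    Correspondence.Iso (M.tensor N) (S.isotypic m).toCorrespondence :=
  let f : M.carrier →ₗ[ℂ] N.carrier →ₗ[ℂ] (S.isotypic m).toCorrespondence.carrier :=
    (mulL h).compl₁₂ φ.toEquiv.toLinearMap ψ.toEquiv.toLinearMap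
  have hf (x x' y y') : (S.isotypic m).rinner (f x y) (f x' y') =
      N.rinner y (M.rinner x x' • y') := by
    rw [← ψ.map_rinner, ψ.map_smul_left, ← φ.map_rinner]
    exact rinner_mulL h _ _ _ _
  Correspondence.isoOfDense (Correspondence.tensorLift f hf).toLinearMap
    (Correspondence.rinner_tensorLift f hf)
    (Correspondence.tensorLift_smul f hf fun b x y =>
      (congrArg (mulL h · (ψ y)) (φ.map_smul_left b x)).trans (mulL_smul h b _ _))
    (Correspondence.denseRange_tensorLift f hf <| by
      refine (dense_span_mulL h).mono (Submodule.span_mono ?_)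
      rintro _ ⟨p, rfl⟩
      obtain ⟨⟨x, hx⟩, y, hy⟩ := And.intro (φ.surjective p.1) (ψ.surjective p.2)
      exact ⟨(x, y), congrArg₂ (fun u v => mulL h u v) hx hy⟩)

theorem valL_mulIso_tmul (h : k + l = m)
    (φ : Correspondence.Iso M (S.isotypic k).toCorrespondence)
    (ψ : Correspondence.Iso N (S.isotypic l).toCorrespondence) (x : M.carrier) (y : N.carrier) :
    S.valL m (mulIso h φ ψ (Correspondence.tmul x y)) = S.valL k (φ x) * S.valL l (ψ y) :=
  congrArg (S.valL m) (Correspondence.tensorLift_tmul _ _ x y)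

variable (S)

/-- The map `B → A(0)` given by `ι`. -/
def zeroL : B →ₗ[ℂ] (S.isotypic 0).carrier where
  toFun b := isotypicMk (S.ι b) (mem_isotypicComponent_zero.2 fun g => S.α_ι g b)
  map_add' a b := valL_injective (map_add S.ι a b)
  map_smul' c b := valL_injective (map_smul S.ι c b)

theorem bijective_zeroL : Function.Bijective S.zeroL :=
  ⟨fun _ _ hab => S.ι_injective (congrArg (S.valL 0) hab), fun x =>
    ⟨S.toB (S.valL 0 x), valL_injective (S.ι_toB (mem_isotypicComponent_zero.1 (valL_mem x)))⟩⟩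

/-- The identification of `B` with `A(0)`. -/
def zeroIso : Correspondence.Iso (Correspondence.self B) (S.isotypic 0).toCorrespondence where
  toEquiv := LinearEquiv.ofBijective S.zeroL S.bijective_zeroL
  map_smul_left a (b : B) := valL_injective (map_mul S.ι a b)
  map_smul_right a (b : B) := valL_injective (map_mul S.ι b (unop a))
  map_rinner (a b : B) := S.ι_injective <| (ι_rinner (S.zeroL a) (S.zeroL b)).trans
    ((congrArg (· * S.ι b) (map_star S.ι a).symm).trans (map_mul S.ι (star a) b).symm)

end FreeSystem

namespace HilbertBimodule

theorem linner_zero_left (N : HilbertBimodule B) (y : N.carrier) : N.linner 0 y = 0 := by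
  simpa only [zero_smul, zero_mul] using N.linner_smul_left 0 0 y

theorem IsMorita.eq_of_forall_smul_eq {N : HilbertBimodule B} (hN : N.IsMorita) {a b : B}
    (h : ∀ z : N.carrier, a • z = b • z) : a = b := by
  suffices ∀ c : B, (a - b) * c = 0 by simpa only [mul_one, sub_eq_zero] using this 1
  intro c
  let V : Submodule ℂ B := LinearMap.ker (LinearMap.mulLeft ℂ (a - b))
  have isClosed : IsClosed (V : Set B) :=
    isClosed_eq (f := fun c : B => (a - b) * c) (by fun_prop) continuous_const
  have span_le : N.linnerSpan ≤ V := Submodule.span_le.2 <| by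
    rintro _ ⟨p, rfl⟩
    change (a - b) * N.linner p.1 p.2 = 0
    rw [← N.linner_smul_left, sub_smul, h, sub_self, N.linner_zero_left]
  exact closure_minimal span_le isClosed (hN.dense_linner c)

theorem linner_eq_of_iso {M N : HilbertBimodule B} (hN : N.IsMorita)
    (φ : Correspondence.Iso M.toCorrespondence N.toCorrespondence) (x y : M.carrier) :
    N.linner (φ x) (φ y) = M.linner x y := by
  refine hN.eq_of_forall_smul_eq fun z => ?_
  obtain ⟨w, rfl⟩ := φ.surjective z
  rw [N.linner_smul, φ.map_rinner, ← φ.map_smul_left, M.linner_smul, φ.map_smul_right]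

end HilbertBimodule

/-! ### Existence and uniqueness of the factor system -/

namespace FreeSystem

open CStarDynamicalSystem Correspondence

variable {S : FreeSystem B} {N : HilbertBimodule B} (φ : HilbertBimodule.Iso N (S.isotypic 1))

/-- The map `x̃ ↦ φ(x)*` from the dual of `N` to `A(-1)`. -/
def dualMap : N.dual.carrier →ₗ[ℂ] (S.isotypic (-1)).carrier where
  toFun x := isotypicMk (star (S.valL 1 (φ.toIso (N.ofDual x))))
    (star_mem_isotypicComponent (valL_mem _))
  map_add' x y := valL_injective <| by
    change star (S.valL 1 (φ.toIso (N.ofDual x + N.ofDual y))) =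
      star (S.valL 1 (φ.toIso (N.ofDual x))) + star (S.valL 1 (φ.toIso (N.ofDual y)))
    rw [map_add, map_add, star_add]
  map_smul' c x := valL_injective <| by
    change star (S.valL 1 (φ.toIso (conj c • N.ofDual x))) =
      c • star (S.valL 1 (φ.toIso (N.ofDual x)))
    rw [map_smul, map_smul, star_smul, starRingEnd_apply, star_star]

theorem valL_dualMap (x : N.dual.carrier) :
    S.valL (-1) (dualMap φ x) = star (S.valL 1 (φ.toIso (N.ofDual x))) := rfl

theorem bijective_dualMap : Function.Bijective (dualMap φ) := by
  refine ⟨fun x y hxy => ?_, fun x => ?_⟩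
  · have := congrArg (S.valL (-1)) hxy
    rw [valL_dualMap, valL_dualMap] at this
    exact φ.toIso.injective (valL_injective (star_injective this))
  · obtain ⟨y, hy⟩ := φ.toIso.surjective
      (isotypicMk _ (star_mem_isotypicComponent (valL_mem x)))
    refine ⟨N.toDual y, valL_injective ?_⟩
    exact (congrArg (fun z => star (S.valL 1 z)) hy).trans (star_star _)

/-- The isomorphism of the dual of `N` with `A(-1)` given by `N ≅ A(1)`. -/
def dualIso : Correspondence.Iso N.dual.toCorrespondence (S.isotypic (-1)).toCorrespondence where
  toEquiv := LinearEquiv.ofBijective (dualMap φ) (bijective_dualMap φ)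
  map_smul_left b x := valL_injective <| by
    change star (S.valL 1 (φ.toIso (op (star b) • N.ofDual x))) =
      S.ι b * star (S.valL 1 (φ.toIso (N.ofDual x)))
    rw [φ.map_smul_right, valL_op_smul, star_mul, unop_op, map_star, star_star]
  map_smul_right b x := valL_injective <| by
    change star (S.valL 1 (φ.toIso (star (unop b) • N.ofDual x))) =
      star (S.valL 1 (φ.toIso (N.ofDual x))) * S.ι (unop b)
    rw [φ.map_smul_left, valL_smul, star_mul, map_star, star_star]
  map_rinner x y := S.ι_injective <| (ι_rinner _ _).trans <| by
    change star (star (S.valL 1 (φ.toIso (N.ofDual x)))) * star (S.valL 1 (φ.toIso (N.ofDual y))) =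
      S.ι (N.linner (N.ofDual x) (N.ofDual y))
    rw [star_star, ← φ.map_linner, ι_linner]

/-- Isomorphisms of the tensor powers of `M` with the isotypic components of degrees `d n`. -/
def powIso (d : ℕ → ℤ) (h : ∀ n, d (n + 1) + d 1 = d (n + 2)) {M : Correspondence B}
    (φ₀ : Correspondence.Iso (self B) (S.isotypic (d 0)).toCorrespondence)
    (φ₁ : Correspondence.Iso M (S.isotypic (d 1)).toCorrespondence) :
    ∀ n, Correspondence.Iso (M.pow n) (S.isotypic (d n)).toCorrespondence
  | 0 => φ₀
  | 1 => φ₁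
  | n + 2 => mulIso (h n) (powIso d h φ₀ φ₁ (n + 1)) φ₁

/-- The isomorphisms `N(k) ≅ A(k)` given by `N ≅ A(1)`. -/
def zpowIso : ∀ k, Correspondence.Iso (N.zpow k) (S.isotypic k).toCorrespondence
  | Int.ofNat n => powIso Int.ofNat (fun _ => rfl) S.zeroIso φ.toIso n
  | Int.negSucc n => powIso Int.negOfNat (fun _ => rfl) S.zeroIso (dualIso φ) (n + 1)

/-- The embedding of `N(k)` in `A` given by `N ≅ A(1)`. -/
def zpowVal (k : ℤ) (x : (N.zpow k).carrier) : S.A := S.valL k (zpowIso φ k x)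

theorem zpowVal_injective (k : ℤ) : Function.Injective (zpowVal φ k) :=
  valL_injective.comp (zpowIso φ k).injective

theorem continuous_zpowVal (k : ℤ) : Continuous (zpowVal φ k) :=
  (S.valL k).continuous.comp (zpowIso φ k).continuous

theorem zpowVal_add (k : ℤ) (x y : (N.zpow k).carrier) :
    zpowVal φ k (x + y) = zpowVal φ k x + zpowVal φ k y :=
  (congrArg (S.valL k) (map_add (zpowIso φ k).toEquiv x y)).trans (map_add (S.valL k) _ _)

theorem zpowVal_smul (k : ℤ) (b : B) (x : (N.zpow k).carrier) :
    zpowVal φ k (b • x) = S.ι b * zpowVal φ k x :=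
  congrArg (S.valL k) ((zpowIso φ k).map_smul_left b x)

theorem zpowVal_op_smul (k : ℤ) (b : B) (x : (N.zpow k).carrier) :
    zpowVal φ k (op b • x) = zpowVal φ k x * S.ι b :=
  congrArg (S.valL k) ((zpowIso φ k).map_smul_right (op b) x)

theorem ι_linner_eq_zpowVal_mul (x y : N.carrier) :
    S.ι (N.linner x y) = zpowVal φ 1 x * zpowVal φ (Int.negSucc 0) (N.toDual y) :=
  (congrArg S.ι (φ.map_linner x y)).symm.trans (ι_linner _ _)

theorem ι_rinner_eq_zpowVal_mul (x y : N.carrier) :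
    S.ι (N.rinner x y) = zpowVal φ (Int.negSucc 0) (N.toDual x) * zpowVal φ 1 y :=
  (congrArg S.ι (φ.map_rinner x y)).symm.trans (ι_rinner _ _)

/-- The maps `Ψ_{k,l}` given by the multiplication of `A`. -/
def factorMap {k l m : ℤ} (h : k + l = m) :
    Correspondence.Iso ((N.zpow k).tensor (N.zpow l)) (N.zpow m) :=
  (mulIso h (zpowIso φ k) (zpowIso φ l)).trans (zpowIso φ m).symm

theorem zpowIso_factorMap {k l m : ℤ} (h : k + l = m) (u : ((N.zpow k).tensor (N.zpow l)).carrier) :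
    zpowIso φ m (factorMap φ h u) = mulIso h (zpowIso φ k) (zpowIso φ l) u :=
  (zpowIso φ m).apply_symm_apply _

theorem zpowVal_factorMap_tmul {k l m : ℤ} (h : k + l = m) (x : (N.zpow k).carrier)
    (y : (N.zpow l).carrier) :
    zpowVal φ m (factorMap φ h (tmul x y)) = zpowVal φ k x * zpowVal φ l y :=
  (congrArg (S.valL m) (zpowIso_factorMap φ h _)).trans (valL_mulIso_tmul _ _ _ _ _)

/-- The factor system given by the multiplication of `A`. -/
def factorSystem : N.FactorSystem where
  Ψ := factorMap φ
  assoc h₁₂ h₂₃ h h' x y z := zpowVal_injective φ _ <| by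
    simp only [zpowVal_factorMap_tmul, mul_assoc]
  zero_left k b x := zpowVal_injective φ _ <|
    (zpowVal_factorMap_tmul φ _ _ _).trans (zpowVal_smul φ k b x).symm
  zero_right k x b := zpowVal_injective φ _ <|
    (zpowVal_factorMap_tmul φ _ _ _).trans (zpowVal_op_smul φ k b x).symm
  pos n u := (zpowIso φ (Int.ofNat (n + 2))).injective
    ((zpowIso φ (Int.ofNat (n + 2))).apply_symm_apply _)
  neg n u := (zpowIso φ (Int.negSucc (n + 1))).injective
    ((zpowIso φ (Int.negSucc (n + 1))).apply_symm_apply _)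
  one_neg_one x y := zpowVal_injective φ 0 <|
    (zpowVal_factorMap_tmul φ _ _ _).trans (ι_linner_eq_zpowVal_mul φ x y).symm
  neg_one_one x y := zpowVal_injective φ 0 <|
    (zpowVal_factorMap_tmul φ _ _ _).trans (ι_rinner_eq_zpowVal_mul φ x y).symm

theorem hasFactorSystem : S.HasFactorSystem (factorSystem φ) :=
  ⟨zpowIso φ, fun _ => rfl, fun h x y => zpowVal_factorMap_tmul φ h x y⟩

variable (F : N.FactorSystem)

/-- The map `Ψ_{k,l}` of a factor system is given by the multiplication of `A`. -/
def IsMulAt (k l : ℤ) : Prop :=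
  ∀ (m : ℤ) (h : k + l = m) (x : (N.zpow k).carrier) (y : (N.zpow l).carrier),
    zpowVal φ m (F.Ψ h (tmul x y)) = zpowVal φ k x * zpowVal φ l y

variable {φ F}

theorem IsMulAt.assoc_right {k₁ k₂ k₃ : ℤ} (h₁₂ : IsMulAt φ F k₁ k₂) (h₂₃ : IsMulAt φ F k₂ k₃)
    (h : IsMulAt φ F (k₁ + k₂) k₃) : IsMulAt φ F k₁ (k₂ + k₃) := by
  intro m hm x w
  obtain ⟨u, rfl⟩ := (F.Ψ (rfl : k₂ + k₃ = k₂ + k₃)).surjective w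
  induction u using tensor_induction with
  | isClosed =>
    refine isClosed_eq ?_ ?_
    · exact (continuous_zpowVal φ m).comp ((F.Ψ hm).continuous.comp
        ((continuous_tmul_right x).comp (F.Ψ rfl).continuous))
    · exact continuous_const.mul ((continuous_zpowVal φ _).comp (F.Ψ rfl).continuous)
  | tmul y z =>
    have hm' : k₁ + k₂ + k₃ = m := by rw [add_assoc, hm]
    rw [← F.assoc rfl rfl hm' hm, h, h₁₂, h₂₃, mul_assoc]
  | add u v hu hv => rw [map_add, tmul_add, map_add, zpowVal_add, zpowVal_add, hu, hv, mul_add]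

theorem IsMulAt.assoc_left {k₁ k₂ k₃ : ℤ} (h₁₂ : IsMulAt φ F k₁ k₂) (h₂₃ : IsMulAt φ F k₂ k₃)
    (h : IsMulAt φ F k₁ (k₂ + k₃)) : IsMulAt φ F (k₁ + k₂) k₃ := by
  intro m hm w z
  obtain ⟨u, rfl⟩ := (F.Ψ (rfl : k₁ + k₂ = k₁ + k₂)).surjective w
  induction u using tensor_induction with
  | isClosed =>
    refine isClosed_eq ?_ ?_
    · exact (continuous_zpowVal φ m).comp ((F.Ψ hm).continuous.comp
        ((continuous_tmul_left z).comp (F.Ψ rfl).continuous))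
    · exact ((continuous_zpowVal φ _).comp (F.Ψ rfl).continuous).mul continuous_const
  | tmul x y =>
    have hm' : k₁ + (k₂ + k₃) = m := by rw [← add_assoc, hm]
    rw [F.assoc rfl rfl hm hm', h, h₁₂, h₂₃, mul_assoc]
  | add u v hu hv => rw [map_add, add_tmul, map_add, zpowVal_add, zpowVal_add, hu, hv, add_mul]

variable (φ F)

theorem isMulAt_zero_left (l : ℤ) : IsMulAt φ F 0 l := by
  intro m hm (b : B) y
  obtain rfl : l = m := by rw [← hm, zero_add]
  exact (congrArg (zpowVal φ l) (F.zero_left l b y)).trans (zpowVal_smul φ l b y)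

theorem isMulAt_zero_right (k : ℤ) : IsMulAt φ F k 0 := by
  intro m hm x (b : B)
  obtain rfl : k = m := by rw [← hm, add_zero]
  exact (congrArg (zpowVal φ k) (F.zero_right k x b)).trans (zpowVal_op_smul φ k b x)

theorem isMulAt_ofNat_one (n : ℕ) : IsMulAt φ F (Int.ofNat n) 1 := by
  cases n with
  | zero => exact isMulAt_zero_left φ F 1
  | succ n =>
    intro m hm x y
    obtain rfl : Int.ofNat (n + 2) = m := hm
    exact (congrArg (zpowVal φ (Int.ofNat (n + 2))) (F.pos n (tmul x y))).trans
      (valL_mulIso_tmul _ _ _ _ _)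

theorem isMulAt_negSucc_neg_one (n : ℕ) : IsMulAt φ F (Int.negSucc n) (-1) := by
  intro m hm x y
  obtain rfl : Int.negSucc (n + 1) = m := hm
  exact (congrArg (zpowVal φ (Int.negSucc (n + 1))) (F.neg n (tmul x y))).trans
    (valL_mulIso_tmul _ _ _ _ _)

theorem isMulAt_one_neg_one : IsMulAt φ F 1 (-1) := by
  intro m hm (x : N.carrier) (y : N.DualCarrier)
  obtain rfl : 0 = m := hm
  exact (congrArg (zpowVal φ 0) (F.one_neg_one x (N.ofDual y))).trans
    (ι_linner_eq_zpowVal_mul φ x (N.ofDual y))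

theorem isMulAt_neg_one_one : IsMulAt φ F (-1) 1 := by
  intro m hm (x : N.DualCarrier) (y : N.carrier)
  obtain rfl : 0 = m := hm
  exact (congrArg (zpowVal φ 0) (F.neg_one_one (N.ofDual x) y)).trans
    (ι_rinner_eq_zpowVal_mul φ (N.ofDual x) y)

theorem isMulAt_one_right : ∀ k : ℤ, IsMulAt φ F k 1
  | Int.ofNat n => isMulAt_ofNat_one φ F n
  | Int.negSucc 0 => isMulAt_neg_one_one φ F
  | Int.negSucc (n + 1) =>
    (isMulAt_negSucc_neg_one φ F n).assoc_left (isMulAt_neg_one_one φ F) (isMulAt_zero_right φ F _)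

theorem isMulAt_neg_one_right : ∀ k : ℤ, IsMulAt φ F k (-1)
  | Int.ofNat 0 => isMulAt_zero_left φ F _
  | Int.ofNat (n + 1) =>
    (isMulAt_ofNat_one φ F n).assoc_left (isMulAt_one_neg_one φ F) (isMulAt_zero_right φ F _)
  | Int.negSucc n => isMulAt_negSucc_neg_one φ F n

theorem isMulAt (k l : ℤ) : IsMulAt φ F k l := by
  induction l with
  | zero => exact isMulAt_zero_right φ F k
  | succ n ih => exact ih.assoc_right (isMulAt_one_right φ F _) (isMulAt_one_right φ F _)
  | pred n ih => exact ih.assoc_right (isMulAt_neg_one_right φ F _) (isMulAt_neg_one_right φ F _)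

theorem eq_factorSystem : F = factorSystem φ := by
  apply HilbertBimodule.FactorSystem.ext
  funext k l m h
  refine Correspondence.Iso.ext_tmul fun x y => zpowVal_injective φ m ?_
  exact (isMulAt φ F k l m h x y).trans (zpowVal_factorMap_tmul φ h x y).symm

end FreeSystem

/-! ### Constructions of dynamical systems -/

namespace CStarDynamicalSystem

section Constructions

variable {G : Type*} [Group G] [TopologicalSpace G]

/-- An action by `*`-endomorphisms is an action by `*`-automorphisms. -/
def actionOfEnd {A : Type*} [CStarAlgebra A] (β : G →* (A →⋆ₐ[ℂ] A)) : G →* (A ≃⋆ₐ[ℂ] A) where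
  toFun g :=
    { β g with
      invFun := β g⁻¹
      left_inv := fun x => DFunLike.congr_fun
        (show β g⁻¹ * β g = 1 by rw [← map_mul, inv_mul_cancel, map_one]) x
      right_inv := fun x => DFunLike.congr_fun
        (show β g * β g⁻¹ = 1 by rw [← map_mul, mul_inv_cancel, map_one]) x
      map_smul' := map_smul (β g) }
  map_one' := StarAlgEquiv.ext fun x => DFunLike.congr_fun (map_one β) x
  map_mul' g h := StarAlgEquiv.ext fun x => DFunLike.congr_fun (map_mul β g h) x

/-- The translation action of a compact group `G` on `C(G, C)`. -/
def translation [ContinuousMul G] [CompactSpace G] (C : Type*) [CStarAlgebra C] :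
    CStarDynamicalSystem G where
  A := C(G, C)
  α := actionOfEnd
    { toFun := fun g => ContinuousMap.compStarAlgHom' ℂ C (ContinuousMap.mulRight g)
      map_one' := StarAlgHom.ext fun f => ContinuousMap.ext fun h => congrArg f (mul_one h)
      map_mul' := fun g g' => StarAlgHom.ext fun f => ContinuousMap.ext fun h =>
        congrArg f (mul_assoc h g g').symm }
  continuous_apply f :=
    (ContinuousMap.curry ⟨fun p : G × G => f (p.2 * p.1),
      f.continuous.comp (continuous_snd.mul continuous_fst)⟩).continuous

/-- The diagonal action on the product of two C*-algebras. -/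
def prod (X Y : CStarDynamicalSystem.{u} G) : CStarDynamicalSystem.{u} G where
  A := X.A × Y.A
  α := actionOfEnd
    { toFun := fun g => ((X.α g : X.A →⋆ₐ[ℂ] X.A).comp (StarAlgHom.fst ℂ X.A Y.A)).prod
        ((Y.α g : Y.A →⋆ₐ[ℂ] Y.A).comp (StarAlgHom.snd ℂ X.A Y.A))
      map_one' := by rw [map_one, map_one]; rfl
      map_mul' := fun g h => by rw [map_mul, map_mul]; rfl }
  continuous_apply p := (X.continuous_apply p.1).prodMk (Y.continuous_apply p.2)

variable (X : CStarDynamicalSystem.{u} G) (D : StarSubalgebra ℂ X.A)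
  (hD : IsClosed (D : Set X.A)) (hα : ∀ g, ∀ x ∈ D, X.α g x ∈ D)

/-- The restriction of an action to an invariant closed `*`-subalgebra. -/
def restrict : CStarDynamicalSystem.{u} G where
  A := D
  cstarAlgebra := StarSubalgebra.cstarAlgebra D
  α := actionOfEnd
    { toFun := fun g => ((X.α g : X.A →⋆ₐ[ℂ] X.A).comp D.subtype).codRestrict D
        fun x => hα g x x.2
      map_one' := StarAlgHom.ext fun x => Subtype.ext (DFunLike.congr_fun (map_one X.α) x.1)
      map_mul' := fun g h =>
        StarAlgHom.ext fun x => Subtype.ext (DFunLike.congr_fun (map_mul X.α g h) x.1) }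
  continuous_apply x := (X.continuous_apply x.1).subtype_mk _

/-- The inclusion of an invariant closed `*`-subalgebra. -/
def restrictIncl : (X.restrict D hD hα).A →⋆ₐ[ℂ] X.A := D.subtype

theorem restrictIncl_injective : Function.Injective (X.restrictIncl D hD hα) :=
  Subtype.val_injective

theorem restrictIncl_α (g : G) (x : (X.restrict D hD hα).A) :
    X.restrictIncl D hD hα ((X.restrict D hD hα).α g x) = X.α g (X.restrictIncl D hD hα x) := rfl

theorem restrictIncl_mem (x : (X.restrict D hD hα).A) : X.restrictIncl D hD hα x ∈ D := x.2

end Constructions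

open SO2

theorem charFunL_mem_isotypicComponent_translation {C : Type*} [CStarAlgebra C] (k : ℤ) (a : C) :
    charFunL k a ∈ (translation C).isotypicComponent k := fun g => ContinuousMap.ext fun h => by
  change (h * g).character ^ k • a = g.character ^ k • h.character ^ k • a
  rw [character_mul, mul_zpow, mul_comm, mul_smul]

theorem mk_mem_isotypicComponent_prod {X Y : CStarDynamicalSystem.{u} SO2} {k : ℤ} {x : X.A}
    {y : Y.A} (hx : x ∈ X.isotypicComponent k) (hy : y ∈ Y.isotypicComponent k) :
    (x, y) ∈ (X.prod Y).isotypicComponent k := fun g => Prod.ext (hx g) (hy g)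

section Restrict

variable {X : CStarDynamicalSystem.{u} SO2} {D : StarSubalgebra ℂ X.A}
  {hD : IsClosed (D : Set X.A)} {hα : ∀ g, ∀ x ∈ D, X.α g x ∈ D}

theorem mem_isotypicComponent_restrict {k : ℤ} {x : (X.restrict D hD hα).A} :
    x ∈ (X.restrict D hD hα).isotypicComponent k ↔
      X.restrictIncl D hD hα x ∈ X.isotypicComponent k :=
  forall_congr' fun g => by
    rw [← (X.restrictIncl_injective D hD hα).eq_iff, restrictIncl_α, map_smul]

theorem isFullAt_restrict {k : ℤ} {V W : Submodule ℂ X.A}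
    (hV : ∀ x ∈ V, x ∈ D ∧ x ∈ X.isotypicComponent (-k))
    (hW : ∀ x ∈ W, x ∈ D ∧ x ∈ X.isotypicComponent k) (h : 1 ∈ (V * W).topologicalClosure) :
    (X.restrict D hD hα).IsFullAt k := by
  let A := (X.restrict D hD hα).isotypicComponent
  have mul_le : V * W ≤ (A (-k) * A k).map (X.restrictIncl D hD hα : _ →ₗ[ℂ] X.A) :=
    Submodule.mul_le.2 fun x hx y hy =>
      ⟨(⟨x, (hV x hx).1⟩ : D) * (⟨y, (hW y hy).1⟩ : D), Submodule.mul_mem_mul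
        (mem_isotypicComponent_restrict.2 (hV x hx).2)
        (mem_isotypicComponent_restrict.2 (hW y hy).2), rfl⟩
  have inducing : Topology.IsInducing (X.restrictIncl D hD hα) := Topology.IsInducing.subtypeVal
  rw [IsFullAt, ← SetLike.mem_coe, Submodule.topologicalClosure_coe,
    inducing.closure_eq_preimage_closure_image, Set.mem_preimage, map_one]
  exact closure_mono mul_le h

end Restrict

end CStarDynamicalSystem

/-! ### The graded algebra generated by a covariant representation -/

theorem HilbertBimodule.linner_smul_right (N : HilbertBimodule B) (b : B) (x y : N.carrier) :
    N.linner x (b • y) = N.linner x y * star b := by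
  rw [← N.star_linner, N.linner_smul_left, star_mul, N.star_linner]

/-- A faithful covariant representation of a Hilbert bimodule in a C*-algebra: both inner products
are implemented by the multiplication. Compatibility of `t` with the linear structure and with the
actions of `B` is a consequence. -/
structure CovariantRep (N : HilbertBimodule B) (C : Type*) [CStarAlgebra C] where
  π : B →⋆ₐ[ℂ] C
  t : N.carrier → C
  star_t_mul : ∀ x y, star (t x) * t y = π (N.rinner x y)
  t_mul_star : ∀ x y, t x * star (t y) = π (N.linner x y)
  injective : Function.Injective π

namespace CovariantRep

variable {N : HilbertBimodule B} {C : Type*} [CStarAlgebra C] (ρ : CovariantRep N C)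

theorem t_add (x y : N.carrier) : ρ.t (x + y) = ρ.t x + ρ.t y := by
  rw [← sub_eq_zero, ← CStarRing.star_mul_self_eq_zero_iff]
  simp only [star_sub, star_add, sub_mul, mul_sub, add_mul, mul_add, ρ.star_t_mul,
    N.rinner_add_right, N.toCorrespondence.rinner_add_left, map_add]
  abel

theorem t_smul (c : ℂ) (x : N.carrier) : ρ.t (c • x) = c • ρ.t x := by
  rw [← sub_eq_zero, ← CStarRing.star_mul_self_eq_zero_iff]
  simp only [star_sub, star_smul, sub_mul, mul_sub, smul_mul_assoc, mul_smul_comm, ρ.star_t_mul,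
    N.toCorrespondence.rinner_smul_right, N.toCorrespondence.rinner_smul_left_complex, map_smul,
    smul_comm c, starRingEnd_apply, sub_self, smul_zero]

theorem t_op_smul (b : B) (x : N.carrier) : ρ.t (op b • x) = ρ.t x * ρ.π b := by
  rw [← sub_eq_zero, ← CStarRing.star_mul_self_eq_zero_iff]
  simp only [star_sub, star_mul, sub_mul, mul_sub, mul_assoc, ρ.star_t_mul,
    N.rinner_op_smul_right, N.toCorrespondence.rinner_op_smul_left, map_mul, map_star]
  simp only [← mul_assoc, ρ.star_t_mul, N.toCorrespondence.rinner_op_smul_left, map_mul, map_star,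
    sub_self]

theorem t_smul_left (b : B) (x : N.carrier) : ρ.t (b • x) = ρ.π b * ρ.t x := by
  rw [← sub_eq_zero, ← CStarRing.mul_star_self_eq_zero_iff]
  simp only [star_sub, star_mul, sub_mul, mul_sub, ← mul_assoc, ρ.t_mul_star,
    N.linner_smul_left, N.linner_smul_right, map_mul, map_star]
  simp only [mul_assoc, ρ.t_mul_star, N.linner_smul_right, map_mul, map_star, sub_self]

theorem isometry_π : Isometry ρ.π := NonUnitalStarAlgHom.isometry ρ.π ρ.injective

theorem norm_t (x : N.carrier) : ‖ρ.t x‖ = ‖x‖ := by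
  rw [← sq_eq_sq₀ (norm_nonneg _) (norm_nonneg _), N.norm_sq_eq_rinner, pow_two,
    ← CStarRing.norm_star_mul_self, ρ.star_t_mul, NonUnitalStarAlgHom.norm_map ρ.π ρ.injective]

/-- The representation of the bimodule as a linear map. -/
def tL : N.carrier →ₗ[ℂ] C where
  toFun := ρ.t
  map_add' := ρ.t_add
  map_smul' := ρ.t_smul

theorem isometry_tL : Isometry ρ.tL := AddMonoidHomClass.isometry_of_norm ρ.tL ρ.norm_t

/-- The image of the coefficient algebra. -/
def rangeπ : Submodule ℂ C := LinearMap.range (ρ.π : B →ₗ[ℂ] C)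

/-- The image of the bimodule. -/
def rangeT : Submodule ℂ C := LinearMap.range ρ.tL

/-- The adjoints of the image of the bimodule. -/
def rangeTStar : Submodule ℂ C := ρ.rangeT.map (starLinearEquiv ℂ (A := C)).toLinearMap

theorem π_mem (b : B) : ρ.π b ∈ ρ.rangeπ := ⟨b, rfl⟩

theorem t_mem (x : N.carrier) : ρ.t x ∈ ρ.rangeT := ⟨x, rfl⟩

theorem star_t_mem (x : N.carrier) : star (ρ.t x) ∈ ρ.rangeTStar := ⟨_, ρ.t_mem x, rfl⟩

theorem one_mem_rangeπ : (1 : C) ∈ ρ.rangeπ := ⟨1, map_one ρ.π⟩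

theorem isClosed_rangeπ : IsClosed (ρ.rangeπ : Set C) :=
  ρ.isometry_π.isClosedEmbedding.isClosed_range

theorem isClosed_rangeT : IsClosed (ρ.rangeT : Set C) :=
  ρ.isometry_tL.isClosedEmbedding.isClosed_range

theorem rangeπ_mul_rangeπ : ρ.rangeπ * ρ.rangeπ ≤ ρ.rangeπ := Submodule.mul_le.2 <| by
  rintro _ ⟨a, rfl⟩ _ ⟨b, rfl⟩
  exact ⟨a * b, map_mul ρ.π a b⟩

theorem rangeπ_mul_rangeT : ρ.rangeπ * ρ.rangeT ≤ ρ.rangeT := Submodule.mul_le.2 <| by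
  rintro _ ⟨a, rfl⟩ _ ⟨x, rfl⟩
  exact ⟨a • x, ρ.t_smul_left a x⟩

theorem rangeT_mul_rangeπ : ρ.rangeT * ρ.rangeπ ≤ ρ.rangeT := Submodule.mul_le.2 <| by
  rintro _ ⟨x, rfl⟩ _ ⟨a, rfl⟩
  exact ⟨op a • x, ρ.t_op_smul a x⟩

theorem rangeπ_mul_rangeTStar : ρ.rangeπ * ρ.rangeTStar ≤ ρ.rangeTStar := Submodule.mul_le.2 <| by
  rintro _ ⟨a, rfl⟩ _ ⟨_, ⟨x, rfl⟩, rfl⟩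
  refine ⟨_, ρ.t_mem (op (star a) • x), ?_⟩
  change star (ρ.t (op (star a) • x)) = ρ.π a * star (ρ.t x)
  rw [t_op_smul, star_mul, map_star, star_star]

theorem rangeT_mul_rangeTStar : ρ.rangeT * ρ.rangeTStar ≤ ρ.rangeπ := Submodule.mul_le.2 <| by
  rintro _ ⟨x, rfl⟩ _ ⟨_, ⟨y, rfl⟩, rfl⟩
  exact ⟨N.linner x y, (ρ.t_mul_star x y).symm⟩

theorem rangeTStar_mul_rangeT : ρ.rangeTStar * ρ.rangeT ≤ ρ.rangeπ := Submodule.mul_le.2 <| by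
  rintro _ ⟨_, ⟨x, rfl⟩, rfl⟩ _ ⟨y, rfl⟩
  exact ⟨N.rinner x y, (ρ.star_t_mul x y).symm⟩

theorem one_mem_closure_rangeTStar_mul_rangeT (hN : N.IsMorita) :
    1 ∈ (ρ.rangeTStar * ρ.rangeT).topologicalClosure := by
  have span_le : N.rinnerSpan ≤ (ρ.rangeTStar * ρ.rangeT).comap (ρ.π : B →ₗ[ℂ] C) :=
    Submodule.span_le.2 <| by
      rintro _ ⟨p, rfl⟩
      change ρ.π (N.rinner p.1 p.2) ∈ ρ.rangeTStar * ρ.rangeT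
      rw [← ρ.star_t_mul]
      exact Submodule.mul_mem_mul (ρ.star_t_mem _) (ρ.t_mem _)
  exact map_one ρ.π ▸ map_mem_closure ρ.isometry_π.continuous (hN.dense_rinner 1) span_le

theorem one_mem_closure_rangeT_mul_rangeTStar (hN : N.IsMorita) :
    1 ∈ (ρ.rangeT * ρ.rangeTStar).topologicalClosure := by
  have span_le : N.linnerSpan ≤ (ρ.rangeT * ρ.rangeTStar).comap (ρ.π : B →ₗ[ℂ] C) :=
    Submodule.span_le.2 <| by
      rintro _ ⟨p, rfl⟩
      change ρ.π (N.linner p.1 p.2) ∈ ρ.rangeT * ρ.rangeTStar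
      rw [← ρ.t_mul_star]
      exact Submodule.mul_mem_mul (ρ.t_mem _) (ρ.star_t_mem _)
  exact map_one ρ.π ▸ map_mem_closure ρ.isometry_π.continuous (hN.dense_linner 1) span_le

/-- The homogeneous part of degree `k` of the `*`-algebra generated by a covariant
representation. -/
def homogeneous : ℤ → Submodule ℂ C
  | Int.ofNat n => ρ.rangeT ^ n * ρ.rangeπ
  | Int.negSucc n => ρ.rangeTStar ^ (n + 1) * ρ.rangeπ

theorem homogeneous_zero : ρ.homogeneous 0 = ρ.rangeπ := by
  change ρ.rangeT ^ 0 * ρ.rangeπ = _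
  rw [pow_zero, one_mul]

theorem homogeneous_succ (n : ℕ) : ρ.homogeneous (n + 1) = ρ.rangeT * ρ.homogeneous n := by
  change ρ.rangeT ^ (n + 1) * ρ.rangeπ = ρ.rangeT * (ρ.rangeT ^ n * ρ.rangeπ)
  rw [pow_succ', mul_assoc]

theorem homogeneous_pred (n : ℕ) :
    ρ.homogeneous (-n - 1) = ρ.rangeTStar * ρ.homogeneous (-n) := by
  have homogeneous_neg (m : ℕ) : ρ.homogeneous (-m) = ρ.rangeTStar ^ m * ρ.rangeπ := by
    cases m with
    | zero => rw [Nat.cast_zero, neg_zero, homogeneous_zero, pow_zero, one_mul]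
    | succ m => rfl
  rw [← neg_add', ← Nat.cast_succ, homogeneous_neg, homogeneous_neg, pow_succ', mul_assoc]

theorem homogeneous_one : ρ.homogeneous 1 = ρ.rangeT := by
  have := ρ.homogeneous_succ 0
  rw [Nat.cast_zero, zero_add, homogeneous_zero] at this
  refine this.trans (le_antisymm ρ.rangeT_mul_rangeπ fun c hc => ?_)
  exact mul_one c ▸ Submodule.mul_mem_mul hc ρ.one_mem_rangeπ

theorem rangeTStar_le_homogeneous : ρ.rangeTStar ≤ ρ.homogeneous (-1) := fun c hc => by
  have := ρ.homogeneous_pred 0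
  rw [Nat.cast_zero, neg_zero, zero_sub, homogeneous_zero] at this
  exact this ▸ mul_one c ▸ Submodule.mul_mem_mul hc ρ.one_mem_rangeπ

theorem rangeπ_mul_homogeneous (k : ℤ) : ρ.rangeπ * ρ.homogeneous k ≤ ρ.homogeneous k := by
  induction k with
  | zero => rw [homogeneous_zero]; exact ρ.rangeπ_mul_rangeπ
  | succ n _ => rw [homogeneous_succ, ← mul_assoc]; exact mul_le_mul_left ρ.rangeπ_mul_rangeT _
  | pred n _ => rw [homogeneous_pred, ← mul_assoc]; exact mul_le_mul_left ρ.rangeπ_mul_rangeTStar _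

theorem rangeT_mul_homogeneous (k : ℤ) : ρ.rangeT * ρ.homogeneous k ≤ ρ.homogeneous (k + 1) := by
  induction k with
  | zero => exact (ρ.homogeneous_succ 0).ge
  | succ n _ => exact (ρ.homogeneous_succ (n + 1)).ge
  | pred n _ =>
    rw [homogeneous_pred, ← mul_assoc, sub_add_cancel]
    exact (mul_le_mul_left ρ.rangeT_mul_rangeTStar _).trans (ρ.rangeπ_mul_homogeneous _)

theorem rangeTStar_mul_homogeneous (k : ℤ) :
    ρ.rangeTStar * ρ.homogeneous k ≤ ρ.homogeneous (k - 1) := by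
  induction k with
  | zero => exact (ρ.homogeneous_pred 0).ge
  | succ n _ =>
    rw [homogeneous_succ, ← mul_assoc, add_sub_cancel_right]
    exact (mul_le_mul_left ρ.rangeTStar_mul_rangeT _).trans (ρ.rangeπ_mul_homogeneous _)
  | pred n _ =>
    have := (ρ.homogeneous_pred (n + 1)).ge
    rwa [Nat.cast_succ, neg_add'] at this

theorem homogeneous_mul_homogeneous (k l : ℤ) :
    ρ.homogeneous k * ρ.homogeneous l ≤ ρ.homogeneous (k + l) := by
  induction k with
  | zero => rw [homogeneous_zero, zero_add]; exact ρ.rangeπ_mul_homogeneous l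
  | succ n ih =>
    rw [homogeneous_succ, mul_assoc, add_right_comm]
    exact (mul_le_mul_right ih _).trans (ρ.rangeT_mul_homogeneous _)
  | pred n ih =>
    rw [homogeneous_pred, mul_assoc, sub_add_eq_add_sub]
    exact (mul_le_mul_right ih _).trans (ρ.rangeTStar_mul_homogeneous _)

theorem star_mem_homogeneous {k : ℤ} {c : C} (hc : c ∈ ρ.homogeneous k) :
    star c ∈ ρ.homogeneous (-k) := by
  have mul_mem {i j : ℤ} {x y : C} (hx : x ∈ ρ.homogeneous i) (hy : y ∈ ρ.homogeneous j) :
      x * y ∈ ρ.homogeneous (i + j) :=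
    ρ.homogeneous_mul_homogeneous i j (Submodule.mul_mem_mul hx hy)
  induction k generalizing c with
  | zero =>
    rw [homogeneous_zero] at hc
    obtain ⟨b, rfl⟩ := hc
    rw [neg_zero, homogeneous_zero]
    exact ⟨star b, map_star ρ.π b⟩
  | succ n ih =>
    rw [homogeneous_succ] at hc
    refine Submodule.mul_induction_on hc ?_ fun x y hx hy => star_add x y ▸ add_mem hx hy
    rintro _ ⟨x, rfl⟩ w hw
    rw [star_mul, neg_add]
    exact mul_mem (ih hw) (ρ.rangeTStar_le_homogeneous (ρ.star_t_mem x))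
  | pred n ih =>
    rw [homogeneous_pred] at hc
    refine Submodule.mul_induction_on hc ?_ fun x y hx hy => star_add x y ▸ add_mem hx hy
    rintro _ ⟨_, ⟨x, rfl⟩, rfl⟩ w hw
    change star (star (ρ.t x) * w) ∈ _
    rw [star_mul, star_star, neg_sub', sub_neg_eq_add]
    exact mul_mem (ih hw) (ρ.homogeneous_one.ge (ρ.t_mem x))

/-- The `*`-algebra generated by a covariant representation. -/
def gradedAlg : StarSubalgebra ℂ C where
  carrier := (⨆ k, ρ.homogeneous k : Submodule ℂ C)
  add_mem' := add_mem
  mul_mem' {a b} ha hb := by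
    have mul_le : (⨆ k, ρ.homogeneous k) * (⨆ k, ρ.homogeneous k) ≤ ⨆ k, ρ.homogeneous k := by
      simp only [Submodule.iSup_mul, Submodule.mul_iSup]
      exact iSup_le fun k => iSup_le fun l =>
        (ρ.homogeneous_mul_homogeneous _ _).trans (le_iSup ρ.homogeneous _)
    exact mul_le (Submodule.mul_mem_mul ha hb)
  algebraMap_mem' c := by
    refine Submodule.mem_iSup_of_mem 0 ?_
    rw [homogeneous_zero, Algebra.algebraMap_eq_smul_one]
    exact Submodule.smul_mem _ _ ρ.one_mem_rangeπ
  star_mem' {a} ha := by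
    induction ha using Submodule.iSup_induction' with
    | mem k x hx => exact Submodule.mem_iSup_of_mem (-k) (ρ.star_mem_homogeneous hx)
    | zero => rw [star_zero]; exact zero_mem _
    | add x y _ _ hx hy => rw [star_add]; exact add_mem hx hy

/-- The C*-algebra generated by a covariant representation. -/
def alg : StarSubalgebra ℂ C := ρ.gradedAlg.topologicalClosure

theorem isClosed_alg : IsClosed (ρ.alg : Set C) := StarSubalgebra.isClosed_topologicalClosure _

theorem mem_alg_of_mem_homogeneous {k : ℤ} {c : C} (hc : c ∈ ρ.homogeneous k) : c ∈ ρ.alg :=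
  StarSubalgebra.le_topologicalClosure _ (Submodule.mem_iSup_of_mem (p := ρ.homogeneous) k hc)

end CovariantRep

/-! ### The free system generated by a homogeneous covariant representation -/

namespace CovariantRep

open CStarDynamicalSystem

variable {N : HilbertBimodule B} {X : CStarDynamicalSystem.{u} SO2} {ρ : CovariantRep N X.A}

variable (ρ) in
/-- A covariant representation is homogeneous if it maps `B` to the fixed points and the bimodule
to the isotypic component of degree `1`. -/
structure IsHomogeneous : Prop where
  π_mem : ∀ b, ρ.π b ∈ X.isotypicComponent 0
  t_mem : ∀ x, ρ.t x ∈ X.isotypicComponent 1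

theorem IsHomogeneous.homogeneous_le (hρ : ρ.IsHomogeneous) (k : ℤ) :
    ρ.homogeneous k ≤ X.isotypicComponent k := by
  induction k with
  | zero =>
    rw [homogeneous_zero]
    rintro _ ⟨b, rfl⟩
    exact hρ.π_mem b
  | succ n ih =>
    rw [homogeneous_succ, Submodule.mul_le]
    rintro _ ⟨x, rfl⟩ w hw
    exact mul_mem_isotypicComponent (add_comm _ _) (hρ.t_mem x) (ih hw)
  | pred n ih =>
    rw [homogeneous_pred, Submodule.mul_le]
    rintro _ ⟨_, ⟨x, rfl⟩, rfl⟩ w hw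
    exact mul_mem_isotypicComponent (sub_eq_neg_add _ _).symm
      (star_mem_isotypicComponent (hρ.t_mem x)) (ih hw)

theorem IsHomogeneous.mem_closure_homogeneous (hρ : ρ.IsHomogeneous) {k : ℤ} {c : X.A}
    (hc : c ∈ ρ.alg) (hck : c ∈ X.isotypicComponent k) :
    c ∈ closure (ρ.homogeneous k : Set X.A) := by
  rw [← isotypicProj_self hck]
  refine map_mem_closure (X.isotypicProj k).continuous hc fun d hd => ?_
  induction hd using Submodule.iSup_induction' with
  | mem l x hx =>
    rw [isotypicProj_of_mem (hρ.homogeneous_le l hx)]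
    split_ifs with hlk
    · exact hlk ▸ hx
    · exact zero_mem _
  | zero => rw [map_zero]; exact zero_mem _
  | add x y _ _ hx hy => rw [map_add]; exact add_mem hx hy

theorem IsHomogeneous.α_mem_alg (hρ : ρ.IsHomogeneous) (g : SO2) (c : X.A) (hc : c ∈ ρ.alg) :
    X.α g c ∈ ρ.alg := by
  have continuous_α : Continuous (X.α g) := (NonUnitalStarAlgHom.isometry _
    (EquivLike.injective (X.α g))).continuous
  refine map_mem_closure continuous_α hc fun d hd => ?_
  induction hd using Submodule.iSup_induction' with
  | mem l x hx =>
    rw [hρ.homogeneous_le l hx g]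
    exact Submodule.smul_mem _ _ (Submodule.mem_iSup_of_mem l hx)
  | zero => rw [map_zero]; exact zero_mem _
  | add x y _ _ hx hy => rw [map_add]; exact add_mem hx hy

variable (ρ) in
theorem π_mem_alg (b : B) : ρ.π b ∈ ρ.alg :=
  ρ.mem_alg_of_mem_homogeneous (ρ.homogeneous_zero.ge (ρ.π_mem b))

variable (ρ) in
theorem t_mem_alg (x : N.carrier) : ρ.t x ∈ ρ.alg :=
  ρ.mem_alg_of_mem_homogeneous (ρ.homogeneous_one.ge (ρ.t_mem x))

variable (hρ : ρ.IsHomogeneous) (hN : N.IsMorita)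

/-- The dynamical system generated by a homogeneous covariant representation. -/
def system : CStarDynamicalSystem.{u} SO2 := X.restrict ρ.alg ρ.isClosed_alg hρ.α_mem_alg

include hN in
theorem isFree_system : (system hρ).IsFree := by
  have rangeT_le (c) (hc : c ∈ ρ.rangeT) : c ∈ ρ.alg ∧ c ∈ X.isotypicComponent 1 := by
    obtain ⟨x, rfl⟩ := hc
    exact ⟨ρ.t_mem_alg x, hρ.t_mem x⟩
  have rangeTStar_le (c) (hc : c ∈ ρ.rangeTStar) : c ∈ ρ.alg ∧ c ∈ X.isotypicComponent (-1) := by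
    obtain ⟨_, ⟨x, rfl⟩, rfl⟩ := hc
    exact ⟨star_mem (ρ.t_mem_alg x), star_mem_isotypicComponent (hρ.t_mem x)⟩
  exact isFree_of_isFullAt
    (isFullAt_restrict rangeTStar_le rangeT_le (ρ.one_mem_closure_rangeTStar_mul_rangeT hN))
    (isFullAt_restrict ((neg_neg (1 : ℤ)).symm ▸ rangeT_le) rangeTStar_le
      (ρ.one_mem_closure_rangeT_mul_rangeTStar hN))

theorem mem_closure_homogeneous_of_mem_system {k : ℤ} {x : (system hρ).A}
    (hx : x ∈ (system hρ).isotypicComponent k) :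
    X.restrictIncl ρ.alg ρ.isClosed_alg hρ.α_mem_alg x ∈ closure (ρ.homogeneous k : Set X.A) :=
  hρ.mem_closure_homogeneous (restrictIncl_mem _ _ _ _ x) (mem_isotypicComponent_restrict.1 hx)

/-- The free system generated by a homogeneous covariant representation of a Morita equivalence
bimodule. -/
def freeSystem : FreeSystem B where
  toCStarDynamicalSystem := system hρ
  isFree := isFree_system hρ hN
  ι := ρ.π.codRestrict ρ.alg ρ.π_mem_alg
  ι_injective _ _ hab := ρ.injective (congrArg Subtype.val hab)
  range_ι := by
    ext x
    constructor
    · rintro ⟨b, rfl⟩ g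
      exact Subtype.ext (mem_isotypicComponent_zero.1 (hρ.π_mem b) g)
    · intro hx
      have := mem_closure_homogeneous_of_mem_system hρ (mem_isotypicComponent_zero.2 hx)
      rw [homogeneous_zero, ρ.isClosed_rangeπ.closure_eq] at this
      obtain ⟨b, hb⟩ := this
      exact ⟨b, Subtype.ext hb⟩

/-- The inclusion of the generated free system. -/
def incl : (freeSystem hρ hN).A →⋆ₐ[ℂ] X.A := X.restrictIncl ρ.alg ρ.isClosed_alg hρ.α_mem_alg

theorem incl_injective : Function.Injective (incl hρ hN) := Subtype.val_injective

theorem t_mem_isotypicComponent_freeSystem (x : N.carrier) :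
    (⟨ρ.t x, ρ.t_mem_alg x⟩ : ρ.alg) ∈ (freeSystem hρ hN).isotypicComponent 1 :=
  (mem_isotypicComponent_restrict (hD := ρ.isClosed_alg) (hα := hρ.α_mem_alg)).2 (hρ.t_mem x)

/-- The linear map `N → A(1)` of the generated free system. -/
def oneMap : N.carrier →ₗ[ℂ] ((freeSystem hρ hN).isotypic 1).carrier where
  toFun x := FreeSystem.isotypicMk _ (t_mem_isotypicComponent_freeSystem hρ hN x)
  map_add' x y := FreeSystem.valL_injective (incl_injective hρ hN (ρ.t_add x y))
  map_smul' c x := FreeSystem.valL_injective (incl_injective hρ hN (ρ.t_smul c x))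

theorem incl_oneMap (x : N.carrier) :
    incl hρ hN ((freeSystem hρ hN).valL 1 (oneMap hρ hN x)) = ρ.t x := rfl

theorem bijective_oneMap : Function.Bijective (oneMap hρ hN) := by
  refine ⟨fun x y hxy => ρ.isometry_tL.injective ?_, fun y => ?_⟩
  · change ρ.t x = ρ.t y
    rw [← incl_oneMap hρ hN, hxy, incl_oneMap]
  · have := mem_closure_homogeneous_of_mem_system hρ (FreeSystem.valL_mem y)
    rw [homogeneous_one, ρ.isClosed_rangeT.closure_eq] at this
    obtain ⟨x, hx⟩ := this
    exact ⟨x, FreeSystem.valL_injective (incl_injective hρ hN hx)⟩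

/-- The isomorphism `N ≅ A(1)` of the generated free system. -/
def oneIso : HilbertBimodule.Iso N ((freeSystem hρ hN).isotypic 1) where
  toEquiv := LinearEquiv.ofBijective (oneMap hρ hN) (bijective_oneMap hρ hN)
  map_smul_left b x := FreeSystem.valL_injective (incl_injective hρ hN (ρ.t_smul_left b x))
  map_smul_right b x :=
    FreeSystem.valL_injective (incl_injective hρ hN (ρ.t_op_smul (unop b) x))
  map_rinner x y := (freeSystem hρ hN).ι_injective <| incl_injective hρ hN <|
    (congrArg (incl hρ hN) (FreeSystem.ι_rinner _ _)).trans (ρ.star_t_mul x y)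
  map_linner x y := (freeSystem hρ hN).ι_injective <| incl_injective hρ hN <|
    (congrArg (incl hρ hN) (FreeSystem.ι_linner _ _)).trans (ρ.t_mul_star x y)

end CovariantRep

/-! ### Free systems with isomorphic components of degree one are equivalent -/

namespace FreeSystem

open CStarDynamicalSystem CovariantRep

theorem mem_of_isotypicComponent_one_le {S : FreeSystem B} {V : StarSubalgebra ℂ S.A}
    (hV : IsClosed (V : Set S.A)) (hι : ∀ b, S.ι b ∈ V) (h : ∀ x ∈ S.isotypicComponent 1, x ∈ V)
    (x : S.A) : x ∈ V := by
  let V' : Submodule ℂ S.A := Subalgebra.toSubmodule V.toSubalgebra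
  have add {k l m : ℤ} (hm : k + l = m) (hk : S.isotypicComponent k ≤ V')
      (hl : S.isotypicComponent l ≤ V') : S.isotypicComponent m ≤ V' :=
    (S.isotypicComponent_le_closure_mul hm).trans <| Submodule.topologicalClosure_minimal _
      (Submodule.mul_le.2 fun x hx y hy => V.mul_mem (hk hx) (hl hy)) hV
  have neg_one : S.isotypicComponent (-1) ≤ V' := fun x hx => by
    have : star (star x) ∈ V := star_mem (h _ (star_mem_isotypicComponent hx))
    rwa [star_star] at this
  refine mem_of_isotypicComponent_le (V := V') hV (fun k => ?_) x
  induction k with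
  | zero =>
    intro x hx
    rw [← S.ι_toB (mem_isotypicComponent_zero.1 hx)]
    exact hι _
  | succ n ih => exact add rfl ih h
  | pred n ih => exact add rfl ih neg_one

theorem bijective_of_equivariant {S T : FreeSystem B} (p : S.A →⋆ₐ[ℂ] T.A)
    (hα : ∀ g x, p (S.α g x) = T.α g (p x)) (hι : ∀ b, p (S.ι b) = T.ι b)
    (hone : ∀ x ∈ T.isotypicComponent 1, ∃ y, p y = x) : Function.Bijective p := by
  have injective : Function.Injective p := injective_of_injective_on_fixed p hα fun x hx hpx => by
    rw [← S.ι_toB (mem_isotypicComponent_zero.1 hx)] at hpx ⊢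
    rw [hι, ← map_zero T.ι] at hpx
    rw [T.ι_injective hpx, map_zero]
  exact ⟨injective, mem_of_isotypicComponent_one_le (V := p.range)
    (NonUnitalStarAlgHom.isometry p injective).isClosedEmbedding.isClosed_range
    (fun b => ⟨S.ι b, hι b⟩) hone⟩

variable {S T : FreeSystem B} (u : HilbertBimodule.Iso (S.isotypic 1) (T.isotypic 1))

/-- The diagonal representation of `A(1)` given by an isomorphism of two such components. -/
def diagRep :
    CovariantRep (S.isotypic 1) (S.toCStarDynamicalSystem.prod T.toCStarDynamicalSystem).A where
  π := (S.ι.prod T.ι : B →⋆ₐ[ℂ] S.A × T.A)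
  t x := ((S.valL 1 x, T.valL 1 (u.toIso x)) : S.A × T.A)
  star_t_mul x y := Prod.ext (ι_rinner x y).symm
    ((ι_rinner _ _).symm.trans (congrArg T.ι (u.map_rinner x y)))
  t_mul_star x y := Prod.ext (ι_linner x y).symm
    ((ι_linner _ _).symm.trans (congrArg T.ι (u.map_linner x y)))
  injective _ _ hab := S.ι_injective (congrArg Prod.fst hab)

theorem isHomogeneous_diagRep : (diagRep u).IsHomogeneous where
  π_mem b := mk_mem_isotypicComponent_prod (mem_isotypicComponent_zero.2 fun g => S.α_ι g b)
    (mem_isotypicComponent_zero.2 fun g => T.α_ι g b)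
  t_mem x := mk_mem_isotypicComponent_prod (valL_mem x) (valL_mem _)

-- The diagonal representation generates the graph of the equivalence: both of its coordinate
-- projections are bijective.
include u in
theorem exists_starAlgEquiv_of_iso :
    ∃ φ : S.A ≃⋆ₐ[ℂ] T.A,
      (∀ b, φ (S.ι b) = T.ι b) ∧ ∀ (g : SO2) (x : S.A), φ (S.α g x) = T.α g (φ x) := by
  have hρ := isHomogeneous_diagRep u
  have hN := S.isMorita 1
  let graph := freeSystem hρ hN
  let inclusion : graph.A →⋆ₐ[ℂ] S.A × T.A := incl hρ hN
  let p : graph.A →⋆ₐ[ℂ] S.A := (StarAlgHom.fst ℂ S.A T.A).comp inclusion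
  let q : graph.A →⋆ₐ[ℂ] T.A := (StarAlgHom.snd ℂ S.A T.A).comp inclusion
  have bijective_p : Function.Bijective p := bijective_of_equivariant p (fun _ _ => rfl)
    (fun _ => rfl) fun x hx => ⟨graph.valL 1 ((oneIso hρ hN).toIso (isotypicMk x hx)), rfl⟩
  have bijective_q : Function.Bijective q := bijective_of_equivariant q (fun _ _ => rfl)
    (fun _ => rfl) fun x hx => by
      obtain ⟨y, hy⟩ := u.toIso.surjective (isotypicMk x hx)
      exact ⟨graph.valL 1 ((oneIso hρ hN).toIso y), congrArg (T.valL 1) hy⟩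
  let P := StarAlgEquiv.ofBijective p bijective_p
  let Q := StarAlgEquiv.ofBijective q bijective_q
  have apply_p (x) : (P.symm.trans Q) (p x) = q x := congrArg q (P.symm_apply_apply x)
  refine ⟨P.symm.trans Q, fun b => apply_p (graph.ι b), fun g x => ?_⟩
  obtain ⟨y, rfl⟩ := bijective_p.surjective x
  exact (apply_p (graph.α g y)).trans (congrArg (T.α g) (apply_p y).symm)

end FreeSystem

/-! ### The C*-algebra of adjointable operators on a correspondence -/

namespace Correspondence

variable (E : Correspondence B)

/-- Two bounded operators are adjoint to each other for the `B`-valued inner product. -/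
def IsAdjointPair (T S : E.carrier →L[ℂ] E.carrier) : Prop :=
  ∀ x y, E.rinner (T x) y = E.rinner x (S y)

variable {E}

theorem rinner_zero_left (x : E.carrier) : E.rinner 0 x = 0 :=
  LinearMap.congr_fun (map_zero E.toPre.sesq) x

theorem ext_rinner {x y : E.carrier} (h : ∀ z, E.rinner z x = E.rinner z y) : x = y :=
  eq_of_rinner_sub_self <| (map_sub (rinnerL (x - y)) x y).trans (sub_eq_zero.2 (h _))

namespace IsAdjointPair

variable {T T' S S' : E.carrier →L[ℂ] E.carrier}

theorem symm (h : E.IsAdjointPair T S) : E.IsAdjointPair S T := fun x y => by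
  rw [← E.star_rinner, ← h, E.star_rinner]

theorem unique (h : E.IsAdjointPair T S) (h' : E.IsAdjointPair T S') : S = S' :=
  ContinuousLinearMap.ext fun y => ext_rinner fun z => by rw [← h, ← h']

theorem one : E.IsAdjointPair 1 1 := fun _ _ => rfl

theorem add (h : E.IsAdjointPair T S) (h' : E.IsAdjointPair T' S') :
    E.IsAdjointPair (T + T') (S + S') := fun x y => by
  rw [add_apply, add_apply, E.rinner_add_left, E.rinner_add_right, h, h']

theorem mul (h : E.IsAdjointPair T S) (h' : E.IsAdjointPair T' S') :
    E.IsAdjointPair (T * T') (S' * S) := fun x y =>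
  (h (T' x) y).trans (h' x (S y))

theorem smul (h : E.IsAdjointPair T S) (c : ℂ) : E.IsAdjointPair (c • T) (conj c • S) :=
  fun x y => by
    rw [smul_apply, smul_apply, E.rinner_smul_left_complex, E.rinner_smul_right, h]

theorem sub (h : E.IsAdjointPair T S) (h' : E.IsAdjointPair T' S') :
    E.IsAdjointPair (T - T') (S - S') := by
  have := h.add (h'.smul (-1))
  rwa [map_neg, map_one, neg_one_smul, neg_one_smul, ← sub_eq_add_neg, ← sub_eq_add_neg] at this

theorem norm_mul_self_le (h : E.IsAdjointPair T S) : ‖T‖ * ‖T‖ ≤ ‖S * T‖ := by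
  have norm_le_sqrt : ‖T‖ ≤ √‖S * T‖ := T.opNorm_le_bound (Real.sqrt_nonneg _) fun x => by
    refine (pow_le_pow_iff_left₀ (norm_nonneg _) (by positivity) two_ne_zero).1 ?_
    calc ‖T x‖ ^ 2 = ‖E.rinner x ((S * T) x)‖ := by rw [E.norm_sq_eq_rinner, h]; rfl
      _ ≤ ‖x‖ * (‖S * T‖ * ‖x‖) := (norm_rinner_le _ _).trans <| by
        gcongr; exact (S * T).le_opNorm x
      _ = (√‖S * T‖ * ‖x‖) ^ 2 := by rw [mul_pow, Real.sq_sqrt (norm_nonneg _)]; ring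
  calc ‖T‖ * ‖T‖ ≤ √‖S * T‖ * √‖S * T‖ := by gcongr
    _ = ‖S * T‖ := Real.mul_self_sqrt (norm_nonneg _)

theorem norm_le (h : E.IsAdjointPair T S) : ‖T‖ ≤ ‖S‖ := by
  rcases (norm_nonneg T).eq_or_lt with norm_eq_zero | norm_pos
  · exact norm_eq_zero ▸ norm_nonneg S
  · exact le_of_mul_le_mul_right (h.norm_mul_self_le.trans (norm_mul_le S T)) norm_pos

theorem norm_eq (h : E.IsAdjointPair T S) : ‖S‖ = ‖T‖ := le_antisymm h.symm.norm_le h.norm_le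

end IsAdjointPair

variable (E)

/-- The algebra of adjointable operators. -/
def adjointable : Subalgebra ℂ (E.carrier →L[ℂ] E.carrier) where
  carrier := {T | ∃ S, E.IsAdjointPair T S}
  mul_mem' := fun ⟨_, h⟩ ⟨_, h'⟩ => ⟨_, h.mul h'⟩
  add_mem' := fun ⟨_, h⟩ ⟨_, h'⟩ => ⟨_, h.add h'⟩
  algebraMap_mem' c := by
    rw [Algebra.algebraMap_eq_smul_one]
    exact ⟨_, IsAdjointPair.one.smul c⟩

theorem isClosed_setOf_isAdjointPair :
    IsClosed {p : (E.carrier →L[ℂ] E.carrier) × (E.carrier →L[ℂ] E.carrier) |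
      E.IsAdjointPair p.1 p.2} := by
  simp only [IsAdjointPair, Set.ofPred_forall]
  exact isClosed_iInter fun x => isClosed_iInter fun y => isClosed_eq
    ((continuous_rinner_left y).comp (continuous_fst.clm_apply continuous_const))
    ((continuous_rinner_right x).comp (continuous_snd.clm_apply continuous_const))

-- The adjoint pairs form a complete space on which the first projection is isometric.
theorem isClosed_adjointable : IsClosed (E.adjointable : Set (E.carrier →L[ℂ] E.carrier)) := by
  set pairs := {p : (E.carrier →L[ℂ] E.carrier) × (E.carrier →L[ℂ] E.carrier) |
    E.IsAdjointPair p.1 p.2}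
  have isometry_fst : Isometry fun p : pairs => p.1.1 := Isometry.of_dist_eq fun p q => by
    rw [Subtype.dist_eq, Prod.dist_eq, dist_eq_norm p.1.2, (p.2.sub q.2).norm_eq, ← dist_eq_norm,
      max_self]
  have range_fst : (Set.range fun p : pairs => p.1.1) = E.adjointable :=
    Set.ext fun T => ⟨fun ⟨p, hT⟩ => hT ▸ ⟨p.1.2, p.2⟩, fun ⟨S, hS⟩ => ⟨⟨(T, S), hS⟩, rfl⟩⟩
  have : CompleteSpace pairs := E.isClosed_setOf_isAdjointPair.completeSpace_coe
  exact range_fst ▸ isometry_fst.isClosedEmbedding.isClosed_range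

variable {E}

/-- The adjoint of an adjointable operator. -/
def adj (T : E.adjointable) : E.carrier →L[ℂ] E.carrier := T.2.choose

theorem isAdjointPair_adj (T : E.adjointable) : E.IsAdjointPair T.1 (adj T) := T.2.choose_spec

theorem adj_eq {T : E.adjointable} {S : E.carrier →L[ℂ] E.carrier} (h : E.IsAdjointPair T.1 S) :
    adj T = S := (isAdjointPair_adj T).unique h

instance : Star E.adjointable := ⟨fun T => ⟨adj T, T.1, (isAdjointPair_adj T).symm⟩⟩

instance : StarRing E.adjointable where
  star_involutive T := Subtype.ext (adj_eq (isAdjointPair_adj T).symm)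
  star_mul T T' := Subtype.ext (adj_eq ((isAdjointPair_adj T).mul (isAdjointPair_adj T')))
  star_add T T' := Subtype.ext (adj_eq ((isAdjointPair_adj T).add (isAdjointPair_adj T')))

instance : CompleteSpace E.adjointable := E.isClosed_adjointable.completeSpace_coe

instance : CStarRing E.adjointable where
  norm_mul_self_le T := (isAdjointPair_adj T).norm_mul_self_le

instance : StarModule ℂ E.adjointable where
  star_smul c T := Subtype.ext (adj_eq ((isAdjointPair_adj T).smul c))

instance : CStarAlgebra E.adjointable where

theorem smul_complex_smul (b : B) (c : ℂ) (x : E.carrier) : b • c • x = c • b • x := by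
  rw [← smul_one_smul B c x, smul_smul, mul_smul_comm, mul_one, smul_assoc]

variable (E) in
/-- The left action of an element of `B`, as a bounded operator. -/
def leftL (b : B) : E.carrier →L[ℂ] E.carrier :=
  LinearMap.mkContinuous
    { toFun := fun x => b • x
      map_add' := smul_add b
      map_smul' := smul_complex_smul b } ‖b‖ (norm_smul_le_left b)

theorem isAdjointPair_leftL (b : B) : E.IsAdjointPair (E.leftL b) (E.leftL (star b)) :=
  E.rinner_smul_left b

variable (E) in
/-- The left action of `B` as a `*`-homomorphism to the adjointable operators. -/
def leftHom : B →⋆ₐ[ℂ] E.adjointable where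
  toFun b := ⟨E.leftL b, _, isAdjointPair_leftL b⟩
  map_one' := Subtype.ext (ContinuousLinearMap.ext fun x => one_smul B x)
  map_mul' a b := Subtype.ext (ContinuousLinearMap.ext fun x => mul_smul a b x)
  map_zero' := Subtype.ext (ContinuousLinearMap.ext fun x => zero_smul B x)
  map_add' a b := Subtype.ext (ContinuousLinearMap.ext fun x => add_smul a b x)
  commutes' c := Subtype.ext (ContinuousLinearMap.ext fun x => by
    change algebraMap ℂ B c • x = c • x
    rw [Algebra.algebraMap_eq_smul_one, smul_assoc, one_smul])
  map_star' b := Subtype.ext (adj_eq (isAdjointPair_leftL b)).symm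

end Correspondence

/-! ### Ladder operators and the covariant representations they define -/

namespace PreCorrespondence

variable {P Q : PreCorrespondence B}

variable (P) in
theorem rinner_zero_right (u : P.carrier) : P.rinner u 0 = 0 := map_zero (P.sesq u)

variable (P) in
theorem rinner_zero_left (u : P.carrier) : P.rinner 0 u = 0 :=
  LinearMap.congr_fun (map_zero P.sesq) u

theorem norm_le_of_rinner_self_eq {u : P.carrier} {w : Q.carrier} {b : B}
    (h : Q.rinner w w = P.rinner u (b • u)) : ‖w‖ ≤ √‖b‖ * ‖u‖ := by
  refine (pow_le_pow_iff_left₀ (norm_nonneg _) (by positivity) two_ne_zero).1 ?_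
  calc ‖w‖ ^ 2 = ‖P.rinner u (b • u)‖ := by rw [Q.norm_sq, h]
    _ ≤ ‖u‖ * ‖b • u‖ := P.norm_rinner_le _ _
    _ ≤ ‖u‖ * (‖b‖ * ‖u‖) := by gcongr; exact P.norm_smul_le_left b u
    _ = (√‖b‖ * ‖u‖) ^ 2 := by rw [mul_pow, Real.sq_sqrt (norm_nonneg _)]; ring

variable (P)

/-- The canonical map to the completion. -/
def toCompletion (u : P.carrier) : P.completion.carrier := Completion.coe' u

theorem rinner_toCompletion (u v : P.carrier) :
    P.completion.rinner (P.toCompletion u) (P.toCompletion v) = P.rinner u v :=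
  P.completionInner_coe u v

theorem smul_toCompletion (b : B) (u : P.carrier) :
    b • P.toCompletion u = P.toCompletion (b • u) := (Completion.coe_smul b u).symm

variable {P}

theorem completion_ext {T S : P.completion.carrier →L[ℂ] P.completion.carrier}
    (h : ∀ u, T (P.toCompletion u) = S (P.toCompletion u)) : T = S :=
  ContinuousLinearMap.ext fun x => Completion.induction_on (α := P.carrier) x
    (isClosed_eq T.continuous S.continuous) h

/-- The extension of a bounded operator to the completion. -/
def extendOp (T : P.carrier →ₗ[ℂ] P.carrier) {r : ℝ} (hr : ∀ u, ‖T u‖ ≤ r * ‖u‖) :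
    P.completion.carrier →L[ℂ] P.completion.carrier :=
  ((Completion.toComplL (𝕜 := ℂ) (E := P.carrier)).comp (T.mkContinuous r hr)).extend
    (Completion.toComplL (𝕜 := ℂ) (E := P.carrier))

theorem extendOp_toCompletion (T : P.carrier →ₗ[ℂ] P.carrier) {r : ℝ}
    (hr : ∀ u, ‖T u‖ ≤ r * ‖u‖) (u : P.carrier) :
    extendOp T hr (P.toCompletion u) = P.toCompletion (T u) :=
  ContinuousLinearMap.extend_eq
    ((Completion.toComplL (𝕜 := ℂ) (E := P.carrier)).comp (T.mkContinuous r hr))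
    Completion.denseRange_coe (Completion.isUniformInducing_coe _) _

theorem isAdjointPair_extendOp {T S : P.carrier →ₗ[ℂ] P.carrier}
    (h : ∀ u v, P.rinner (T u) v = P.rinner u (S v)) {r s : ℝ} (hr : ∀ u, ‖T u‖ ≤ r * ‖u‖)
    (hs : ∀ u, ‖S u‖ ≤ s * ‖u‖) :
    P.completion.IsAdjointPair (extendOp T hr) (extendOp S hs) := by
  intro x y
  refine Completion.induction_on (α := P.carrier) x (isClosed_eq
    ((Correspondence.continuous_rinner_left (M := P.completion) y).comp
      (extendOp T hr).continuous)
    (Correspondence.continuous_rinner_left (M := P.completion) _)) fun u => ?_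
  refine Completion.induction_on (α := P.carrier) y (isClosed_eq
    (Correspondence.continuous_rinner_right (M := P.completion) _)
    ((Correspondence.continuous_rinner_right (M := P.completion) _).comp
      (extendOp S hs).continuous)) fun v => ?_
  change P.completion.rinner (extendOp T hr (P.toCompletion u)) (P.toCompletion v) =
    P.completion.rinner (P.toCompletion u) (extendOp S hs (P.toCompletion v))
  rw [extendOp_toCompletion, extendOp_toCompletion, rinner_toCompletion, rinner_toCompletion, h]

end PreCorrespondence

/-- Creation and annihilation operators of a bimodule `N` between two pre-correspondences: the
relations of a covariant representation, for operators that need not be defined on the same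
space. -/
structure Ladder (N : HilbertBimodule B) (P Q : PreCorrespondence B) where
  create : N.carrier → P.carrier →ₗ[ℂ] Q.carrier
  annihilate : N.carrier → Q.carrier →ₗ[ℂ] P.carrier
  rinner_create : ∀ x u v, Q.rinner (create x u) v = P.rinner u (annihilate x v)
  annihilate_create : ∀ x y u, annihilate x (create y u) = N.rinner x y • u
  create_annihilate : ∀ x y v, create x (annihilate y v) = N.linner x y • v

namespace Ladder

open PreCorrespondence

variable {N : HilbertBimodule B} {P Q : PreCorrespondence B}

theorem rinner_annihilate (l : Ladder N P Q) (x : N.carrier) (v : Q.carrier) (u : P.carrier) :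
    P.rinner (l.annihilate x v) u = Q.rinner v (l.create x u) := by
  rw [← P.star_rinner, ← l.rinner_create, Q.star_rinner]

theorem norm_create_le (l : Ladder N P Q) (x : N.carrier) (u : P.carrier) :
    ‖l.create x u‖ ≤ √‖N.rinner x x‖ * ‖u‖ :=
  norm_le_of_rinner_self_eq (by rw [l.rinner_create, l.annihilate_create])

theorem norm_annihilate_le (l : Ladder N P Q) (x : N.carrier) (v : Q.carrier) :
    ‖l.annihilate x v‖ ≤ √‖N.linner x x‖ * ‖v‖ :=
  norm_le_of_rinner_self_eq (by rw [l.rinner_annihilate, l.create_annihilate])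

variable (l : Ladder N P P)

theorem isAdjointPair_extendOp_create (x : N.carrier) :
    P.completion.IsAdjointPair (extendOp (l.create x) (l.norm_create_le x))
      (extendOp (l.annihilate x) (l.norm_annihilate_le x)) :=
  isAdjointPair_extendOp (l.rinner_create x) _ _

/-- The creation operators on the completion. -/
def createOp (x : N.carrier) : P.completion.adjointable :=
  ⟨_, _, l.isAdjointPair_extendOp_create x⟩

theorem createOp_toCompletion (x : N.carrier) (u : P.carrier) :
    (l.createOp x).1 (P.toCompletion u) = P.toCompletion (l.create x u) :=
  extendOp_toCompletion _ _ u

theorem star_createOp_toCompletion (x : N.carrier) (u : P.carrier) :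
    (star (l.createOp x)).1 (P.toCompletion u) = P.toCompletion (l.annihilate x u) := by
  have : (star (l.createOp x)).1 = extendOp (l.annihilate x) (l.norm_annihilate_le x) :=
    Correspondence.adj_eq (l.isAdjointPair_extendOp_create x)
  rw [this, extendOp_toCompletion]

/-- The covariant representation by creation operators on the completion. -/
def covariantRep (hP : ∀ b : B, (∀ u : P.carrier, P.rinner (b • u) (b • u) = 0) → b = 0) :
    CovariantRep N P.completion.adjointable where
  π := P.completion.leftHom
  t := l.createOp
  star_t_mul x y := Subtype.ext <| completion_ext fun u => by
    change (star (l.createOp x)).1 ((l.createOp y).1 (P.toCompletion u)) =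
      N.rinner x y • P.toCompletion u
    rw [createOp_toCompletion, star_createOp_toCompletion, l.annihilate_create, smul_toCompletion]
  t_mul_star x y := Subtype.ext <| completion_ext fun u => by
    change (l.createOp x).1 ((star (l.createOp y)).1 (P.toCompletion u)) =
      N.linner x y • P.toCompletion u
    rw [star_createOp_toCompletion, createOp_toCompletion, l.create_annihilate, smul_toCompletion]
  injective := (injective_iff_map_eq_zero _).2 fun b hb => hP b fun u => by
    have : b • P.toCompletion u = 0 :=
      congrArg (fun T : P.completion.adjointable => T.1 (P.toCompletion u)) hb
    rw [smul_toCompletion] at this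
    rw [← rinner_toCompletion, this, Correspondence.rinner_zero_left]

end Ladder

/-! ### Direct sums of pre-correspondences -/

namespace PreCorrespondence

section DirectSum

variable {ι : Type} [DecidableEq ι] (L : ι → PreCorrespondence B)

/-- The underlying space of the algebraic direct sum of pre-correspondences. -/
abbrev DirectSumCarrier : Type u := Π₀ i, (L i).carrier

variable {L}

/-- The map `v ↦ ∑ i, ⟨u i, v i⟩` on an algebraic direct sum. -/
def directSumInner (u : DirectSumCarrier L) : DirectSumCarrier L →ₗ[ℂ] B :=
  DFinsupp.lsum ℂ fun i => (L i).sesq (u i)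

theorem directSumInner_single (u : DirectSumCarrier L) (i : ι) (m : (L i).carrier) :
    directSumInner u (DFinsupp.single i m) = (L i).rinner (u i) m :=
  DFinsupp.lsum_single ..

theorem directSumInner_zero : directSumInner (0 : DirectSumCarrier L) = 0 :=
  DFinsupp.lhom_ext fun i m => by
    rw [directSumInner_single, DFinsupp.zero_apply, rinner_zero_left, LinearMap.zero_apply]

theorem directSumInner_add (u u' : DirectSumCarrier L) :
    directSumInner (u + u') = directSumInner u + directSumInner u' :=
  DFinsupp.lhom_ext fun i m => by
    rw [LinearMap.add_apply, directSumInner_single, directSumInner_single, directSumInner_single,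
      DFinsupp.add_apply, rinner_add_left]

theorem directSumInner_single_left (i : ι) (m : (L i).carrier) (v : DirectSumCarrier L) :
    directSumInner (DFinsupp.single i m) v = (L i).rinner m (v i) := by
  suffices directSumInner (DFinsupp.single i m) = (L i).sesq m ∘ₗ DFinsupp.lapply i from
    LinearMap.congr_fun this v
  refine DFinsupp.lhom_ext fun j n => ?_
  rw [LinearMap.comp_apply, DFinsupp.lapply_apply, sesq_apply, directSumInner_single]
  by_cases h : i = j
  · subst h; rw [DFinsupp.single_eq_same, DFinsupp.single_eq_same]
  · rw [DFinsupp.single_eq_of_ne (Ne.symm h), DFinsupp.single_eq_of_ne h, rinner_zero_left,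
      rinner_zero_right]

theorem directSumInner_smul_single (i : ι) (b : B) (m : (L i).carrier) :
    directSumInner (b • DFinsupp.single i m : DirectSumCarrier L) (b • DFinsupp.single i m) =
      (L i).rinner (b • m) (b • m) := by
  rw [← DFinsupp.single_smul, directSumInner_single, DFinsupp.single_eq_same]

variable (L)

/-- The algebraic direct sum of pre-correspondences. -/
def directSum : PreCorrespondence B where
  carrier := DirectSumCarrier L
  rinner u v := directSumInner u v
  rinner_add_right u := map_add _
  rinner_op_smul_right u v b := by
    induction v using DFinsupp.induction with
    | h0 => rw [smul_zero, map_zero, zero_mul]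
    | ha i m v _ _ hv =>
      rw [smul_add, map_add, map_add, hv, ← DFinsupp.single_smul, directSumInner_single,
        directSumInner_single, (L i).rinner_op_smul_right, add_mul]
  star_rinner u v := by
    induction v using DFinsupp.induction with
    | h0 => rw [map_zero, star_zero, directSumInner_zero, LinearMap.zero_apply]
    | ha i m v _ _ hv =>
      rw [map_add, star_add, hv, directSumInner_add, LinearMap.add_apply, directSumInner_single,
        directSumInner_single_left, (L i).star_rinner]
  rinner_smul_left b u v := by
    induction v using DFinsupp.induction with
    | h0 => rw [smul_zero, map_zero, map_zero]
    | ha i m v _ _ hv =>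
      rw [smul_add, map_add, map_add, hv, ← DFinsupp.single_smul, directSumInner_single,
        directSumInner_single, DFinsupp.smul_apply, (L i).rinner_smul_left]
  rinner_self_nonneg u := by
    classical
    let _ := CStarAlgebra.spectralOrder B
    let _ := CStarAlgebra.spectralOrderedRing B
    rw [← CStarAlgebra.nonneg_iff_eq_star_mul_self, directSumInner, DFinsupp.lsum_apply_apply,
      DFinsupp.sumAddHom_apply]
    refine Finset.sum_nonneg fun i _ => ?_
    exact CStarAlgebra.nonneg_iff_eq_star_mul_self.2 ((L i).rinner_self_nonneg (u i))

end DirectSum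

end PreCorrespondence

namespace Ladder

open PreCorrespondence

variable {N : HilbertBimodule B} {L : ℤ → PreCorrespondence B}
  (l : ∀ i j : ℤ, i + 1 = j → Ladder N (L i) (L j))

/-- The creation operators on a graded direct sum. -/
def sumCreate (x : N.carrier) : DirectSumCarrier L →ₗ[ℂ] DirectSumCarrier L :=
  DFinsupp.lsum ℂ fun i => DFinsupp.lsingle (i + 1) ∘ₗ (l i (i + 1) rfl).create x

/-- The annihilation operators on a graded direct sum. -/
def sumAnnihilate (x : N.carrier) : DirectSumCarrier L →ₗ[ℂ] DirectSumCarrier L :=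
  DFinsupp.lsum ℂ fun j =>
    DFinsupp.lsingle (j - 1) ∘ₗ (l (j - 1) j (sub_add_cancel j 1)).annihilate x

theorem sumCreate_single {i j : ℤ} (h : i + 1 = j) (x : N.carrier) (m : (L i).carrier) :
    sumCreate l x (DFinsupp.single i m) = DFinsupp.single j ((l i j h).create x m) := by
  subst h
  exact DFinsupp.lsum_single ..

theorem sumAnnihilate_single {i j : ℤ} (h : i + 1 = j) (x : N.carrier) (m : (L j).carrier) :
    sumAnnihilate l x (DFinsupp.single j m) = DFinsupp.single i ((l i j h).annihilate x m) := by
  obtain rfl : i = j - 1 := eq_sub_of_add_eq h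
  exact DFinsupp.lsum_single ..

theorem directSumInner_sumCreate_single (x : N.carrier) (i : ℤ) (m : (L i).carrier)
    (v : DirectSumCarrier L) : directSumInner (sumCreate l x (DFinsupp.single i m)) v =
      directSumInner (DFinsupp.single i m) (sumAnnihilate l x v) := by
  induction v using DFinsupp.induction with
  | h0 => rw [map_zero, map_zero, map_zero]
  | ha j z v _ _ hv =>
    rw [map_add, map_add, map_add, hv]
    congr 1
    by_cases hij : i + 1 = j
    · rw [sumCreate_single l hij, sumAnnihilate_single l hij, directSumInner_single,
        directSumInner_single, DFinsupp.single_eq_same, DFinsupp.single_eq_same,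
        (l i j hij).rinner_create]
    · rw [sumCreate_single l rfl, sumAnnihilate_single l (sub_add_cancel j 1),
        directSumInner_single, directSumInner_single, DFinsupp.single_eq_of_ne (by lia),
        DFinsupp.single_eq_of_ne (by lia), rinner_zero_left, rinner_zero_left]

theorem directSumInner_sumCreate (x : N.carrier) (u v : DirectSumCarrier L) :
    directSumInner (sumCreate l x u) v = directSumInner u (sumAnnihilate l x v) := by
  induction u using DFinsupp.induction with
  | h0 => rw [map_zero, directSumInner_zero, LinearMap.zero_apply, LinearMap.zero_apply]
  | ha i m u _ _ hu =>
    rw [map_add, directSumInner_add, directSumInner_add, LinearMap.add_apply,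
      LinearMap.add_apply, hu, directSumInner_sumCreate_single]

theorem sumAnnihilate_sumCreate (x y : N.carrier) (u : DirectSumCarrier L) :
    sumAnnihilate l x (sumCreate l y u) = N.rinner x y • u := by
  induction u using DFinsupp.induction with
  | h0 => rw [map_zero, map_zero, smul_zero]
  | ha i m u _ _ hu =>
    rw [map_add, map_add, smul_add, hu, sumCreate_single l rfl, sumAnnihilate_single l rfl,
      (l i _ rfl).annihilate_create, DFinsupp.single_smul]

theorem sumCreate_sumAnnihilate (x y : N.carrier) (u : DirectSumCarrier L) :
    sumCreate l x (sumAnnihilate l y u) = N.linner x y • u := by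
  induction u using DFinsupp.induction with
  | h0 => rw [map_zero, map_zero, smul_zero]
  | ha i m u _ _ hu =>
    rw [map_add, map_add, smul_add, hu, sumAnnihilate_single l (sub_add_cancel i 1),
      sumCreate_single l (sub_add_cancel i 1), Ladder.create_annihilate, DFinsupp.single_smul]

/-- Ladder operators between consecutive summands combine to ladder operators on the direct
sum. -/
def sum : Ladder N (directSum L) (directSum L) where
  create := sumCreate l
  annihilate := sumAnnihilate l
  rinner_create := directSumInner_sumCreate l
  annihilate_create := sumAnnihilate_sumCreate l
  create_annihilate := sumCreate_sumAnnihilate l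

end Ladder

/-! ### The Fock representation -/

namespace Correspondence

variable {K M : Correspondence B}

/-- The map `z ⊗ y ↦ ⟨x, z⟩ y` on the algebraic tensor product. -/
def preAnnihilate (M : Correspondence B) (x : K.carrier) : TensorCarrier K M →ₗ[ℂ] M.carrier :=
  TensorCarrier.lift <| LinearMap.mk₂ ℂ (fun z y => K.rinner x z • y)
    (fun z z' y => by rw [K.rinner_add_right, add_smul])
    (fun c z y => by rw [K.rinner_smul_right, smul_assoc])
    (fun z => smul_add _)
    (fun c z y => smul_complex_smul _ c y)

theorem rinner_preAnnihilate (x : K.carrier) (y : M.carrier) (s : TensorCarrier K M) :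
    M.rinner y (preAnnihilate M x s) = TensorCarrier.sesq K M (TensorCarrier.tmul x y) s := by
  induction s using TensorCarrier.induction with
  | h z w => rw [preAnnihilate, TensorCarrier.lift_tmul, LinearMap.mk₂_apply,
      TensorCarrier.sesq_tmul]
  | hadd s t hs ht => rw [map_add, map_add, M.rinner_add_right, hs, ht]

theorem norm_preAnnihilate_le (x : K.carrier) (s : (preTensor K M).carrier) :
    ‖preAnnihilate M x s‖ ≤ ‖x‖ * ‖s‖ := by
  set w := preAnnihilate M x s
  let tensor_x_w : (preTensor K M).carrier := TensorCarrier.tmul x w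
  have norm_tensor_x_w : ‖tensor_x_w‖ = ‖tmul x w‖ :=
    (Completion.norm_coe (E := (preTensor K M).carrier) tensor_x_w).symm
  have norm_sq_le : ‖w‖ * ‖w‖ ≤ ‖x‖ * ‖s‖ * ‖w‖ :=
    calc ‖w‖ * ‖w‖ = ‖(preTensor K M).rinner tensor_x_w s‖ := by
          rw [← sq, M.norm_sq_eq_rinner]
          exact congrArg _ (rinner_preAnnihilate x w s)
      _ ≤ ‖tensor_x_w‖ * ‖s‖ := (preTensor K M).norm_rinner_le tensor_x_w s
      _ ≤ ‖x‖ * ‖w‖ * ‖s‖ := by rw [norm_tensor_x_w]; gcongr; exact norm_tmul_le x w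
      _ = ‖x‖ * ‖s‖ * ‖w‖ := by ring
  rcases (norm_nonneg w).eq_or_lt' with hw | hw
  · rw [hw]; positivity
  · exact le_of_mul_le_mul_right norm_sq_le hw

/-- The annihilation operator `z ⊗ y ↦ ⟨x, z⟩ y`. -/
def annihilate (M : Correspondence B) (x : K.carrier) : (tensor K M).carrier →L[ℂ] M.carrier :=
  extendTensor <| LinearMap.mkContinuous (E := (preTensor K M).carrier) (preAnnihilate M x) ‖x‖
    (norm_preAnnihilate_le x)

theorem annihilate_tmul (x z : K.carrier) (y : M.carrier) :
    annihilate M x (tmul z y) = K.rinner x z • y :=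
  extendTensor_tmul _ z y

theorem rinner_tmul_left (x : K.carrier) (y : M.carrier) (u : (tensor K M).carrier) :
    (tensor K M).rinner (tmul x y) u = M.rinner y (annihilate M x u) := by
  induction u using tensor_induction with
  | isClosed =>
    exact isClosed_eq (continuous_rinner_right _)
      ((continuous_rinner_right _).comp (annihilate M x).continuous)
  | tmul z w => rw [rinner_tmul, annihilate_tmul]
  | add u v hu hv => rw [rinner_add_right, map_add, rinner_add_right, hu, hv]

theorem rinner_annihilate_left (x : K.carrier) (u : (tensor K M).carrier) (y : M.carrier) :
    M.rinner (annihilate M x u) y = (tensor K M).rinner u (tmul x y) := by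
  rw [← star_rinner, ← rinner_tmul_left, star_rinner]

theorem tmul_annihilate {K : HilbertBimodule B} (x y : K.carrier)
    (u : (tensor K.toCorrespondence M).carrier) :
    tmul x (annihilate M y u) = K.linner x y • u := by
  induction u using tensor_induction with
  | isClosed =>
    exact isClosed_eq ((continuous_tmul_right _).comp (annihilate M y).continuous)
      (continuous_smul_left _)
  | tmul z w => rw [annihilate_tmul, ← tmul_balanced, smul_tmul, K.linner_smul]
  | add u v hu hv => rw [map_add, tmul_add, smul_add, hu, hv]

/-- The tensor powers `B`, `K ⊗ B`, `K ⊗ (K ⊗ B)`, ... The factor `B` at the end makes the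
creation operators `u ↦ x ⊗ u` uniform in all degrees. -/
def fock (K : Correspondence B) : ℕ → Correspondence B
  | 0 => self B
  | n + 1 => tensor K (fock K n)

end Correspondence

namespace HilbertBimodule

open Correspondence PreCorrespondence

variable (N : HilbertBimodule B)

/-- Tensoring with the elements of `N` as creation operators. -/
def tensorLadder (M : Correspondence B) :
    Ladder N M.toPre (tensor N.toCorrespondence M).toPre where
  create x := (tmulL (M := N.toCorrespondence) M x).toLinearMap
  annihilate x := (annihilate (K := N.toCorrespondence) M x).toLinearMap
  rinner_create := rinner_tmul_left (K := N.toCorrespondence)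
  annihilate_create := annihilate_tmul (K := N.toCorrespondence)
  create_annihilate := tmul_annihilate (K := N)

/-- Tensoring with the elements of the dual of `N` as annihilation operators. -/
def dualTensorLadder (M : Correspondence B) :
    Ladder N (tensor N.dual.toCorrespondence M).toPre M.toPre where
  create x := (annihilate (K := N.dual.toCorrespondence) M (N.toDual x)).toLinearMap
  annihilate x := (tmulL (M := N.dual.toCorrespondence) M (N.toDual x)).toLinearMap
  rinner_create x := rinner_annihilate_left (K := N.dual.toCorrespondence) (N.toDual x)
  annihilate_create x y := tmul_annihilate (K := N.dual) (N.toDual x) (N.toDual y)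
  create_annihilate x y :=
    annihilate_tmul (K := N.dual.toCorrespondence) (N.toDual x) (N.toDual y)

/-- The degree `k` part of the two-sided Fock module of `N`. -/
def twoSidedFock : ℤ → Correspondence B
  | Int.ofNat n => fock N.toCorrespondence n
  | Int.negSucc n => fock N.dual.toCorrespondence (n + 1)

/-- The creation and annihilation operators between consecutive degrees of the two-sided Fock
module. -/
def fockLadder (i j : ℤ) (h : i + 1 = j) :
    Ladder N (N.twoSidedFock i).toPre (N.twoSidedFock j).toPre :=
  h ▸ match i with
    | Int.ofNat n => N.tensorLadder (fock N.toCorrespondence n)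
    | Int.negSucc 0 => N.dualTensorLadder (fock N.dual.toCorrespondence 0)
    | Int.negSucc (n + 1) => N.dualTensorLadder (fock N.dual.toCorrespondence (n + 1))

/-- The algebraic two-sided Fock module of `N`. -/
def preFock : PreCorrespondence B := directSum fun i => (N.twoSidedFock i).toPre

theorem eq_zero_of_rinner_smul_preFock {b : B}
    (hb : ∀ u : N.preFock.carrier, N.preFock.rinner (b • u) (b • u) = 0) : b = 0 := by
  have vacuum : star (b * 1) * (b * 1) = 0 :=
    (directSumInner_smul_single (L := fun i => (N.twoSidedFock i).toPre) 0 b (1 : B)).symm.trans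
      (hb _)
  rwa [mul_one, CStarRing.star_mul_self_eq_zero_iff] at vacuum

/-- The covariant representation of `N` by creation operators on its two-sided Fock module. -/
def fockRep : CovariantRep N N.preFock.completion.adjointable :=
  (Ladder.sum N.fockLadder).covariantRep fun _ => N.eq_zero_of_rinner_smul_preFock

end HilbertBimodule

/-! ### The classification -/

namespace CovariantRep

open CStarDynamicalSystem SO2

variable {N : HilbertBimodule B} {C : Type u} [CStarAlgebra C]

/-- The constant functions, as a `*`-homomorphism. -/
def constHom (C : Type u) [CStarAlgebra C] : C →⋆ₐ[ℂ] C(SO2, C) where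
  toFun := ContinuousMap.const SO2
  map_one' := rfl
  map_mul' _ _ := rfl
  map_zero' := rfl
  map_add' _ _ := rfl
  commutes' _ := rfl
  map_star' _ := rfl

/-- The covariant representation in `C(SO(2), C)` obtained by placing the bimodule in degree
one. -/
def twist (ρ : CovariantRep N C) : CovariantRep N (translation (G := SO2) C).A where
  π := (constHom C).comp ρ.π
  t x := charFunL 1 (ρ.t x)
  star_t_mul x y := ContinuousMap.ext fun g => by
    change star (g.character ^ (1 : ℤ) • ρ.t x) * (g.character ^ (1 : ℤ) • ρ.t y) = ρ.π _
    rw [zpow_one, star_smul, smul_mul_smul_comm, ρ.star_t_mul, ← starRingEnd_apply,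
      g.conj_character_mul, one_smul]
  t_mul_star x y := ContinuousMap.ext fun g => by
    change (g.character ^ (1 : ℤ) • ρ.t x) * star (g.character ^ (1 : ℤ) • ρ.t y) = ρ.π _
    rw [zpow_one, star_smul, smul_mul_smul_comm, ρ.t_mul_star, ← starRingEnd_apply,
      g.character_mul_conj, one_smul]
  injective a b h := ρ.injective (congrArg (fun f : C(SO2, C) => f 1) h)

theorem isHomogeneous_twist (ρ : CovariantRep N C) : ρ.twist.IsHomogeneous where
  π_mem _ := mem_isotypicComponent_zero.2 fun _ => rfl
  t_mem x := charFunL_mem_isotypicComponent_translation 1 (ρ.t x)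

end CovariantRep

namespace FreeSystem

theorem exists_iso_isotypic_one (N : MoritaBimodule B) :
    ∃ S : FreeSystem B, Nonempty (HilbertBimodule.Iso N.toHilbertBimodule (S.isotypic 1)) :=
  ⟨_, ⟨CovariantRep.oneIso N.fockRep.isHomogeneous_twist N.isMorita⟩⟩

section Equivariant

variable {S T : FreeSystem B} (φ : S.A ≃⋆ₐ[ℂ] T.A)
  (hα : ∀ (g : SO2) (x : S.A), φ (S.α g x) = T.α g (φ x)) (k : ℤ)

/-- The restriction of an equivariant isomorphism to isotypic components. -/
def isotypicEquiv : (S.isotypic k).carrier ≃ₗ[ℂ] (T.isotypic k).carrier where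
  toFun x := isotypicMk (φ (S.valL k x)) fun g => by rw [← hα, valL_mem x g, map_smul]
  invFun x := isotypicMk (φ.symm (T.valL k x)) fun g => by
    apply EquivLike.injective φ
    rw [hα, map_smul, StarAlgEquiv.apply_symm_apply, valL_mem x g]
  map_add' x y := valL_injective (map_add φ (S.valL k x) (S.valL k y))
  map_smul' c x := valL_injective (map_smul φ c (S.valL k x))
  left_inv x := valL_injective (φ.symm_apply_apply (S.valL k x))
  right_inv x := valL_injective (φ.apply_symm_apply (T.valL k x))

theorem valL_isotypicEquiv (x : (S.isotypic k).carrier) :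
    T.valL k (isotypicEquiv φ hα k x) = φ (S.valL k x) := rfl

/-- The bimodule isomorphism of isotypic components induced by an equivalence of free systems. -/
def isotypicIso (hι : ∀ b, φ (S.ι b) = T.ι b) :
    HilbertBimodule.Iso (S.isotypic k) (T.isotypic k) where
  toEquiv := isotypicEquiv φ hα k
  map_smul_left b x := valL_injective (by
    rw [valL_isotypicEquiv, valL_smul, valL_smul, valL_isotypicEquiv, map_mul, hι])
  map_smul_right b x := valL_injective (by
    rw [valL_isotypicEquiv, valL_op_smul, valL_op_smul, valL_isotypicEquiv, map_mul, hι])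
  map_rinner x y := T.ι_injective (by
    rw [ι_rinner, ← hι, ι_rinner, map_mul, map_star, valL_isotypicEquiv, valL_isotypicEquiv])
  map_linner x y := T.ι_injective (by
    rw [ι_linner, ← hι, ι_linner, map_mul, map_star, valL_isotypicEquiv, valL_isotypicEquiv])

end Equivariant

/-- The map from equivalence classes of free systems to the Picard set. -/
def picMap (B : Type u) [CStarAlgebra B] : FreeExt B → Pic B :=
  Quotient.lift (fun S => MoritaBimodule.toPic ⟨S.isotypic 1, S.isMorita 1⟩) fun _ _ ⟨φ, hι, hα⟩ =>
    Quotient.sound ⟨isotypicIso φ hα 1 hι⟩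

theorem picMap_toFreeExt (S : FreeSystem B) :
    picMap B S.toFreeExt = MoritaBimodule.toPic ⟨S.isotypic 1, S.isMorita 1⟩ := rfl

theorem picMap_toFreeExt_eq_iff (S : FreeSystem B) (N : MoritaBimodule B) :
    picMap B S.toFreeExt = N.toPic ↔
      Nonempty (HilbertBimodule.Iso N.toHilbertBimodule (S.isotypic 1)) :=
  eq_comm.trans Quotient.eq

theorem picMap_injective : Function.Injective (picMap B) := fun s t =>
  Quotient.inductionOn₂ s t fun S T h => by
    obtain ⟨u⟩ := (picMap_toFreeExt_eq_iff T ⟨S.isotypic 1, S.isMorita 1⟩).1 h.symm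
    exact Quotient.sound (exists_starAlgEquiv_of_iso u)

theorem picMap_surjective : Function.Surjective (picMap B) := Quotient.ind fun N => by
  obtain ⟨S, hS⟩ := exists_iso_isotypic_one N
  exact ⟨S.toFreeExt, (picMap_toFreeExt_eq_iff S N).2 hS⟩

theorem nonempty_iso_iff_hasFactorSystem {N : HilbertBimodule B} (F : N.FactorSystem)
    (S : FreeSystem B) :
    Nonempty (HilbertBimodule.Iso N (S.isotypic 1)) ↔ S.HasFactorSystem F := by
  constructor
  · rintro ⟨φ⟩
    rw [eq_factorSystem φ F]
    exact hasFactorSystem φ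
  · rintro ⟨φ, -, -⟩
    exact ⟨⟨φ 1, HilbertBimodule.linner_eq_of_iso (M := N) (S.isMorita 1) (φ 1)⟩⟩

end FreeSystem

end

theorem mainTheorem4 (B : Type u) [CStarAlgebra B] :
    ∃ isMorita : ∀ (S : FreeSystem B) (k : ℤ), (S.isotypic k).IsMorita,
    ∃ Φ : FreeExt B ≃ Pic B,
      (∀ S : FreeSystem B, Φ S.toFreeExt = MoritaBimodule.toPic ⟨S.isotypic 1, isMorita S 1⟩) ∧
      ∀ N : MoritaBimodule B, ∃ F : N.FactorSystem, (∀ F' : N.FactorSystem, F' = F) ∧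
        ∀ S : FreeSystem B, Φ.symm N.toPic = S.toFreeExt ↔ S.HasFactorSystem F := by
  refine ⟨FreeSystem.isMorita,
    Equiv.ofBijective _ ⟨FreeSystem.picMap_injective, FreeSystem.picMap_surjective⟩,
    FreeSystem.picMap_toFreeExt, fun N => ?_⟩
  obtain ⟨S₀, ⟨φ₀⟩⟩ := FreeSystem.exists_iso_isotypic_one N
  refine ⟨FreeSystem.factorSystem φ₀, FreeSystem.eq_factorSystem φ₀, fun S => ?_⟩
  rw [Equiv.symm_apply_eq, eq_comm, ← FreeSystem.nonempty_iso_iff_hasFactorSystem]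
  exact FreeSystem.picMap_toFreeExt_eq_iff S N
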